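/- **Setting.** Fix $N,n,\nu\in\mathbb N$ and $\nu$-parameter dilations on $\mathbb R^N$: vectors $0\neq e_1,\dots,e_N\in\mathbb N^\nu$. For $\delta\in[0,\infty)^\nu$ and $d\in\mathbb N^\nu$ put $\delta^d=\prod_\mu\delta_\mu^{d^\mu}$, $\delta t=(\delta^{e_1}t_1,\dots,\delta^{e_N}t_N)$ for $t\in\mathbb R^N$, and $\deg(\alpha)=\sum_j\alpha_je_j\in\mathbb N^\nu$ for $\alpha\in\mathbb N^N$. Let $\gamma(t,x)=\gamma_t(x)$ be a germ at $(0,0)\in\mathbb R^N\times\mathbb R^n$ of a real analytic function with values in $\mathbb R^n$ such that $\gamma_0(x)\equiv x$. Put $$W(t,x)=\frac{d}{d\epsilon}\Big|_{\epsilon=1}\gamma_{\epsilon t}\circ\gamma_t^{-1}(x),\qquad \hat X_\alpha=\frac1{\alpha!}\partial_t^\alpha W(t,\cdot)\big|_{t=0}\quad(0\neq\alpha\in\mathbb N^N),$$ and let $X_\alpha$ ($0\ne\alpha\in\mathbb N^N$) be germs at $0$ of real analytic vector fields with $\gamma_t(x)\sim\exp\big(\sum_{|\alpha|>0}t^\alpha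 X_\alpha\big)x$, i.e. for every $M$, $\gamma_t(x)=\exp\big(\sum_{0<|\alpha|<M}t^\alpha X_\alpha\big)x+O(|t|^M)$ as $t\to0$, uniformly for $x$ near $0$. **Balls.** Let $(X,d)=(X_1,d_1),\dots,(X_q,d_q)$ be a finite list of $C^\infty$ vector fields on an open set $\Omega\subseteq\mathbb R^n$ with formal degrees $0\neq d_j\in\mathbb N^\nu$. Write $\delta X=(\delta^{d_1}X_1,\dots,\delta^{d_q}X_q)$. The ball $B_{(X,d)}(x_0,\delta)$ is the set of end points $\sigma(1)$ of absolutely continuous curves $\sigma:[0,1]\to\Omega$ with $\sigma(0)=x_0$, $\sigma'=\sum_ja_j\,\delta^{d_j}X_j(\sigma)$ a.e., $a_j\in L^\infty([0,1])$, $\big\|(\sum_j|a_j|^2)^{1/2}\big\|_{L^\infty}<1$. **Control.** $(X,d)$ *controls* $(X_0,d_0)$ if there are an open $U$ with $0\in U\subseteq\Omega$ and $\tau_1>0$ such that for all $\delta\in[0,1]^\nu$ and $x\in U$ there are continuous functions $c^\delta_{x,j}$ on $B_{(X,d)}(x,\tau_1\delta)$ with $\delta^{d_0}X_0=\sum_jc^\delta_{x,j}\,\delta^{d_j}X_j$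 on $B_{(X,d)}(x,\tau_1\delta)$ and, for every $m$, $\sup_{\delta,x}\sum_{|\beta|\le m}\|(\delta X)^\beta c^\delta_{x,j}\|_{C^0(B_{(X,d)}(x,\tau_1\delta))}<\infty$. Here $\beta$ runs over ordered multi-indices, $X_jf(y)=\frac{d}{ds}\big|_{s=0}f(e^{sX_j}y)$, and finiteness includes that the derivatives exist and are continuous. Likewise $(X,d)$ *controls* $W$ if there are $U,\tau_1$ as above and $\rho_1>0$ such that for all $\delta\in[0,1]^\nu$ and $x_0\in U$ there are functions $c_l^{x_0,\delta}$ on $S=\{|t|<\rho_1\}\times B_{(X,d)}(x_0,\tau_1\delta)$ with $W(\delta t,x)=\sum_lc_l^{x_0,\delta}(t,x)\,\delta^{d_l}X_l(x)$ on $S$ and, for every $m$, $\sup_{\delta,x_0}\sum_{|\alpha|+|\beta|\le m}\|(\delta X)^\alpha\partial_t^\beta c_l^{x_0,\delta}\|_{C^0(S)}<\infty$. For germs at $0$, $\Omega$ may be any neighbourhood of $0$ on which they are defined. **Finite lists.** For a set $\mathcal S$ of vector fields with formal degrees, $\mathcal L_0(\mathcal S)$ is the smallest set containing $\mathcal S$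 and containing $([X_1,X_2],d_1+d_2)$ whenever $(X_1,d_1)\in\mathcal S$, $(X_2,d_2)\in\mathcal L_0(\mathcal S)$. A finite list $(X_1,d_1),\dots,(X_r,d_r)$ *generates the finite list* $(X_1,d_1),\dots,(X_q,d_q)$, $q\ge r$, if $(X_j,d_j)\in\mathcal L_0(\{(X_1,d_1),\dots,(X_r,d_r)\})$ for $r<j\le q$ and, for all $1\le j,k\le q$, $([X_j,X_k],d_j+d_k)$ is controlled by $(X_1,d_1),\dots,(X_q,d_q)$. **Proposition.** For real analytic $\gamma$ as above, both finite type conditions hold: (II.F) there is a finite subset of $\{(\hat X_\alpha,\deg(\alpha)):0\ne\alpha\in\mathbb N^N\}$ which generates a finite list that controls $W$; (III.F) the vector fields $X_\alpha$ exist, and for them there is a finite subset of $\{(X_\alpha,\deg(\alpha)):0\ne\alpha\in\mathbb N^N\}$ which generates a finite list that controls $W$. -/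

import Mathlib

open scoped Topology ContDiff

noncomputable section

namespace Radon

/-- Euclidean space `ℝⁿ`. -/
abbrev Rn (n : ℕ) := EuclideanSpace ℝ (Fin n)

/-- A vector field on `ℝⁿ` paired with a `ν`-parameter formal degree. Germs at `0` are represented
by total functions; every notion below depends only on the germ at `0` of the vector field. -/
abbrev FormalField (n ν : ℕ) := (Rn n → Rn n) × (Fin ν → ℕ)

/-- `δ ^ d = ∏_μ δ_μ ^ d_μ` for `δ ∈ [0,∞)^ν` and `d ∈ ℕ^ν`. -/
def dpow {ν : ℕ} (δ : Fin ν → ℝ) (d : Fin ν → ℕ) : ℝ := ∏ μ, δ μ ^ d μ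

/-- The dilation `δ t = (δ ^ e₁ t₁, …, δ ^ e_N t_N)` on `ℝ^N`. -/
def dilate {N ν : ℕ} (e : Fin N → Fin ν → ℕ) (δ : Fin ν → ℝ) (t : Rn N) : Rn N :=
  WithLp.toLp 2 fun j => dpow δ (e j) * t j

/-- `deg α = ∑_j α_j e_j ∈ ℕ^ν` for a multi-index `α ∈ ℕ^N`. -/
def deg {N ν : ℕ} (e : Fin N → Fin ν → ℕ) (α : Fin N → ℕ) : Fin ν → ℕ := ∑ j, α j • e j

/-- The monomial `t ^ α`. -/
def monomial {N : ℕ} (t : Rn N) (α : Fin N → ℕ) : ℝ := ∏ j, t j ^ α j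

/-! ### Carnot–Carathéodory balls and control -/

/-- The list `δX = (δ ^ d₁ X₁, …, δ ^ d_q X_q)`. -/
def scaled {n ν q : ℕ} (X : Fin q → FormalField n ν) (δ : Fin ν → ℝ) : Fin q → Rn n → Rn n :=
  fun j x => dpow δ (X j).2 • (X j).1 x

/-- The unit Carnot–Carathéodory ball in `Ω` centred at `x₀` for the list of vector fields `Y`:
the end points of the absolutely continuous curves `σ : [0,1] → Ω` starting at `x₀` with
`σ' = ∑_j a_j Y_j(σ)` (written in integrated form), where
`‖(∑_j |a_j|²)^{1/2}‖_{L^∞([0,1])} < 1`. -/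
def ccUnitBall {n q : ℕ} (Ω : Set (Rn n)) (Y : Fin q → Rn n → Rn n) (x₀ : Rn n) : Set (Rn n) :=
  {y | y ∈ Ω ∧ ∃ (σ : ℝ → Rn n) (a : ℝ → EuclideanSpace ℝ (Fin q)),
    MeasureTheory.MemLp a ⊤ (MeasureTheory.volume.restrict (Set.Icc (0 : ℝ) 1)) ∧
    MeasureTheory.eLpNorm a ⊤ (MeasureTheory.volume.restrict (Set.Icc (0 : ℝ) 1)) < 1 ∧
    ContinuousOn σ (Set.Icc 0 1) ∧ Set.MapsTo σ (Set.Icc 0 1) Ω ∧ σ 0 = x₀ ∧ σ 1 = y ∧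
    ∀ s ∈ Set.Icc (0 : ℝ) 1, σ s = x₀ + ∫ u in (0 : ℝ)..s, ∑ j, a u j • Y j (σ u)}

/-- The multi-parameter ball `B_{(X,d)}(x₀, δ) = B_{δX}(x₀)`. -/
def ccBall {n ν q : ℕ} (Ω : Set (Rn n)) (X : Fin q → FormalField n ν) (x₀ : Rn n)
    (δ : Fin ν → ℝ) : Set (Rn n) :=
  ccUnitBall Ω (scaled X δ) x₀

/-- `f` has derivative `f'` at `y` along the vector field `Y`, i.e.
`d/ds f(e^{sY} y) = f'` at `s = 0`. For `Y` of class `C¹` near `y` the integral curve through `y`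
exists and its germ is unique, so `f'` is unique. The derivative depends only on the values of `f`
along that curve, so this makes sense for `f` given on a Carnot–Carathéodory ball of a list
containing `Y`, even if the ball has empty interior in `ℝⁿ`. -/
def HasDerivAlong {E : Type*} [NormedAddCommGroup E] [NormedSpace ℝ E]
    (Y : E → E) (f : E → ℝ) (y : E) (f' : ℝ) : Prop :=
  ∀ σ : ℝ → E, σ 0 = y → IsIntegralCurveAt σ (fun _ => Y) 0 → HasDerivAt (fun s => f (σ s)) f' 0

/-- All iterated derivatives of `f` of order at most `m` along the vector fields `Y_i`, in any
order of the `Y_i`, exist on `S`, are continuous on `S`, and are bounded by `C` on `S`. -/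
def DerivsBoundedBy {E : Type*} [NormedAddCommGroup E] [NormedSpace ℝ E] {ι : Type*}
    (Y : ι → E → E) (S : Set E) (C : ℝ) : ℕ → (E → ℝ) → Prop
  | 0, f => ContinuousOn f S ∧ ∀ y ∈ S, |f y| ≤ C
  | m + 1, f => (ContinuousOn f S ∧ ∀ y ∈ S, |f y| ≤ C) ∧
      ∀ i, ∃ g : E → ℝ, (∀ y ∈ S, HasDerivAlong (Y i) f y (g y)) ∧ DerivsBoundedBy Y S C m g

/-- The finite list `(X,d)` controls `(X₀,d₀)` on a neighbourhood of `0`. Here `Ω` is a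
neighbourhood of `0` on which all the vector fields are defined and smooth, and `c δ x j` is the
coefficient `c_{x,j}^δ`. The finiteness of the supremum over `δ` and `x` of the finite sum of the
sup norms of the derivatives of order at most `m` is expressed by one bound `C` for them all. -/
def Controls {n ν q : ℕ} (X : Fin q → FormalField n ν) (X₀ : FormalField n ν) : Prop :=
  ∃ Ω : Set (Rn n), IsOpen Ω ∧ (∀ j, ContDiffOn ℝ ∞ (X j).1 Ω) ∧ ContDiffOn ℝ ∞ X₀.1 Ω ∧
  ∃ U : Set (Rn n), IsOpen U ∧ (0 : Rn n) ∈ U ∧ U ⊆ Ω ∧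
  ∃ τ₁ : ℝ, 0 < τ₁ ∧
  ∃ c : (Fin ν → ℝ) → Rn n → Fin q → Rn n → ℝ,
    (∀ δ ∈ Set.Icc (0 : Fin ν → ℝ) 1, ∀ x ∈ U, ∀ y ∈ ccBall Ω X x (τ₁ • δ),
      dpow δ X₀.2 • X₀.1 y = ∑ j, c δ x j y • scaled X δ j y) ∧
    ∀ m : ℕ, ∃ C : ℝ, ∀ δ ∈ Set.Icc (0 : Fin ν → ℝ) 1, ∀ x ∈ U, ∀ j,
      DerivsBoundedBy (scaled X δ) (ccBall Ω X x (τ₁ • δ)) C m (c δ x j)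

/-- The vector fields on `ℝ^N × ℝⁿ` giving the derivatives `∂_{t_k}` and `δ ^ d_j X_j` (the latter
acting in the `x` variable). -/
def productFields {N n ν q : ℕ} (X : Fin q → FormalField n ν) (δ : Fin ν → ℝ) :
    Fin N ⊕ Fin q → Rn N × Rn n → Rn N × Rn n
  | Sum.inl k, _ => (EuclideanSpace.single k 1, 0)
  | Sum.inr j, p => (0, scaled X δ j p.2)

/-- The finite list `(X,d)` controls the `t`-dependent vector field `W(t,x)` on a neighbourhood
of `0`, with respect to the dilations `e` on `ℝ^N`. Here `c δ x₀ l (t,x)` is the coefficient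
`c_l^{x₀,δ}(t,x)`. -/
def ControlsParam {N n ν q : ℕ} (e : Fin N → Fin ν → ℕ) (X : Fin q → FormalField n ν)
    (W : Rn N → Rn n → Rn n) : Prop :=
  ∃ Ω : Set (Rn n), IsOpen Ω ∧ (∀ j, ContDiffOn ℝ ∞ (X j).1 Ω) ∧
  ∃ U : Set (Rn n), IsOpen U ∧ (0 : Rn n) ∈ U ∧ U ⊆ Ω ∧
  ∃ τ₁ : ℝ, 0 < τ₁ ∧ ∃ ρ₁ : ℝ, 0 < ρ₁ ∧
  ∃ c : (Fin ν → ℝ) → Rn n → Fin q → Rn N × Rn n → ℝ,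
    (∀ δ ∈ Set.Icc (0 : Fin ν → ℝ) 1, ∀ x₀ ∈ U,
      ∀ t ∈ Metric.ball (0 : Rn N) ρ₁, ∀ x ∈ ccBall Ω X x₀ (τ₁ • δ),
        W (dilate e δ t) x = ∑ l, c δ x₀ l (t, x) • scaled X δ l x) ∧
    ∀ m : ℕ, ∃ C : ℝ, ∀ δ ∈ Set.Icc (0 : Fin ν → ℝ) 1, ∀ x₀ ∈ U, ∀ l,
      DerivsBoundedBy (productFields X δ)
        (Metric.ball (0 : Rn N) ρ₁ ×ˢ ccBall Ω X x₀ (τ₁ • δ)) C m (c δ x₀ l)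

/-! ### Commutators and finite lists -/

/-- `([X₁,X₂], d₁ + d₂)`. -/
def bracket {n ν : ℕ} (X₁ X₂ : FormalField n ν) : FormalField n ν :=
  (VectorField.lieBracket ℝ X₁.1 X₂.1, X₁.2 + X₂.2)

/-- Membership in `L₀(S)`, the smallest set that contains `S` and contains
`([X₁,X₂], d₁ + d₂)` whenever `(X₁,d₁) ∈ S` and `(X₂,d₂) ∈ L₀(S)`. -/
inductive MemL0 {n ν : ℕ} (S : Set (FormalField n ν)) : FormalField n ν → Prop
  | base (X : FormalField n ν) : X ∈ S → MemL0 S X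
  | comm (X₁ X₂ : FormalField n ν) : X₁ ∈ S → MemL0 S X₂ → MemL0 S (bracket X₁ X₂)

/-- The list `F = (X₁,d₁), …, (X_r,d_r)` generates the finite list
`X = (X₁,d₁), …, (X_q,d_q)`, `q ≥ r`. -/
def GeneratesFiniteList {n ν r q : ℕ} (F : Fin r → FormalField n ν) (X : Fin q → FormalField n ν) :
    Prop :=
  ∃ h : r ≤ q, (∀ i : Fin r, X (Fin.castLE h i) = F i) ∧
    (∀ j : Fin q, r ≤ (j : ℕ) → MemL0 (Set.range F) (X j)) ∧
    ∀ j k : Fin q, Controls X (bracket (X j) (X k))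

/-! ### The vector field `W` and the two expansions -/

/-- `g t` is the inverse of `γ_t`, for `(t,x)` near `(0,0)`. -/
def IsLocalInverse {N n : ℕ} (γ g : Rn N → Rn n → Rn n) : Prop :=
  ∀ᶠ p in 𝓝 ((0, 0) : Rn N × Rn n), γ p.1 (g p.1 p.2) = p.2 ∧ g p.1 (γ p.1 p.2) = p.2

/-- For `γ` analytic (or `C¹`) near `(0,0)` with `γ₀(x) = x`, the local inverse exists. -/
theorem exists_isLocalInverse {N n : ℕ} (γ : Rn N → Rn n → Rn n)
    (hγ : AnalyticAt ℝ (fun p : Rn N × Rn n => γ p.1 p.2) (0, 0))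
    (hγ₀ : ∀ᶠ x in 𝓝 (0 : Rn n), γ 0 x = x) : ∃ g, IsLocalInverse γ g := by
  have h00 : γ 0 0 = 0 := hγ₀.self_of_nhds
  set G : Rn N × Rn n → Rn n := fun p => γ p.1 p.2 with hG
  have hs : HasStrictFDerivAt G (fderiv ℝ G (0, 0)) (0, 0) := hγ.hasStrictFDerivAt
  set L := fderiv ℝ G (0, 0) with hL
  have hL2 : ∀ v : Rn n, L (0, v) = v := by
    have h1 : HasFDerivAt (fun x : Rn n => ((0 : Rn N), x))
        (ContinuousLinearMap.inr ℝ (Rn N) (Rn n)) (0 : Rn n) :=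
      (ContinuousLinearMap.inr ℝ (Rn N) (Rn n)).hasFDerivAt
    have h2 := HasFDerivAt.comp (0 : Rn n) (g := G) hs.hasFDerivAt h1
    have h3 : (G ∘ fun x : Rn n => ((0 : Rn N), x)) =ᶠ[𝓝 0] id := by
      filter_upwards [hγ₀] with x hx using hx
    have h4 := h2.unique ((hasFDerivAt_id (0 : Rn n)).congr_of_eventuallyEq h3)
    intro v
    simpa using congrArg (fun A : Rn n →L[ℝ] Rn n => A v) h4
  have hLs : ∀ t v, L (t, v) = L (t, 0) + v := by
    intro t v
    have : ((t, v) : Rn N × Rn n) = (t, 0) + (0, v) := by simp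
    rw [this, map_add, hL2]
  let P : (Rn N × Rn n) →L[ℝ] (Rn N × Rn n) := (ContinuousLinearMap.fst ℝ (Rn N) (Rn n)).prod L
  let Q : (Rn N × Rn n) →L[ℝ] (Rn N × Rn n) := (ContinuousLinearMap.fst ℝ (Rn N) (Rn n)).prod
    (ContinuousLinearMap.snd ℝ (Rn N) (Rn n) -
      L.comp ((ContinuousLinearMap.inl ℝ (Rn N) (Rn n)).comp
        (ContinuousLinearMap.fst ℝ (Rn N) (Rn n))))
  let E : (Rn N × Rn n) ≃L[ℝ] (Rn N × Rn n) := ContinuousLinearEquiv.equivOfInverse P Q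
    (by rintro ⟨t, v⟩; simp [P, Q, hLs t v]) (by rintro ⟨t, v⟩; simp [P, Q, hLs t (v - _)])
  have hΓ : HasStrictFDerivAt (fun p : Rn N × Rn n => (p.1, G p))
      (E : (Rn N × Rn n) →L[ℝ] (Rn N × Rn n)) (0, 0) :=
    hasStrictFDerivAt_fst.prodMk hs
  have hr := hΓ.eventually_right_inverse
  have hl := hΓ.eventually_left_inverse
  have hG0 : ((0 : Rn N), G (0, 0)) = (0, 0) := by simp [hG, h00]
  simp only [hG0] at hr
  refine ⟨fun t y => (hΓ.localInverse _ _ _ (t, y)).2, ?_⟩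
  filter_upwards [hr, hl] with p hp hq
  have hp1 := congrArg Prod.fst hp
  have hp2 := congrArg Prod.snd hp
  refine ⟨?_, congrArg Prod.snd hq⟩
  simp only at hp1 hp2
  simp only [hG] at hp2
  rw [hp1] at hp2
  exact hp2

/-- The local inverse `(t,x) ↦ γ_t⁻¹(x)` (its germ at `(0,0)` is unique). -/
def localInverse {N n : ℕ} (γ : Rn N → Rn n → Rn n) : Rn N → Rn n → Rn n :=
  Classical.epsilon (IsLocalInverse γ)

/-- `W(t,x) = d/dε γ_{εt} ∘ γ_t⁻¹(x)` at `ε = 1`. -/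
def fieldW {N n : ℕ} (γ : Rn N → Rn n → Rn n) (t : Rn N) (x : Rn n) : Rn n :=
  deriv (fun ε : ℝ => γ (ε • t) (localInverse γ t x)) 1

/-- The iterated partial derivative `∂_t^α f`. -/
def iteratedPartial {N : ℕ} {F : Type*} [NormedAddCommGroup F] [NormedSpace ℝ F]
    (α : Fin N → ℕ) (f : Rn N → F) : Rn N → F :=
  (List.finRange N).foldr
    (fun j g => (fun h t => lineDeriv ℝ h t (EuclideanSpace.single j (1 : ℝ)))^[α j] g) f

/-- The Taylor coefficient `(1/α!) ∂_t^α W(t,x)` at `t = 0` of a `t`-dependent vector field. -/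
def taylorField {N n : ℕ} (W : Rn N → Rn n → Rn n) (α : Fin N → ℕ) : Rn n → Rn n :=
  fun x => ((∏ j, (α j).factorial : ℕ) : ℝ)⁻¹ • iteratedPartial α (fun t => W t x) 0

/-- The truncated sum `∑_{0 < |α| < M} t ^ α X_α`. -/
def truncated {N n : ℕ} (X : (Fin N → ℕ) → Rn n → Rn n) (M : ℕ) (t : Rn N) (x : Rn n) : Rn n :=
  ∑ k ∈ Finset.Ico 1 M, ∑ α ∈ Finset.piAntidiag (Finset.univ : Finset (Fin N)) k,
    monomial t α • X α x

/-- `γ_t(x) ∼ exp(∑_{|α| > 0} t ^ α X_α) x` with real analytic vector fields `X_α` near `0`: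
for every `M`, `γ_t(x) = exp(∑_{0 < |α| < M} t ^ α X_α) x + O(|t| ^ M)` as `t → 0`, uniformly for
`x` in a neighbourhood of `0`. Here `exp(V) x = σ(1)`, where `σ' = V(σ)` on `[0,1]`, `σ(0) = x`. -/
def HasExpExpansion {N n : ℕ} (γ : Rn N → Rn n → Rn n) (X : (Fin N → ℕ) → Rn n → Rn n) : Prop :=
  (∀ α, α ≠ 0 → AnalyticAt ℝ (X α) 0) ∧
  ∀ M : ℕ, ∃ r : ℝ, 0 < r ∧ ∃ C : ℝ, ∀ t : Rn N, ‖t‖ < r → ∀ x : Rn n, ‖x‖ < r →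
    ∃ σ : ℝ → Rn n, σ 0 = x ∧ IsIntegralCurveOn σ (fun _ => truncated X M t) (Set.Icc 0 1) ∧
      ‖γ t x - σ 1‖ ≤ C * ‖t‖ ^ M

/-- The finite type condition for `W` and a family `X_α`, `|α| > 0`: there is a finite list `F` of
elements of `{(X_α, deg α)}` which generates a finite list that controls `W`. -/
def FiniteType {N n ν : ℕ} (e : Fin N → Fin ν → ℕ) (W : Rn N → Rn n → Rn n)
    (X : (Fin N → ℕ) → Rn n → Rn n) : Prop :=
  ∃ (r : ℕ) (F : Fin r → FormalField n ν),
    (∀ i, ∃ α : Fin N → ℕ, α ≠ 0 ∧ F i = (X α, deg e α)) ∧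
    ∃ (q : ℕ) (Y : Fin q → FormalField n ν), GeneratesFiniteList F Y ∧ ControlsParam e Y W

end Radon

end

/-!
Both conditions come out of one criterion, `finiteType_of_approx`: if `W(t, x)` agrees, up to
`O(|t|^K)` for every `K`, with a linear combination of vector fields `t ^ α Z` with
`(Z, deg α) ∈ L₀(S)`, where `S = {(X_α, deg α)}`, then a finite part of `S` generates a finite list
that controls `W`.

The criterion rests on the ring of germs at `0` of real analytic functions being Noetherian
(`isNoetherianRing_anGerm`). This is proved for convergent power series by division with remainder
(`exists_division`), the monomials being ordered by the injective weight `α ↦ ∏ pᵢ ^ αᵢ`; these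
weights also define norms that measure convergence, and in these norms the division algorithm
contracts. Let `M` be the module over the germs in the variables `(τ, t, δ, x)` that is spanned by
the vectors `δ ^ d Z(x)`, `(Z, d) ∈ L₀(S)`. It is finitely generated, and finitely many elements of
`L₀(S)` together with the finitely many elements of `S` they are made of form the list
(`exists_generating_list`). By the Jacobi identity `L₀(S)` spans a Lie algebra
(`MemL0.bracket_inSpanL0`), so brackets of the list lie in `M`. The field `W(δ (τ t), x)` lies in
`M + τ ^ K (…)` for every `K` by the approximation hypothesis, hence in `M` by Krull's intersection
theorem (`vecGerm_blowUp_mem_of_approx`). Membership in `M` gives coefficients that are analytic in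
all variables near the origin. As both sides are homogeneous in `δ`, replacing `δ` by `ε δ` turns
this into control with bounds uniform over all `δ ∈ [0,1]^ν` (`controls_of_mem_span`,
`controlsParam_of_mem_span`).

For the Taylor coefficients of `W` the approximation is Taylor's theorem
(`finiteType_taylorField`).

For the fields of the exponential expansion, let `e` be the Euler derivation `∑ t_j ∂_{t_j}` and let
`a` be the derivation along `∑ t ^ α X_α`, `0 < |α| < K`. The definition of `W` reads `W ∘ γ = e γ`
(`shear_fieldW`), and composition with `γ` agrees modulo `O(|t|^K)` with the truncated exponential
`P` of `a` (`shear_sub_expTrunc_mem`). Moving `e` past `P` gives `e P ≡ P ∑_j b_j / j!`, where `b_j`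
is the iterated commutator of `e` with `j` copies of `a` (`RaisesOrder.mul_expTrunc_sub`). Apply this to
the coordinates `x`, which `e = b_0` annihilates, and cancel `P`, which is invertible modulo
`O(|t|^K)` because it agrees with composition with `γ` (`shear_mem_vanishIdeal_iff`): this yields
`W ≡ ∑_{j ≥ 1} b_j x / j!`. The first commutator `b_1` is the derivation along `∑ |α| t ^ α X_α`,
and each further bracket with `a` stays within the span of the `t ^ α Z`, `(Z, deg α) ∈ L₀(S)`
(`exists_iterComm_eq`), which is the required approximation
(`finiteType_of_shear_sub_expTrunc_mem`).

The expansion exists because the terms of order `M` can be chosen to cancel the leading error left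
by those of lower order (`germ_sub_expTrunc_expFields_mem`); the integral curves in its definition
are obtained from the Picard–Lindelöf theorem (`exists_isIntegralCurveOn_Icc`).
-/

namespace Radon

/-! ### Convergent power series -/

/-- The multiplicative weight `w(α) = ∏ pᵢ ^ αᵢ` of an exponent, `pᵢ` being the `i`-th prime.
By unique factorization it is injective, so it orders the monomials; it also measures
convergence, since `w(α)⁻ᵘ` is the monomial `z ^ α` at the point `zᵢ = pᵢ⁻ᵘ`. -/
noncomputable def weight {m : ℕ} (α : Fin m →₀ ℕ) : ℕ := α.prod fun i a => Nat.nth Nat.Prime i ^ a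

theorem prime_nth (i : ℕ) : (Nat.nth Nat.Prime i).Prime :=
  Nat.nth_mem_of_infinite Nat.infinite_setOfPred_prime i

theorem weight_add {m : ℕ} (α β : Fin m →₀ ℕ) : weight (α + β) = weight α * weight β := by
  classical
  exact Finsupp.prod_add_index' (by simp) (by intros; rw [pow_add])

theorem weight_pos {m : ℕ} (α : Fin m →₀ ℕ) : 0 < weight α :=
  Finset.prod_pos fun i _ => pow_pos (prime_nth i).pos _

theorem weight_injective {m : ℕ} : Function.Injective (weight (m := m)) := by
  classical
  let φ : Fin m ↪ ℕ := ⟨fun i => Nat.nth Nat.Prime i, fun i j h =>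
    Fin.ext (Nat.nth_injective Nat.infinite_setOfPred_prime h)⟩
  have key : ∀ α : Fin m →₀ ℕ, (weight α).factorization = α.embDomain φ := by
    intro α
    have h1 : weight α = (α.embDomain φ).prod (fun x1 x2 => x1 ^ x2) := by
      rw [Finsupp.prod_embDomain]; rfl
    rw [h1, Nat.prod_pow_factorization_eq_self]
    intro p hp
    simp only [Finsupp.support_embDomain, Finset.mem_map] at hp
    obtain ⟨i, -, rfl⟩ := hp
    exact prime_nth i
  intro α β h
  have := (key α).symm.trans ((congrArg Nat.factorization h).trans (key β))
  exact Finsupp.embDomain_injective φ this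

/-- The weighted `ℓ¹` norm `∑ |a_α| w(α)⁻ᵘ` of a power series, with values in `[0,∞]`. -/
noncomputable def wnorm {m : ℕ} (u : ℕ) (f : MvPowerSeries (Fin m) ℝ) : ENNReal :=
  ∑' α, ‖MvPowerSeries.coeff α f‖ₑ * ((weight α : ENNReal)⁻¹) ^ u

open MvPowerSeries

theorem weight_cast_ne_zero {m : ℕ} (α : Fin m →₀ ℕ) : (weight α : ENNReal) ≠ 0 :=
  Nat.cast_ne_zero.2 (weight_pos α).ne'

theorem inv_weight_add {m : ℕ} (u : ℕ) (α β : Fin m →₀ ℕ) : ((weight (α + β) : ENNReal)⁻¹) ^ u =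
    ((weight α : ENNReal)⁻¹) ^ u * ((weight β : ENNReal)⁻¹) ^ u := by
  rw [weight_add, Nat.cast_mul, ENNReal.mul_inv (.inl (weight_cast_ne_zero α))
    (.inl (ENNReal.natCast_ne_top _)), mul_pow]

theorem inv_weight_le_one {m : ℕ} (α : Fin m →₀ ℕ) : (weight α : ENNReal)⁻¹ ≤ 1 := by
  rw [ENNReal.inv_le_one]
  exact_mod_cast weight_pos α

theorem wnorm_anti {m : ℕ} {u v : ℕ} (h : u ≤ v) (f : MvPowerSeries (Fin m) ℝ) :
    wnorm v f ≤ wnorm u f :=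
  ENNReal.tsum_le_tsum fun α =>
    mul_le_mul' le_rfl (pow_le_pow_right_of_le_one' (inv_weight_le_one α) h)

theorem wnorm_add_le {m : ℕ} (u : ℕ) (f g : MvPowerSeries (Fin m) ℝ) :
    wnorm u (f + g) ≤ wnorm u f + wnorm u g := by
  unfold wnorm
  rw [← ENNReal.tsum_add]
  refine ENNReal.tsum_le_tsum fun α => ?_
  rw [← add_mul, map_add]
  gcongr
  exact enorm_add_le _ _

theorem wnorm_neg {m : ℕ} (u : ℕ) (f : MvPowerSeries (Fin m) ℝ) : wnorm u (-f) = wnorm u f := by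
  simp [wnorm]

theorem wnorm_zero {m : ℕ} (u : ℕ) : wnorm u (0 : MvPowerSeries (Fin m) ℝ) = 0 := by
  simp [wnorm]

theorem wnorm_sum_le {m : ℕ} (u : ℕ) {ι : Type*} (s : Finset ι)
    (f : ι → MvPowerSeries (Fin m) ℝ) : wnorm u (∑ i ∈ s, f i) ≤ ∑ i ∈ s, wnorm u (f i) := by
  classical
  induction s using Finset.induction_on with
  | empty => simp [wnorm_zero]
  | insert a s ha ih =>
    rw [Finset.sum_insert ha, Finset.sum_insert ha]
    exact (wnorm_add_le _ _ _).trans (by gcongr)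

theorem wnorm_mul_le {m : ℕ} (u : ℕ) (f g : MvPowerSeries (Fin m) ℝ) :
    wnorm u (f * g) ≤ wnorm u f * wnorm u g := by
  classical
  calc wnorm u (f * g) ≤ ∑' n : Fin m →₀ ℕ, ∑ p ∈ Finset.HasAntidiagonal.antidiagonal n,
        (‖coeff p.1 f‖ₑ * ((weight p.1 : ENNReal)⁻¹) ^ u) *
          (‖coeff p.2 g‖ₑ * ((weight p.2 : ENNReal)⁻¹) ^ u) := by
        refine ENNReal.tsum_le_tsum fun n => ?_
        rw [coeff_mul]
        calc _ ≤ (∑ p ∈ Finset.HasAntidiagonal.antidiagonal n, ‖coeff p.1 f * coeff p.2 g‖ₑ) *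
              ((weight n : ENNReal)⁻¹) ^ u := by gcongr; exact enorm_sum_le _ _
          _ = _ := by
            rw [Finset.sum_mul]
            refine Finset.sum_congr rfl fun p hp => ?_
            rw [← Finset.HasAntidiagonal.mem_antidiagonal.1 hp, inv_weight_add, enorm_mul]
            ring
    _ = ∑' p : (Fin m →₀ ℕ) × (Fin m →₀ ℕ),
        (‖coeff p.1 f‖ₑ * ((weight p.1 : ENNReal)⁻¹) ^ u) *
          (‖coeff p.2 g‖ₑ * ((weight p.2 : ENNReal)⁻¹) ^ u) := by
        rw [← Finset.HasAntidiagonal.sigmaAntidiagonalEquivProd.tsum_eq, ENNReal.tsum_sigma']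
        refine tsum_congr fun n => ?_
        rw [tsum_fintype, ← Finset.sum_coe_sort]
        rfl
    _ = wnorm u f * wnorm u g := by
        rw [ENNReal.tsum_prod']
        simp_rw [ENNReal.tsum_mul_left, ENNReal.tsum_mul_right]
        rfl

/-- A power series converges if it does so absolutely at some point with non-zero coordinates. -/
def IsConv {m : ℕ} (f : MvPowerSeries (Fin m) ℝ) : Prop := ∃ u, wnorm u f < ⊤

theorem IsConv.add {m : ℕ} {f g : MvPowerSeries (Fin m) ℝ} (hf : IsConv f) (hg : IsConv g) :
    IsConv (f + g) := by
  obtain ⟨u, hu⟩ := hf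
  obtain ⟨v, hv⟩ := hg
  refine ⟨max u v, (wnorm_add_le _ _ _).trans_lt (ENNReal.add_lt_top.2 ⟨?_, ?_⟩)⟩
  · exact (wnorm_anti (le_max_left _ _) _).trans_lt hu
  · exact (wnorm_anti (le_max_right _ _) _).trans_lt hv

theorem IsConv.mul {m : ℕ} {f g : MvPowerSeries (Fin m) ℝ} (hf : IsConv f) (hg : IsConv g) :
    IsConv (f * g) := by
  obtain ⟨u, hu⟩ := hf
  obtain ⟨v, hv⟩ := hg
  refine ⟨max u v, (wnorm_mul_le _ _ _).trans_lt (ENNReal.mul_lt_top ?_ ?_)⟩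
  · exact (wnorm_anti (le_max_left _ _) _).trans_lt hu
  · exact (wnorm_anti (le_max_right _ _) _).trans_lt hv

theorem IsConv.neg {m : ℕ} {f : MvPowerSeries (Fin m) ℝ} (hf : IsConv f) : IsConv (-f) := by
  simpa [IsConv, wnorm_neg] using hf

theorem isConv_monomial {m : ℕ} (α : Fin m →₀ ℕ) (c : ℝ) : IsConv (MvPowerSeries.monomial α c) := by
  classical
  refine ⟨0, ?_⟩
  unfold wnorm
  rw [tsum_eq_single α]
  · simp
  · intro β hβ
    simp [coeff_monomial, hβ]

/-- The ring of convergent power series in `m` variables. -/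
def convRing (m : ℕ) : Subring (MvPowerSeries (Fin m) ℝ) where
  carrier := {f | IsConv f}
  mul_mem' := IsConv.mul
  one_mem' := isConv_monomial 0 1
  add_mem' := IsConv.add
  zero_mem' := ⟨0, by simp [wnorm_zero]⟩
  neg_mem' := IsConv.neg

/-- A convergent series whose exponents all have weight larger than `L` becomes negligible with
respect to `L⁻ᵘ` as `u` grows. -/
theorem eventually_wnorm_le {m : ℕ} {h : MvPowerSeries (Fin m) ℝ} (hh : IsConv h) (L : ℕ)
    (hL : 0 < L) (hlt : ∀ α, coeff α h ≠ 0 → L < weight α) (θ : ENNReal) (hθ : 0 < θ) :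
    ∀ᶠ u in Filter.atTop, wnorm u h ≤ θ * ((L : ENNReal)⁻¹) ^ u := by
  obtain ⟨v, hv⟩ := hh
  have hL0 : (L : ENNReal) ≠ 0 := by exact_mod_cast hL.ne'
  have hLt : (L : ENNReal) ≠ ⊤ := ENNReal.natCast_ne_top _
  set x : ENNReal := (L : ENNReal) * ((L + 1 : ℕ) : ENNReal)⁻¹ with hx
  have hx1 : x < 1 := by
    rw [hx, ← div_eq_mul_inv, ENNReal.div_lt_iff (by simp) (by simp), one_mul]
    exact_mod_cast Nat.lt_succ_self L
  have h1 : Filter.Tendsto (fun u : ℕ => wnorm v h * (L : ENNReal) ^ v * x ^ u) Filter.atTop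
      (𝓝 0) := by
    have := ENNReal.Tendsto.const_mul (a := wnorm v h * (L : ENNReal) ^ v)
      (ENNReal.tendsto_pow_atTop_nhds_zero_of_lt_one hx1)
      (.inr (ENNReal.mul_ne_top hv.ne (ENNReal.pow_ne_top hLt)))
    simpa using this
  obtain ⟨u₀, hu₀⟩ := Filter.eventually_atTop.1 (h1.eventually_le_const hθ)
  filter_upwards [Filter.eventually_ge_atTop (u₀ + v)] with u hu
  obtain ⟨k, rfl⟩ : ∃ k, u = k + v := ⟨u - v, by omega⟩
  have h2 : wnorm (k + v) h ≤ wnorm v h * (((L + 1 : ℕ) : ENNReal)⁻¹) ^ k := by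
    unfold wnorm
    rw [← ENNReal.tsum_mul_right]
    refine ENNReal.tsum_le_tsum fun α => ?_
    by_cases h0 : coeff α h = 0
    · simp [h0]
    · rw [add_comm k v, pow_add, ← mul_assoc]
      gcongr
      exact hlt α h0
  calc wnorm (k + v) h ≤ wnorm v h * (((L + 1 : ℕ) : ENNReal)⁻¹) ^ k := h2
    _ = (wnorm v h * (L : ENNReal) ^ v * x ^ k) * ((L : ENNReal)⁻¹) ^ (k + v) := by
        rw [hx, mul_pow, pow_add]
        have e : ∀ j : ℕ, (L : ENNReal) ^ j * ((L : ENNReal)⁻¹) ^ j = 1 := fun j => by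
          rw [← mul_pow, ENNReal.mul_inv_cancel hL0 hLt, one_pow]
        calc _ = wnorm v h * (((L + 1 : ℕ) : ENNReal)⁻¹) ^ k *
              ((L : ENNReal) ^ v * ((L : ENNReal)⁻¹) ^ v) *
              ((L : ENNReal) ^ k * ((L : ENNReal)⁻¹) ^ k) := by rw [e, e]; simp
          _ = _ := by ring
    _ ≤ _ := by gcongr; exact hu₀ k (by omega)

/-- Division with remainder in the ring of convergent power series: if `L j` is the exponent of
least weight of `f j`, every convergent `g` is a combination of the `f j` up to a remainder none of
whose monomials is divisible by a leading monomial. -/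
theorem exists_division {m k : ℕ} (f : Fin k → MvPowerSeries (Fin m) ℝ) (L : Fin k → Fin m →₀ ℕ)
    (hf : ∀ j, IsConv (f j)) (hlead : ∀ j, coeff (L j) (f j) = 1)
    (hmin : ∀ j α, coeff α (f j) ≠ 0 → weight (L j) ≤ weight α)
    (g : MvPowerSeries (Fin m) ℝ) (hg : IsConv g) :
    ∃ q : Fin k → MvPowerSeries (Fin m) ℝ, (∀ j, IsConv (q j)) ∧
      ∀ α, coeff α (g - ∑ j, q j * f j) ≠ 0 → ∀ j, ¬ L j ≤ α := by
  classical
  have hJ : ∀ α : Fin m →₀ ℕ, ∃ o : Option (Fin k), (∀ j, o = some j → L j ≤ α) ∧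
      (o = none → ∀ j, ¬ L j ≤ α) := by
    intro α
    by_cases h : ∃ j, L j ≤ α
    · obtain ⟨j, hj⟩ := h
      exact ⟨some j, by simp [hj], by simp⟩
    · exact ⟨none, by simp, fun _ => not_exists.1 h⟩
  choose J hJ1 hJ2 using hJ
  let Q : Fin k → MvPowerSeries (Fin m) ℝ → MvPowerSeries (Fin m) ℝ :=
    fun j F β => if J (β + L j) = some j then coeff (β + L j) F else 0
  let R : MvPowerSeries (Fin m) ℝ → MvPowerSeries (Fin m) ℝ :=
    fun F α => if J α = none then coeff α F else 0
  have cQ : ∀ j F β, coeff β (Q j F) = if J (β + L j) = some j then coeff (β + L j) F else 0 :=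
    fun _ _ _ => rfl
  have cR : ∀ F α, coeff α (R F) = if J α = none then coeff α F else 0 := fun _ _ => rfl
  let h : Fin k → MvPowerSeries (Fin m) ℝ := fun j => f j - MvPowerSeries.monomial (L j) 1
  let T : MvPowerSeries (Fin m) ℝ → MvPowerSeries (Fin m) ℝ := fun F => -∑ j, Q j F * h j
  -- The leading terms alone divide every series.
  have hsplit : ∀ F, ∑ j, Q j F * MvPowerSeries.monomial (L j) 1 + R F = F := by
    intro F
    ext α
    rw [map_add, map_sum, cR]
    have e : ∀ j, coeff α (Q j F * MvPowerSeries.monomial (L j) 1) =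
        if J α = some j then coeff α F else 0 := by
      intro j
      rw [coeff_mul_monomial]
      by_cases hj : L j ≤ α
      · rw [if_pos hj, cQ, tsub_add_cancel_of_le hj, mul_one]
      · rw [if_neg hj, if_neg]
        exact fun h => hj (hJ1 α j h)
    simp_rw [e]
    rcases hα : J α with _ | j <;> simp
  have hQadd : ∀ j F G, Q j (F + G) = Q j F + Q j G := by
    intro j F G
    ext β
    rw [map_add, cQ, cQ, cQ, map_add]
    split_ifs <;> simp
  have hTadd : ∀ F G, T (F + G) = T F + T G := by
    intro F G
    simp only [T, hQadd, add_mul, Finset.sum_add_distrib, neg_add]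
  have hlt : ∀ j α, coeff α (h j) ≠ 0 → weight (L j) < weight α := by
    intro j α hα
    simp only [h, map_sub, coeff_monomial] at hα
    by_cases e : α = L j
    · simp [e, hlead] at hα
    · rw [if_neg e, sub_zero] at hα
      exact lt_of_le_of_ne (hmin j α hα) fun h' => e (weight_injective h').symm
  have hconv : ∀ j, IsConv (h j) := fun j => by
    simpa only [h, sub_eq_add_neg] using (hf j).add (isConv_monomial (L j) 1).neg
  obtain ⟨v, hv⟩ := hg
  set θ : ENNReal := ((2 * (k + 1) : ℕ) : ENNReal)⁻¹ with hθ
  have hθpos : 0 < θ := by rw [hθ, ENNReal.inv_pos]; exact ENNReal.natCast_ne_top _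
  have hev : ∀ᶠ u in Filter.atTop, v ≤ u ∧
      ∀ j, wnorm u (h j) ≤ θ * ((weight (L j) : ENNReal)⁻¹) ^ u :=
    (Filter.eventually_ge_atTop v).and (Filter.eventually_all.2 fun j =>
      eventually_wnorm_le (hconv j) _ (weight_pos _) (hlt j) θ hθpos)
  obtain ⟨u, huv, hu⟩ := hev.exists
  have hQle : ∀ j F, wnorm u (Q j F) * ((weight (L j) : ENNReal)⁻¹) ^ u ≤ wnorm u F := by
    intro j F
    unfold wnorm
    rw [← ENNReal.tsum_mul_right]
    refine le_trans (ENNReal.tsum_le_tsum fun β => ?_)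
      (ENNReal.tsum_comp_le_tsum_of_injective (f := fun β : Fin m →₀ ℕ => β + L j)
        (add_left_injective (L j)) _)
    rw [mul_assoc, ← inv_weight_add, cQ]
    gcongr
    split_ifs <;> simp
  have hTle : ∀ F, wnorm u (T F) ≤ 2⁻¹ * wnorm u F := by
    intro F
    calc wnorm u (T F) ≤ ∑ j, wnorm u (Q j F) * wnorm u (h j) := by
          rw [wnorm_neg]
          exact (wnorm_sum_le _ _ _).trans (Finset.sum_le_sum fun j _ => wnorm_mul_le _ _ _)
      _ ≤ ∑ j : Fin k, θ * wnorm u F := by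
          refine Finset.sum_le_sum fun j _ => ?_
          calc _ ≤ wnorm u (Q j F) * (θ * ((weight (L j) : ENNReal)⁻¹) ^ u) := by
                gcongr; exact hu j
            _ = θ * (wnorm u (Q j F) * ((weight (L j) : ENNReal)⁻¹) ^ u) := by ring
            _ ≤ _ := by gcongr; exact hQle j F
      _ = (k * θ) * wnorm u F := by simp [mul_assoc]
      _ ≤ 2⁻¹ * wnorm u F := by
          gcongr
          rw [hθ]
          push_cast
          rw [ENNReal.mul_inv (by simp) (by simp), mul_comm (2⁻¹ : ENNReal), ← mul_assoc]
          nth_rewrite 2 [← one_mul (2⁻¹ : ENNReal)]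
          gcongr
          rw [← div_eq_mul_inv]
          refine ENNReal.div_le_of_le_mul ?_
          rw [one_mul]
          exact le_self_add
  have hgu : wnorm u g < ⊤ := (wnorm_anti huv _).trans_lt hv
  have hTk : ∀ i : ℕ, wnorm u (T^[i] g) ≤ 2⁻¹ ^ i * wnorm u g := by
    intro i
    induction i with
    | zero => simp
    | succ i ih =>
      rw [Function.iterate_succ_apply', pow_succ', mul_assoc]
      exact (hTle _).trans (by gcongr)
  have hsumN : ∑' i : ℕ, wnorm u (T^[i] g) < ⊤ := by
    refine (ENNReal.tsum_le_tsum hTk).trans_lt ?_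
    rw [ENNReal.tsum_mul_right]
    refine ENNReal.mul_lt_top ?_ hgu
    rw [ENNReal.tsum_geometric, ENNReal.one_sub_inv_two, inv_inv]
    exact ENNReal.ofNat_lt_top
  let G : MvPowerSeries (Fin m) ℝ := fun α => ∑' i : ℕ, coeff α (T^[i] g)
  have cG : ∀ α, coeff α G = ∑' i : ℕ, coeff α (T^[i] g) := fun _ => rfl
  have hGN : wnorm u G < ⊤ := by
    refine lt_of_le_of_lt ?_ hsumN
    unfold wnorm
    rw [ENNReal.tsum_comm]
    refine ENNReal.tsum_le_tsum fun α => ?_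
    rw [ENNReal.tsum_mul_right, cG]
    gcongr
    exact enorm_tsum_le_tsum_enorm
  have hsummable : ∀ α, Summable fun i : ℕ => coeff α (T^[i] g) := by
    intro α
    have hne : ((weight α : ENNReal)⁻¹) ^ u ≠ 0 := by simp
    have : (∑' i : ℕ, ‖coeff α (T^[i] g)‖ₑ) * ((weight α : ENNReal)⁻¹) ^ u < ⊤ := by
      rw [← ENNReal.tsum_mul_right]
      exact (ENNReal.tsum_le_tsum fun i => ENNReal.le_tsum α).trans_lt hsumN
    have h3 : ∑' i : ℕ, ‖coeff α (T^[i] g)‖ₑ ≠ ⊤ := by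
      intro h
      rw [h, ENNReal.top_mul hne] at this
      exact lt_irrefl _ this
    rw [← summable_norm_iff]
    have h4 := ENNReal.summable_toReal h3
    simpa using h4
  let S : ℕ → MvPowerSeries (Fin m) ℝ := fun n => ∑ i ∈ Finset.range n, T^[i] g
  have hSlim : ∀ α, Filter.Tendsto (fun n => coeff α (S n)) Filter.atTop (𝓝 (coeff α G)) := by
    intro α
    simpa [S, map_sum, cG] using (hsummable α).hasSum.tendsto_sum_nat
  have hT0 : T 0 = 0 := by
    have := hTadd 0 0
    simpa using this
  have hSrec : ∀ n, S (n + 1) = g + T (S n) := by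
    intro n
    induction n with
    | zero => simp [S, hT0]
    | succ n ih =>
      have e : ∀ n, S (n + 1) = S n + T^[n] g := fun n => Finset.sum_range_succ _ _
      calc S (n + 1 + 1) = g + T (S n) + T (T^[n] g) := by
            rw [e (n + 1), ih, Function.iterate_succ_apply']
        _ = g + T (S (n + 1)) := by rw [e n, hTadd, add_assoc]
  have hfix : G = g + T G := by
    ext α
    have l1 := (hSlim α).comp (Filter.tendsto_add_atTop_nat 1)
    have l2 : Filter.Tendsto (fun n => coeff α (g + T (S n))) Filter.atTop
        (𝓝 (coeff α (g + T G))) := by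
      simp only [map_add, T, map_neg, map_sum, coeff_mul]
      refine tendsto_const_nhds.add (Filter.Tendsto.neg ?_)
      refine tendsto_finsetSum _ fun j _ => tendsto_finsetSum _ fun p _ => ?_
      refine Filter.Tendsto.mul_const _ ?_
      simp only [cQ]
      split_ifs
      · exact hSlim _
      · exact tendsto_const_nhds
    refine tendsto_nhds_unique l1 (l2.congr fun n => ?_)
    rw [Function.comp, hSrec]
  refine ⟨fun j => Q j G, fun j => ⟨u, ?_⟩, ?_⟩
  · refine lt_of_le_of_ne le_top fun h => ?_
    have := hQle j G
    rw [h, ENNReal.top_mul (by simp)] at this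
    exact hGN.ne (top_le_iff.1 this)
  · have hR : g - ∑ j, Q j G * f j = R G := by
      have e1 := hsplit G
      have e2 : ∑ j, Q j G * f j = ∑ j, Q j G * MvPowerSeries.monomial (L j) 1 +
          ∑ j, Q j G * h j := by
        rw [← Finset.sum_add_distrib]
        refine Finset.sum_congr rfl fun j _ => ?_
        simp only [h]
        ring
      have e3 : G = g - ∑ j, Q j G * h j := by
        rw [sub_eq_add_neg]
        exact hfix
      rw [e2]
      linear_combination (-1 : MvPowerSeries (Fin m) ℝ) * e3 - e1
    intro α hα
    rw [hR, cR] at hα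
    exact hJ2 α (by by_contra h; simp [h] at hα)

/-- The ring of convergent power series is Noetherian: by Dickson's lemma finitely many leading
exponents of an ideal divide all others, and division by the corresponding elements of the ideal
leaves no remainder on the ideal. -/
instance isNoetherianRing_convRing (m : ℕ) : IsNoetherianRing (convRing m) := by
  classical
  refine ⟨fun I => ?_⟩
  -- the leading exponents of monic elements of `I`
  let E : Set (Fin m →₀ ℕ) := {L | ∃ f ∈ I, coeff L (f : MvPowerSeries (Fin m) ℝ) = 1 ∧
    ∀ α, coeff α (f : MvPowerSeries (Fin m) ℝ) ≠ 0 → weight L ≤ weight α}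
  have hlead : ∀ f ∈ I, f ≠ 0 → ∃ L ∈ E, coeff L (f : MvPowerSeries (Fin m) ℝ) ≠ 0 := by
    intro f hf hf0
    have hne : {α | coeff α (f : MvPowerSeries (Fin m) ℝ) ≠ 0}.Nonempty := by
      by_contra h
      refine hf0 (Subtype.ext ?_)
      ext α
      by_contra hα
      exact h ⟨α, hα⟩
    obtain ⟨L, hL, hmin⟩ := exists_minimalFor_of_wellFoundedLT
      (fun α => coeff α (f : MvPowerSeries (Fin m) ℝ) ≠ 0) weight hne
    have hL' : coeff L (f : MvPowerSeries (Fin m) ℝ) ≠ 0 := hL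
    let c : convRing m := ⟨MvPowerSeries.monomial 0 (coeff L (f : MvPowerSeries (Fin m) ℝ))⁻¹,
      isConv_monomial _ _⟩
    have hc : ∀ α, coeff α ((c * f : convRing m) : MvPowerSeries (Fin m) ℝ) =
        (coeff L (f : MvPowerSeries (Fin m) ℝ))⁻¹ * coeff α (f : MvPowerSeries (Fin m) ℝ) := by
      intro α
      change coeff α (MvPowerSeries.monomial 0 _ * (f : MvPowerSeries (Fin m) ℝ)) = _
      rw [coeff_monomial_mul]
      simp
    refine ⟨L, ⟨c * f, I.smul_mem c hf, ?_, ?_⟩, hL⟩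
    · rw [hc, inv_mul_cancel₀ hL']
    · intro α hα
      rw [hc] at hα
      rcases le_total (weight L) (weight α) with h | h
      · exact h
      · exact hmin (right_ne_zero_of_mul hα) h
  have hfin : {L | Minimal (· ∈ E) L}.Finite :=
    (setOfPred_minimal_antichain (· ∈ E)).finite_of_partiallyWellOrderedOn
      (Set.isPWO_of_wellQuasiOrderedLE _)
  obtain ⟨k, L, hL⟩ : ∃ (k : ℕ) (L : Fin k → Fin m →₀ ℕ),
      Set.range L = {L | Minimal (· ∈ E) L} := by
    obtain ⟨k, L, -, h⟩ := hfin.fin_param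
    exact ⟨k, L, h⟩
  have hLE : ∀ j, L j ∈ E := fun j => (hL.subset ⟨j, rfl⟩ : Minimal (· ∈ E) (L j)).prop
  choose f hfI hf1 hfmin using hLE
  refine ⟨Finset.univ.image f, le_antisymm ?_ ?_⟩
  · rw [Submodule.span_le]
    intro x hx
    simp only [Finset.coe_image, Finset.coe_univ, Set.image_univ, Set.mem_range] at hx
    obtain ⟨j, rfl⟩ := hx
    exact hfI j
  · intro g hg
    obtain ⟨q, hq, hr⟩ := exists_division (fun j => (f j : MvPowerSeries (Fin m) ℝ)) L
      (fun j => (f j).2) hf1 hfmin g g.2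
    let q' : Fin k → convRing m := fun j => ⟨q j, hq j⟩
    have hmem : ∑ j, q' j * f j ∈ Submodule.span (convRing m)
        ((Finset.univ.image f : Finset (convRing m)) : Set (convRing m)) := by
      refine Submodule.sum_mem _ fun j _ => ?_
      rw [← smul_eq_mul]
      exact Submodule.smul_mem _ _ (Submodule.subset_span (by simp))
    have hrI : g - ∑ j, q' j * f j ∈ I := by
      refine I.sub_mem hg (I.sum_mem fun j _ => I.smul_mem (q' j) (hfI j))
    have hcoe : ((g - ∑ j, q' j * f j : convRing m) : MvPowerSeries (Fin m) ℝ) =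
        g - ∑ j, q j * f j := by
      simp [q']
    have : g - ∑ j, q' j * f j = 0 := by
      by_contra h0
      obtain ⟨A, hA, hA0⟩ := hlead _ hrI h0
      obtain ⟨B, hBA, hB⟩ := exists_minimal_le_of_wellFoundedLT (· ∈ E) A hA
      obtain ⟨j, hj⟩ : B ∈ Set.range L := by rw [hL]; exact hB
      rw [hcoe] at hA0
      exact hr A hA0 j (hj ▸ hBA)
    rw [sub_eq_zero.1 this]
    exact hmem

end Radon

namespace Radon
open MvPowerSeries

/-! ### Sums of convergent power series -/

/-- The monomial `z ^ α`. -/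
noncomputable def mpow {m : ℕ} (z : Fin m → ℝ) (α : Fin m →₀ ℕ) : ℝ := α.prod fun i a => z i ^ a

theorem mpow_add {m : ℕ} (z : Fin m → ℝ) (α β : Fin m →₀ ℕ) :
    mpow z (α + β) = mpow z α * mpow z β := by
  classical
  exact Finsupp.prod_add_index' (by simp) (by intros; rw [pow_add])

/-- The point `z` lies in the polydisc of radii `pᵢ⁻ᵘ`. -/
def InPolydisc {m : ℕ} (u : ℕ) (z : Fin m → ℝ) : Prop :=
  ∀ i, ‖z i‖ₑ ≤ ((Nat.nth Nat.Prime i : ENNReal)⁻¹) ^ u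

theorem enorm_mpow_le {m : ℕ} {u : ℕ} {z : Fin m → ℝ} (hz : InPolydisc u z) (α : Fin m →₀ ℕ) :
    ‖mpow z α‖ₑ ≤ ((weight α : ENNReal)⁻¹) ^ u := by
  classical
  induction α using Finsupp.induction_linear with
  | zero => simp [mpow, weight]
  | add α β hα hβ => rw [mpow_add, inv_weight_add, enorm_mul]; gcongr
  | single i k =>
    have h1 : mpow z (Finsupp.single i k) = z i ^ k := by simp [mpow]
    have h2 : weight (Finsupp.single i k) = Nat.nth Nat.Prime i ^ k := by simp [weight]
    rw [h1, h2, enorm_pow, Nat.cast_pow, ENNReal.inv_pow, ← pow_mul, mul_comm k u, pow_mul]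
    gcongr
    exact hz i

theorem eventually_inPolydisc {m : ℕ} (u : ℕ) : ∀ᶠ z in 𝓝 (0 : Fin m → ℝ), InPolydisc u z := by
  refine Filter.eventually_all.2 fun i => ?_
  have hc : Filter.Tendsto (fun z : Fin m → ℝ => ‖z i‖ₑ) (𝓝 0) (𝓝 0) := by
    have : Continuous fun z : Fin m → ℝ => ‖z i‖ₑ := by fun_prop
    simpa using this.tendsto 0
  refine hc.eventually_le_const ?_
  have : ((Nat.nth Nat.Prime i : ENNReal)⁻¹) ≠ 0 := ENNReal.inv_ne_zero.2 (ENNReal.natCast_ne_top _)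
  positivity

/-- The sum of a power series at `z`; zero where the series does not converge. -/
noncomputable def ev {m : ℕ} (f : MvPowerSeries (Fin m) ℝ) (z : Fin m → ℝ) : ℝ :=
  ∑' α, coeff α f * mpow z α

theorem summable_norm_ev {m u : ℕ} {f : MvPowerSeries (Fin m) ℝ} (hf : wnorm u f < ⊤)
    {z : Fin m → ℝ} (hz : InPolydisc u z) : Summable fun α => ‖coeff α f * mpow z α‖ := by
  have h : ∑' α, ‖coeff α f * mpow z α‖ₑ ≠ ⊤ := by
    refine (lt_of_le_of_lt (ENNReal.tsum_le_tsum fun α => ?_) hf).ne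
    rw [enorm_mul]
    gcongr
    exact enorm_mpow_le hz α
  simpa using ENNReal.summable_toReal h

theorem ev_add {m u : ℕ} {f g : MvPowerSeries (Fin m) ℝ} (hf : wnorm u f < ⊤) (hg : wnorm u g < ⊤)
    {z : Fin m → ℝ} (hz : InPolydisc u z) : ev (f + g) z = ev f z + ev g z := by
  unfold ev
  rw [← (summable_norm_ev hf hz).of_norm.tsum_add (summable_norm_ev hg hz).of_norm]
  simp [add_mul]

theorem tsum_mul_tsum_of_summable_norm {A : Type*} [AddCommMonoid A] [Finset.HasAntidiagonal A]
    {a b : A → ℝ} (ha : Summable fun x => ‖a x‖) (hb : Summable fun x => ‖b x‖) :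
    (∑' x, a x) * (∑' x, b x) =
      ∑' n, ∑ p ∈ Finset.HasAntidiagonal.antidiagonal n, a p.1 * b p.2 := by
  have h : Summable fun x : A × A => a x.1 * b x.2 := summable_mul_of_summable_norm ha hb
  exact ha.of_norm.tsum_mul_tsum_eq_tsum_sum_antidiagonal hb.of_norm h

theorem ev_mul {m u : ℕ} {f g : MvPowerSeries (Fin m) ℝ} (hf : wnorm u f < ⊤) (hg : wnorm u g < ⊤)
    {z : Fin m → ℝ} (hz : InPolydisc u z) : ev (f * g) z = ev f z * ev g z := by
  have h4 := tsum_mul_tsum_of_summable_norm (summable_norm_ev hf hz) (summable_norm_ev hg hz)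
  refine Eq.trans (tsum_congr fun n => ?_) h4.symm
  rw [coeff_mul, Finset.sum_mul]
  refine Finset.sum_congr rfl fun p hp => ?_
  rw [← Finset.HasAntidiagonal.mem_antidiagonal.1 hp, mpow_add, mul_mul_mul_comm]

theorem ev_monomial {m : ℕ} (α : Fin m →₀ ℕ) (c : ℝ) (z : Fin m → ℝ) :
    ev (MvPowerSeries.monomial α c) z = c * mpow z α := by
  classical
  unfold ev
  rw [tsum_eq_single α]
  · simp
  · intro β hβ
    simp [coeff_monomial, hβ]

/-- Every monomial of degree `k` is the diagonal of a `k`-linear form of norm at most `1`. -/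
theorem exists_multilinear_mpow {m : ℕ} (k : ℕ) (α : Fin m →₀ ℕ) (hα : α.degree = k) :
    ∃ φ : ContinuousMultilinearMap ℝ (fun _ : Fin k => Fin m → ℝ) ℝ,
      (∀ z, φ (fun _ => z) = mpow z α) ∧ ‖φ‖ ≤ 1 := by
  classical
  obtain ⟨l, hl⟩ := Quot.exists_rep α.toMultiset
  have hlen : l.length = k := by
    have : Multiset.card (α.toMultiset) = l.length := by rw [← hl]; rfl
    rw [← this, Finsupp.card_toMultiset, ← hα]
    rfl
  subst hlen
  refine ⟨(ContinuousMultilinearMap.mkPiAlgebraFin ℝ l.length ℝ).compContinuousLinearMap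
    (fun i => ContinuousLinearMap.proj (R := ℝ) (φ := fun _ : Fin m => ℝ) (l.get i)), ?_, ?_⟩
  · intro z
    have h1 : mpow z α = (Multiset.map z α.toMultiset).prod := by
      rw [Finsupp.toMultiset_map, Finsupp.prod_toMultiset, Finsupp.prod_mapDomain_index] <;>
        simp [mpow, pow_add]
    rw [h1, ← hl]
    simp only [ContinuousMultilinearMap.compContinuousLinearMap_apply,
      ContinuousMultilinearMap.mkPiAlgebraFin_apply, ContinuousLinearMap.proj_apply]
    change _ = (Multiset.map z (l : Multiset (Fin m))).prod
    rw [Multiset.map_coe, Multiset.prod_coe]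
    congr 1
    apply List.ext_get <;> simp
  · refine ContinuousMultilinearMap.opNorm_le_bound zero_le_one fun v => ?_
    simp only [ContinuousMultilinearMap.compContinuousLinearMap_apply,
      ContinuousMultilinearMap.mkPiAlgebraFin_apply, ContinuousLinearMap.proj_apply, one_mul]
    rw [List.prod_ofFn, norm_prod]
    exact Finset.prod_le_prod (fun _ _ => norm_nonneg _) fun i _ => norm_le_pi_norm (v i) _

theorem mpow_const {m : ℕ} (r : ℝ) (α : Fin m →₀ ℕ) : mpow (fun _ => r) α = r ^ α.degree := by
  classical
  rw [Finsupp.degree_apply]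
  exact Finset.prod_pow_eq_pow_sum _ _ _

/-- The sum of a convergent power series is analytic. -/
theorem analyticAt_ev {m : ℕ} {f : MvPowerSeries (Fin m) ℝ} (hf : IsConv f) :
    AnalyticAt ℝ (ev f) 0 := by
  classical
  obtain ⟨u, hu⟩ := hf
  choose φ hφ1 hφ2 using fun k (α : {α : Fin m →₀ ℕ // α.degree = k}) =>
    exists_multilinear_mpow k α.1 α.2
  have hfin : ∀ k, {α : Fin m →₀ ℕ | α.degree = k}.Finite := fun k =>
    (Finset.finite_toSet (Finset.finsuppAntidiag Finset.univ k)).subset fun α hα => by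
      simp only [Finset.mem_coe, Finset.mem_finsuppAntidiag]
      exact ⟨by rw [← hα, Finsupp.degree_eq_sum], Finset.subset_univ _⟩
  have hft : ∀ k, Fintype {α : Fin m →₀ ℕ // α.degree = k} := fun k => (hfin k).fintype
  let p : FormalMultilinearSeries ℝ (Fin m → ℝ) ℝ :=
    fun k => ∑ α : {α : Fin m →₀ ℕ // α.degree = k}, coeff α.1 f • φ k α
  obtain ⟨r, hr0, hr⟩ : ∃ r : NNReal, 0 < r ∧ ∀ z : Fin m → ℝ, ‖z‖ ≤ r → InPolydisc u z := by
    obtain ⟨ε, hε, h⟩ := Metric.eventually_nhds_iff.1 (eventually_inPolydisc (m := m) u)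
    refine ⟨Real.toNNReal (ε / 2), Real.toNNReal_pos.2 (half_pos hε), fun z hz => h ?_⟩
    rw [dist_zero_right]
    have : ‖z‖ ≤ ε / 2 := by rwa [Real.coe_toNNReal _ (half_pos hε).le] at hz
    linarith
  have hrd : InPolydisc u (fun _ : Fin m => (r : ℝ)) := hr _ <| by
    refine (pi_norm_const_le _).trans ?_
    simp
  refine ⟨p, r, ?_, by exact_mod_cast hr0, ?_⟩
  · refine p.le_radius_of_bound (∑' α, ‖coeff α f * mpow (fun _ => (r : ℝ)) α‖) fun k => ?_
    have h1 : ‖p k‖ ≤ ∑ α : {α : Fin m →₀ ℕ // α.degree = k}, ‖coeff α.1 f‖ := by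
      refine (norm_sum_le _ _).trans (Finset.sum_le_sum fun α _ => ?_)
      rw [norm_smul]
      exact mul_le_of_le_one_right (norm_nonneg _) (hφ2 k α)
    calc ‖p k‖ * (r : ℝ) ^ k ≤ (∑ α : {α : Fin m →₀ ℕ // α.degree = k}, ‖coeff α.1 f‖) *
          (r : ℝ) ^ k := by gcongr
      _ = ∑ α : {α : Fin m →₀ ℕ // α.degree = k}, ‖coeff α.1 f * mpow (fun _ => (r : ℝ)) α.1‖ := by
          rw [Finset.sum_mul]
          refine Finset.sum_congr rfl fun α _ => ?_
          rw [mpow_const, α.2, norm_mul]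
          simp
      _ = ∑' α : {α : Fin m →₀ ℕ // α.degree = k},
            ‖coeff α.1 f * mpow (fun _ => (r : ℝ)) α.1‖ := (tsum_fintype _).symm
      _ ≤ _ := Summable.tsum_subtype_le _ {α : Fin m →₀ ℕ | α.degree = k} (fun _ => norm_nonneg _)
          (summable_norm_ev hu hrd)
  · intro y hy
    have hy' : ‖y‖ ≤ r := by
      have := hy
      rw [Metric.mem_eball, edist_zero_right] at this
      have h2 : (‖y‖₊ : ENNReal) < r := this
      exact_mod_cast h2.le
    have hs := (summable_norm_ev hu (hr y hy')).of_norm.hasSum.tsum_fiberwise Finsupp.degree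
    rw [zero_add]
    change HasSum _ (ev f y) at hs
    refine hs.congr_fun fun k => ?_
    change p k (fun _ => y) = ∑' α : {α : Fin m →₀ ℕ // α.degree = k}, coeff α.1 f * mpow y α.1
    rw [tsum_fintype]
    simp only [p, _root_.sum_apply, _root_.smul_apply, hφ1,
      smul_eq_mul]

/-- Every function that is analytic at `0` is near `0` the sum of a convergent power series. -/
theorem exists_ev_eq {m : ℕ} {f : (Fin m → ℝ) → ℝ} (hf : AnalyticAt ℝ f 0) :
    ∃ g, IsConv g ∧ ∀ᶠ z in 𝓝 0, f z = ev g z := by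
  classical
  obtain ⟨p, r, hp⟩ := hf
  obtain ⟨ρ, hρ0, hρ⟩ := ENNReal.lt_iff_exists_nnreal_btwn.1 (hp.r_pos.trans_le hp.r_le)
  obtain ⟨C, hC0, hC⟩ := p.norm_mul_pow_le_of_lt_radius hρ
  have hρ0' : 0 < (ρ : ℝ) := by exact_mod_cast hρ0
  obtain ⟨u, hu⟩ : ∃ u : ℕ, (m : ℝ) * (2⁻¹) ^ u ≤ ρ / 2 := by
    have : Filter.Tendsto (fun u : ℕ => (m : ℝ) * (2⁻¹) ^ u) Filter.atTop (𝓝 (m * 0)) :=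
      (tendsto_pow_atTop_nhds_zero_of_lt_one (by norm_num) (by norm_num)).const_mul _
    rw [mul_zero] at this
    exact (this.eventually_le_const (half_pos hρ0')).exists
  let b : (Σ k : ℕ, Fin k → Fin m) → ℝ := fun x => p x.1 fun i => Pi.single (x.2 i) 1
  let cnt : (Σ k : ℕ, Fin k → Fin m) → (Fin m →₀ ℕ) := fun x => ∑ i, Finsupp.single (x.2 i) 1
  have hmpow : ∀ z x, mpow z (cnt x) = ∏ i, z (x.2 i) := by
    intro z x
    have : ∀ s : Finset (Fin x.1), mpow z (∑ i ∈ s, Finsupp.single (x.2 i) 1) =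
        ∏ i ∈ s, z (x.2 i) := by
      intro s
      induction s using Finset.induction_on with
      | empty => simp [mpow]
      | insert a s ha ih =>
        rw [Finset.sum_insert ha, Finset.prod_insert ha, mpow_add, ih]
        simp [mpow]
    exact this _
  have hweight : ∀ x, ((weight (cnt x) : ENNReal)⁻¹) ^ u ≤ ((2⁻¹ : ENNReal) ^ u) ^ x.1 := by
    intro x
    have : ∀ s : Finset (Fin x.1), ((weight (∑ i ∈ s, Finsupp.single (x.2 i) 1) : ENNReal)⁻¹) ^ u ≤
        ((2⁻¹ : ENNReal) ^ u) ^ s.card := by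
      intro s
      induction s using Finset.induction_on with
      | empty => simp [weight]
      | insert a s ha ih =>
        rw [Finset.sum_insert ha, inv_weight_add, Finset.card_insert_of_notMem ha, pow_succ']
        gcongr
        have h2 : weight (Finsupp.single (x.2 a) 1) = Nat.nth Nat.Prime (x.2 a) := by simp [weight]
        rw [h2]
        exact_mod_cast (prime_nth _).two_le
    simpa using this Finset.univ
  have hb : ∀ x, ‖b x‖ ≤ ‖p x.1‖ := by
    intro x
    refine ((p x.1).le_opNorm _).trans (mul_le_of_le_one_right (norm_nonneg _) ?_)
    refine Finset.prod_le_one (fun _ _ => norm_nonneg _) fun i _ => ?_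
    rw [Pi.norm_single, norm_one]
  let g : MvPowerSeries (Fin m) ℝ := fun α => ∑' x : cnt ⁻¹' {α}, b x.1
  have cg : ∀ α, coeff α g = ∑' x : cnt ⁻¹' {α}, b x.1 := fun _ => rfl
  have htot : ∑' x, ‖b x‖ₑ * ((weight (cnt x) : ENNReal)⁻¹) ^ u < ⊤ := by
    have hle : ∀ k, ∑' c : Fin k → Fin m, ‖b ⟨k, c⟩‖ₑ * ((weight (cnt ⟨k, c⟩) : ENNReal)⁻¹) ^ u ≤
        ENNReal.ofReal C * 2⁻¹ ^ k := by
      intro k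
      calc _ ≤ ∑' c : Fin k → Fin m, ENNReal.ofReal (‖p k‖ * ((2⁻¹ : ℝ) ^ u) ^ k) := by
            refine ENNReal.tsum_le_tsum fun c => ?_
            rw [ENNReal.ofReal_mul (norm_nonneg _), ENNReal.ofReal_pow (by positivity),
              ENNReal.ofReal_pow (by positivity), ENNReal.ofReal_inv_of_pos two_pos,
              ENNReal.ofReal_ofNat]
            refine mul_le_mul' ?_ (hweight ⟨k, c⟩)
            rw [← ofReal_norm]
            exact ENNReal.ofReal_le_ofReal (hb ⟨k, c⟩)
        _ = ENNReal.ofReal (((m : ℝ) * (2⁻¹) ^ u) ^ k * ‖p k‖) := by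
            rw [tsum_fintype, Finset.sum_const, Finset.card_univ, Fintype.card_fun,
              Fintype.card_fin, Fintype.card_fin, nsmul_eq_mul, ← ENNReal.ofReal_natCast,
              ← ENNReal.ofReal_mul (by positivity)]
            congr 1
            push_cast
            rw [mul_pow]
            ring
        _ ≤ ENNReal.ofReal (C * (2⁻¹) ^ k) := by
            refine ENNReal.ofReal_le_ofReal ?_
            calc _ ≤ ((ρ : ℝ) / 2) ^ k * ‖p k‖ := by gcongr
              _ = (‖p k‖ * (ρ : ℝ) ^ k) * (2⁻¹) ^ k := by rw [div_eq_mul_inv, mul_pow]; ring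
              _ ≤ _ := by gcongr; exact hC k
        _ = _ := by
            rw [ENNReal.ofReal_mul hC0.le, ENNReal.ofReal_pow (by positivity),
              ENNReal.ofReal_inv_of_pos two_pos, ENNReal.ofReal_ofNat]
    rw [ENNReal.tsum_sigma']
    refine (ENNReal.tsum_le_tsum hle).trans_lt ?_
    rw [ENNReal.tsum_mul_left, ENNReal.tsum_geometric, ENNReal.one_sub_inv_two, inv_inv]
    exact ENNReal.mul_lt_top ENNReal.ofReal_lt_top ENNReal.ofNat_lt_top
  refine ⟨g, ⟨u, lt_of_le_of_lt ?_ htot⟩, ?_⟩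
  · rw [← ENNReal.tsum_fiberwise _ cnt]
    refine ENNReal.tsum_le_tsum fun α => ?_
    rw [cg]
    calc _ ≤ (∑' x : cnt ⁻¹' {α}, ‖b x.1‖ₑ) * ((weight α : ENNReal)⁻¹) ^ u := by
          gcongr; exact enorm_tsum_le_tsum_enorm
      _ = _ := by
          rw [← ENNReal.tsum_mul_right]
          refine tsum_congr fun x => ?_
          rw [show cnt x.1 = α from x.2]
  · filter_upwards [eventually_inPolydisc u, Metric.eball_mem_nhds (0 : Fin m → ℝ) hp.r_pos]
      with z hz hzr
    have hsum : Summable fun x => b x * mpow z (cnt x) := by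
      have h : ∑' x, ‖b x * mpow z (cnt x)‖ₑ ≠ ⊤ := by
        refine (lt_of_le_of_lt (ENNReal.tsum_le_tsum fun x => ?_) htot).ne
        rw [enorm_mul]
        gcongr
        exact enorm_mpow_le hz _
      refine Summable.of_norm ?_
      simpa using ENNReal.summable_toReal h
    have hk : ∀ k, p k (fun _ => z) = ∑ c : Fin k → Fin m, b ⟨k, c⟩ * mpow z (cnt ⟨k, c⟩) := by
      intro k
      have hz' : (fun _ : Fin k => z) = fun _ => ∑ j, z j • (Pi.single j 1 : Fin m → ℝ) := by
        funext _
        exact pi_eq_sum_univ' z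
      rw [hz', ContinuousMultilinearMap.map_sum]
      refine Finset.sum_congr rfl fun c _ => ?_
      rw [ContinuousMultilinearMap.map_smul_univ, hmpow, smul_eq_mul, mul_comm]
    have h1 := hp.hasSum hzr
    rw [zero_add] at h1
    have h2 : HasSum (fun k => p k fun _ => z) (∑' x, b x * mpow z (cnt x)) := by
      refine hsum.hasSum.sigma fun k => ?_
      rw [hk]
      exact hasSum_fintype _
    rw [h1.unique h2, ev, ← (hsum.hasSum.tsum_fiberwise cnt).tsum_eq]
    refine tsum_congr fun α => ?_
    rw [cg, ← tsum_mul_right]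
    refine tsum_congr fun x => ?_
    rw [show cnt x.1 = α from x.2]

end Radon

namespace Radon
open MvPowerSeries

/-! ### The ring of germs of analytic functions -/

section Germs

variable {E F : Type*} [NormedAddCommGroup E] [NormedSpace ℝ E]
  [NormedAddCommGroup F] [NormedSpace ℝ F]

/-- The ring of germs at `0` of real analytic functions on a normed space. -/
def anGerm (E : Type*) [NormedAddCommGroup E] [NormedSpace ℝ E] :
    Subring (Filter.Germ (𝓝 (0 : E)) ℝ) where
  carrier := {φ | ∃ f : E → ℝ, AnalyticAt ℝ f 0 ∧ (f : Filter.Germ (𝓝 (0 : E)) ℝ) = φ}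
  mul_mem' := by
    rintro _ _ ⟨f, hf, rfl⟩ ⟨g, hg, rfl⟩
    exact ⟨f * g, hf.mul hg, rfl⟩
  one_mem' := ⟨fun _ => 1, analyticAt_const, rfl⟩
  add_mem' := by
    rintro _ _ ⟨f, hf, rfl⟩ ⟨g, hg, rfl⟩
    exact ⟨f + g, hf.add hg, rfl⟩
  zero_mem' := ⟨fun _ => 0, analyticAt_const, rfl⟩
  neg_mem' := by
    rintro _ ⟨f, hf, rfl⟩
    exact ⟨-f, hf.neg, rfl⟩

/-- The germ of a function that is analytic at `0`. -/
def toGerm (f : E → ℝ) (hf : AnalyticAt ℝ f 0) : anGerm E := ⟨f, f, hf, rfl⟩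

/-- A function representing a germ. -/
noncomputable def rep (φ : anGerm E) : E → ℝ := φ.2.choose

theorem analyticAt_rep (φ : anGerm E) : AnalyticAt ℝ (rep φ) 0 := φ.2.choose_spec.1

theorem coe_rep (φ : anGerm E) : (rep φ : Filter.Germ (𝓝 (0 : E)) ℝ) = φ := φ.2.choose_spec.2

theorem toGerm_rep (φ : anGerm E) : toGerm (rep φ) (analyticAt_rep φ) = φ :=
  Subtype.ext (coe_rep φ)

theorem toGerm_eq_iff {f g : E → ℝ} (hf : AnalyticAt ℝ f 0) (hg : AnalyticAt ℝ g 0) :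
    toGerm f hf = toGerm g hg ↔ f =ᶠ[𝓝 0] g :=
  Subtype.ext_iff.trans Filter.Germ.coe_eq

theorem rep_toGerm {f : E → ℝ} (hf : AnalyticAt ℝ f 0) : rep (toGerm f hf) =ᶠ[𝓝 0] f :=
  Filter.Germ.coe_eq.1 (coe_rep (toGerm f hf))

theorem germ_ext {φ ψ : anGerm E} (h : rep φ =ᶠ[𝓝 0] rep ψ) : φ = ψ := by
  rw [← toGerm_rep φ, ← toGerm_rep ψ, toGerm_eq_iff]
  exact h

theorem rep_add (φ ψ : anGerm E) : rep (φ + ψ) =ᶠ[𝓝 0] fun x => rep φ x + rep ψ x := by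
  refine Filter.Germ.coe_eq.1 ((coe_rep _).trans ?_)
  change (φ : Filter.Germ (𝓝 (0 : E)) ℝ) + ψ = _
  rw [← coe_rep φ, ← coe_rep ψ]
  rfl

theorem rep_mul (φ ψ : anGerm E) : rep (φ * ψ) =ᶠ[𝓝 0] fun x => rep φ x * rep ψ x := by
  refine Filter.Germ.coe_eq.1 ((coe_rep _).trans ?_)
  change (φ : Filter.Germ (𝓝 (0 : E)) ℝ) * ψ = _
  rw [← coe_rep φ, ← coe_rep ψ]
  rfl

theorem rep_neg (φ : anGerm E) : rep (-φ) =ᶠ[𝓝 0] fun x => -rep φ x := by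
  refine Filter.Germ.coe_eq.1 ((coe_rep _).trans ?_)
  change -(φ : Filter.Germ (𝓝 (0 : E)) ℝ) = _
  rw [← coe_rep φ]
  rfl

theorem rep_sub (φ ψ : anGerm E) : rep (φ - ψ) =ᶠ[𝓝 0] fun x => rep φ x - rep ψ x := by
  rw [sub_eq_add_neg]
  filter_upwards [rep_add φ (-ψ), rep_neg ψ] with x h1 h2
  rw [h1, h2, sub_eq_add_neg]

theorem rep_zero : rep (0 : anGerm E) =ᶠ[𝓝 0] fun _ => 0 :=
  Filter.Germ.coe_eq.1 (coe_rep _)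

theorem rep_one : rep (1 : anGerm E) =ᶠ[𝓝 0] fun _ => 1 :=
  Filter.Germ.coe_eq.1 (coe_rep _)

theorem rep_sum {ι : Type*} (s : Finset ι) (φ : ι → anGerm E) :
    rep (∑ i ∈ s, φ i) =ᶠ[𝓝 0] fun x => ∑ i ∈ s, rep (φ i) x := by
  classical
  induction s using Finset.induction_on with
  | empty => simpa using rep_zero
  | insert a s ha ih =>
    rw [Finset.sum_insert ha]
    filter_upwards [rep_add (φ a) (∑ i ∈ s, φ i), ih] with x h1 h2
    rw [h1, h2, Finset.sum_insert ha]

theorem rep_pow (φ : anGerm E) (k : ℕ) : rep (φ ^ k) =ᶠ[𝓝 0] fun x => rep φ x ^ k := by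
  induction k with
  | zero => simpa using rep_one
  | succ k ih =>
    rw [pow_succ]
    filter_upwards [rep_mul (φ ^ k) φ, ih] with x h1 h2
    rw [h1, h2, pow_succ]

/-- Real numbers act on germs as constant functions. -/
noncomputable instance : Algebra ℝ (anGerm E) :=
  RingHom.toAlgebra
    { toFun := fun c => toGerm (fun _ => c) analyticAt_const
      map_one' := rfl
      map_mul' := fun _ _ => rfl
      map_zero' := rfl
      map_add' := fun _ _ => rfl }

theorem rep_smul (c : ℝ) (φ : anGerm E) : rep (c • φ) =ᶠ[𝓝 0] fun x => c * rep φ x := by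
  rw [Algebra.smul_def]
  filter_upwards [rep_mul (algebraMap ℝ (anGerm E) c) φ,
    rep_toGerm (E := E) (f := fun _ => c) analyticAt_const] with x h1 h2
  rw [h1]
  congr 1

/-- A germ vanishing at `0` lies in the Jacobson radical. -/
theorem toGerm_mem_jacobson {f : E → ℝ} (hf : AnalyticAt ℝ f 0) (h0 : f 0 = 0) :
    toGerm f hf ∈ Ideal.jacobson (⊥ : Ideal (anGerm E)) := by
  rw [Ideal.mem_jacobson_bot]
  intro y
  have h1 := (rep_add (toGerm f hf * y) 1).self_of_nhds
  have h2 := (rep_mul (toGerm f hf) y).self_of_nhds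
  have h3 := (rep_toGerm hf).self_of_nhds
  have h4 := (rep_one (E := E)).self_of_nhds
  have hne : rep (toGerm f hf * y + 1) 0 ≠ 0 := by
    simp only [h1, h2, h3, h4, h0]
    norm_num
  set ψ := toGerm f hf * y + 1
  have ha := analyticAt_rep ψ
  refine IsUnit.of_mul_eq_one (toGerm (fun x => (rep ψ x)⁻¹) (ha.inv hne)) (germ_ext ?_)
  filter_upwards [rep_mul ψ (toGerm (fun x => (rep ψ x)⁻¹) (ha.inv hne)), rep_one (E := E),
    rep_toGerm (f := fun x => (rep ψ x)⁻¹) (ha.inv hne), ha.continuousAt.eventually_ne hne]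
    with x h1 h2 h3 h4
  rw [h1, h2, h3]
  exact mul_inv_cancel₀ h4

/-- Summation of convergent power series in linear coordinates `e`, as a ring homomorphism. -/
noncomputable def evGerm {d : ℕ} (e : E →L[ℝ] (Fin d → ℝ)) : convRing d →+* anGerm E where
  toFun f := toGerm (fun x => ev (f : MvPowerSeries (Fin d) ℝ) (e x))
    (analyticAt_ev f.2 |>.comp_of_eq (e.analyticAt 0) (map_zero e))
  map_one' := by
    refine (toGerm_eq_iff _ analyticAt_const).2 (Filter.Eventually.of_forall fun x => ?_)
    exact (ev_monomial 0 1 (e x)).trans (by simp [mpow])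
  map_zero' := by
    refine (toGerm_eq_iff _ analyticAt_const).2 (Filter.Eventually.of_forall fun x => ?_)
    simp [ev]
  map_mul' f g := by
    obtain ⟨u, hu⟩ := f.2
    obtain ⟨v, hv⟩ := g.2
    refine (toGerm_eq_iff _ (AnalyticAt.mul (analyticAt_ev f.2 |>.comp_of_eq (e.analyticAt 0)
      (map_zero e)) (analyticAt_ev g.2 |>.comp_of_eq (e.analyticAt 0) (map_zero e)))).2 ?_
    have ht : Filter.Tendsto e (𝓝 0) (𝓝 0) := by simpa using e.continuous.tendsto 0
    filter_upwards [ht.eventually (eventually_inPolydisc (max u v))] with x hx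
    exact ev_mul ((wnorm_anti (le_max_left u v) _).trans_lt hu)
      ((wnorm_anti (le_max_right u v) _).trans_lt hv) hx
  map_add' f g := by
    obtain ⟨u, hu⟩ := f.2
    obtain ⟨v, hv⟩ := g.2
    refine (toGerm_eq_iff _ (AnalyticAt.add (analyticAt_ev f.2 |>.comp_of_eq (e.analyticAt 0)
      (map_zero e)) (analyticAt_ev g.2 |>.comp_of_eq (e.analyticAt 0) (map_zero e)))).2 ?_
    have ht : Filter.Tendsto e (𝓝 0) (𝓝 0) := by simpa using e.continuous.tendsto 0
    filter_upwards [ht.eventually (eventually_inPolydisc (max u v))] with x hx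
    exact ev_add ((wnorm_anti (le_max_left u v) _).trans_lt hu)
      ((wnorm_anti (le_max_right u v) _).trans_lt hv) hx

/-- The ring of germs of analytic functions in finitely many variables is Noetherian. -/
instance isNoetherianRing_anGerm [FiniteDimensional ℝ E] : IsNoetherianRing (anGerm E) := by
  let e : E ≃L[ℝ] (Fin (Module.finrank ℝ E) → ℝ) := (Module.finBasis ℝ E).equivFunL
  refine isNoetherianRing_of_surjective (convRing (Module.finrank ℝ E)) (anGerm E)
    (evGerm (e : E →L[ℝ] (Fin (Module.finrank ℝ E) → ℝ))) fun φ => ?_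
  have ha : AnalyticAt ℝ (fun z => rep φ (e.symm z)) 0 :=
    (analyticAt_rep φ).comp_of_eq (e.symm.analyticAt 0) (map_zero _)
  obtain ⟨g, hg, h⟩ := exists_ev_eq ha
  refine ⟨⟨g, hg⟩, ?_⟩
  rw [← toGerm_rep φ]
  refine (toGerm_eq_iff ((analyticAt_ev hg).comp_of_eq (e.analyticAt 0) (map_zero e)) _).2 ?_
  have ht : Filter.Tendsto e (𝓝 0) (𝓝 0) := by simpa using e.continuous.tendsto 0
  filter_upwards [ht.eventually h] with x hx
  rw [ContinuousLinearEquiv.symm_apply_apply] at hx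
  exact hx.symm

/-! ### Division by a coordinate -/

/-- An analytic function vanishing on a coordinate hyperplane is divisible by the coordinate. -/
theorem exists_eq_coord_mul {m : ℕ} {f : (Fin m → ℝ) → ℝ} (hf : AnalyticAt ℝ f 0) (j : Fin m)
    (h0 : ∀ᶠ z in 𝓝 0, z j = 0 → f z = 0) :
    ∃ g : (Fin m → ℝ) → ℝ, AnalyticAt ℝ g 0 ∧ ∀ᶠ z in 𝓝 0, f z = z j * g z := by
  classical
  obtain ⟨p, ⟨u, hu⟩, hp⟩ := exists_ev_eq hf
  let q : MvPowerSeries (Fin m) ℝ := fun α => coeff (α + Finsupp.single j 1) p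
  have cq : ∀ α, coeff α q = coeff (α + Finsupp.single j 1) p := fun _ => rfl
  have hq : wnorm u q < ⊤ := by
    have h1 : wnorm u q * ((weight (Finsupp.single j 1 : Fin m →₀ ℕ) : ENNReal)⁻¹) ^ u ≤
        wnorm u p := by
      unfold wnorm
      rw [← ENNReal.tsum_mul_right]
      refine le_trans (ENNReal.tsum_le_tsum fun β => ?_)
        (ENNReal.tsum_comp_le_tsum_of_injective
          (f := fun β : Fin m →₀ ℕ => β + Finsupp.single j 1) (add_left_injective _) _)
      rw [mul_assoc, ← inv_weight_add, cq]
    refine lt_of_le_of_ne le_top fun h => ?_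
    rw [h, ENNReal.top_mul (by simp)] at h1
    exact hu.ne (top_le_iff.1 h1)
  refine ⟨ev q, analyticAt_ev ⟨u, hq⟩, ?_⟩
  have hupd : Filter.Tendsto (fun z : Fin m → ℝ => Function.update z j 0) (𝓝 0) (𝓝 0) := by
    have hc : Continuous fun z : Fin m → ℝ => Function.update z j (0 : ℝ) :=
      continuous_id.update j continuous_const
    have := hc.tendsto 0
    rwa [show Function.update (0 : Fin m → ℝ) j 0 = 0 from Function.update_eq_self j 0] at this
  filter_upwards [hp, eventually_inPolydisc u, hupd.eventually hp, hupd.eventually h0] with z h1 h2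
    h3 h4
  have h5 : InPolydisc u (Function.update z j 0) := by
    intro i
    by_cases hi : i = j
    · subst hi; simp
    · rw [Function.update_of_ne hi]; exact h2 i
  rw [h4 (by simp)] at h3
  -- the difference of the values at `z` and at its projection involves only monomials with `z j`
  have hs1 := (summable_norm_ev hu h2).of_norm
  have hs2 := (summable_norm_ev hu h5).of_norm
  have hshift : Function.Injective fun β : Fin m →₀ ℕ => β + Finsupp.single j 1 :=
    add_left_injective _
  calc f z = ev p z - ev p (Function.update z j 0) := by rw [h1, ← h3, sub_zero]
    _ = ∑' α, coeff α p * (mpow z α - mpow (Function.update z j 0) α) := by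
        unfold ev
        rw [← hs1.tsum_sub hs2]
        simp only [mul_sub]
    _ = ∑' β : Fin m →₀ ℕ, coeff (β + Finsupp.single j 1) p *
          (mpow z (β + Finsupp.single j 1) -
            mpow (Function.update z j 0) (β + Finsupp.single j 1)) := by
        refine (hshift.tsum_eq ?_).symm
        intro α hα
        refine ⟨α - Finsupp.single j 1, tsub_add_cancel_of_le ?_⟩
        rw [Finsupp.single_le_iff]
        by_contra hlt
        have hj : α j = 0 := by omega
        refine hα ?_
        have : mpow (Function.update z j 0) α = mpow z α := by
          refine Finsupp.prod_congr fun i hi => ?_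
          rw [Function.update_of_ne]
          rintro rfl
          exact Finsupp.mem_support_iff.1 hi hj
        simp [this]
    _ = ∑' β : Fin m →₀ ℕ, z j * (coeff β q * mpow z β) := by
        refine tsum_congr fun β => ?_
        have e1 : ∀ w : Fin m → ℝ, mpow w (Finsupp.single j 1) = w j := fun w => by simp [mpow]
        rw [mpow_add, mpow_add, e1, e1, Function.update_self, cq]
        ring
    _ = z j * ev q z := tsum_mul_left

/-- An analytic function on `ℝ × F` vanishing on `{0} × F` is divisible by the first coordinate. -/
theorem exists_eq_fst_mul [FiniteDimensional ℝ F] {f : ℝ × F → ℝ} (hf : AnalyticAt ℝ f 0)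
    (h0 : ∀ᶠ z in 𝓝 (0 : F), f (0, z) = 0) :
    ∃ g : ℝ × F → ℝ, AnalyticAt ℝ g 0 ∧ ∀ᶠ p in 𝓝 0, f p = p.1 * g p := by
  let e : F ≃L[ℝ] (Fin (Module.finrank ℝ F) → ℝ) := (Module.finBasis ℝ F).equivFunL
  let c : (ℝ × (Fin (Module.finrank ℝ F) → ℝ)) ≃L[ℝ] (Fin (Module.finrank ℝ F + 1) → ℝ) :=
    Fin.consEquivL ℝ (fun _ => ℝ)
  let a : (ℝ × F) ≃L[ℝ] (Fin (Module.finrank ℝ F + 1) → ℝ) :=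
    ((ContinuousLinearEquiv.refl ℝ ℝ).prodCongr e).trans c
  have ha : ∀ p, a p 0 = p.1 := fun p => rfl
  have hs : Filter.Tendsto a.symm (𝓝 0) (𝓝 0) := by simpa using a.symm.continuous.tendsto 0
  have hs' : Filter.Tendsto a (𝓝 0) (𝓝 0) := by simpa using a.continuous.tendsto 0
  have h0' : ∀ᶠ p in 𝓝 (0 : ℝ × F), f (0, p.2) = 0 :=
    continuous_snd.tendsto (0 : ℝ × F) |>.eventually h0
  obtain ⟨g, hg, h⟩ := exists_eq_coord_mul (f := fun w => f (a.symm w))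
    (hf.comp_of_eq (a.symm.analyticAt 0) (map_zero _)) 0 (by
      filter_upwards [hs.eventually h0'] with w hw hw0
      have h1 : (a.symm w).1 = 0 := by
        rw [← ha, ContinuousLinearEquiv.apply_symm_apply, hw0]
      rw [← h1] at hw
      exact hw.trans h1)
  refine ⟨fun p => g (a p), hg.comp_of_eq (a.analyticAt 0) (map_zero _), ?_⟩
  filter_upwards [hs'.eventually h] with p hp
  rwa [ContinuousLinearEquiv.symm_apply_apply, ha] at hp

/-- An inequality that holds off the hyperplane `τ = 0` extends to it by continuity. -/
theorem eventually_le_of_fst_ne_zero {f g : ℝ × F → ℝ} (hf : ∀ᶠ p in 𝓝 0, ContinuousAt f p)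
    (hg : ∀ᶠ p in 𝓝 0, ContinuousAt g p) (h : ∀ᶠ p in 𝓝 (0 : ℝ × F), p.1 ≠ 0 → f p ≤ g p) :
    ∀ᶠ p in 𝓝 0, f p ≤ g p := by
  filter_upwards [h.eventually_nhds, hf, hg] with p hp hfp hgp
  have hcl : p ∈ closure {p : ℝ × F | p.1 ≠ 0} := by
    have h2 : {p : ℝ × F | p.1 ≠ 0} = ({0}ᶜ : Set ℝ) ×ˢ (Set.univ : Set F) := by
      ext p; simp
    rw [h2, closure_prod_eq, closure_univ, (dense_compl_singleton (0 : ℝ)).closure_eq]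
    trivial
  have hne : (𝓝[{p : ℝ × F | p.1 ≠ 0}] p).NeBot := mem_closure_iff_nhdsWithin_neBot.1 hcl
  have c1 : Filter.Tendsto f (𝓝[{p : ℝ × F | p.1 ≠ 0}] p) (𝓝 (f p)) :=
    hfp.tendsto.mono_left nhdsWithin_le_nhds
  have c2 : Filter.Tendsto g (𝓝[{p : ℝ × F | p.1 ≠ 0}] p) (𝓝 (g p)) :=
    hgp.tendsto.mono_left nhdsWithin_le_nhds
  refine le_of_tendsto_of_tendsto c1 c2 ?_
  filter_upwards [nhdsWithin_le_nhds hp, self_mem_nhdsWithin] with w hw hw0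
  exact hw hw0

/-- An analytic function on `ℝ × F` that is `O(|τ|^k)` is divisible by `τ ^ k`. -/
theorem exists_eq_fst_pow_mul [FiniteDimensional ℝ F] (k : ℕ) {f : ℝ × F → ℝ}
    (hf : AnalyticAt ℝ f 0) {C : ℝ} (h0 : ∀ᶠ p in 𝓝 (0 : ℝ × F), |f p| ≤ C * |p.1| ^ k) :
    ∃ g : ℝ × F → ℝ, AnalyticAt ℝ g 0 ∧ ∀ᶠ p in 𝓝 0, f p = p.1 ^ k * g p := by
  induction k generalizing f with
  | zero => exact ⟨f, hf, by simp⟩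
  | succ k ih =>
    have hinr : Filter.Tendsto (fun z : F => ((0 : ℝ), z)) (𝓝 0) (𝓝 0) :=
      (Continuous.prodMk_right (0 : ℝ)).tendsto 0
    obtain ⟨g, hg, h⟩ := exists_eq_fst_mul hf (by
      filter_upwards [hinr.eventually h0] with z hz
      simpa using hz)
    have hbound : ∀ᶠ p in 𝓝 (0 : ℝ × F), |g p| ≤ C * |p.1| ^ k := by
      refine eventually_le_of_fst_ne_zero
        (hg.eventually_analyticAt.mono fun p hp => hp.continuousAt.abs)
        (Filter.Eventually.of_forall fun p => by fun_prop) ?_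
      filter_upwards [h, h0] with w hw h3 hw0
      have hpos : 0 < |w.1| := abs_pos.2 hw0
      rw [hw, abs_mul, pow_succ, ← mul_assoc, mul_comm |w.1|] at h3
      exact le_of_mul_le_mul_right h3 hpos
    obtain ⟨g', hg', h'⟩ := ih hg hbound
    refine ⟨g', hg', ?_⟩
    filter_upwards [h, h'] with p h1 h2
    rw [h1, h2, pow_succ]
    ring

end Germs

end Radon

namespace Radon

/-! ### Bounds for derivatives along vector fields -/

theorem analyticAt_clm_apply {D E F : Type*} [NormedAddCommGroup D] [NormedSpace ℝ D]
    [NormedAddCommGroup E] [NormedSpace ℝ E] [NormedAddCommGroup F] [NormedSpace ℝ F]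
    {L : D → E →L[ℝ] F} {v : D → E} {a : D} (hL : AnalyticAt ℝ L a) (hv : AnalyticAt ℝ v a) :
    AnalyticAt ℝ (fun p => L p (v p)) a :=
  AnalyticAt.comp (g := fun q : (E →L[ℝ] F) × E => q.1 q.2) (f := fun p => (L p, v p))
    ((ContinuousLinearMap.id ℝ (E →L[ℝ] F)).analyticAt_bilinear (L a, v a)) (hL.prod hv)

theorem DerivsBoundedBy.mono {E : Type*} [NormedAddCommGroup E] [NormedSpace ℝ E] {ι : Type*}
    {Y : ι → E → E} {S : Set E} {C C' : ℝ} (hC : C ≤ C') {m : ℕ} {f : E → ℝ}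
    (h : DerivsBoundedBy Y S C m f) : DerivsBoundedBy Y S C' m f := by
  induction m generalizing f with
  | zero => exact ⟨h.1, fun y hy => (h.2 y hy).trans hC⟩
  | succ m ih =>
    refine ⟨⟨h.1.1, fun y hy => (h.1.2 y hy).trans hC⟩, fun i => ?_⟩
    obtain ⟨g, hg, hg'⟩ := h.2 i
    exact ⟨g, hg, ih hg'⟩

/-- The derivatives of an analytic function along analytic vector fields, all depending on a
parameter, are bounded uniformly on compact sets of parameters and points. -/
theorem exists_derivsBoundedBy {P E : Type*} [NormedAddCommGroup P] [NormedSpace ℝ P]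
    [NormedAddCommGroup E] [NormedSpace ℝ E] {ι : Type*} [Fintype ι] {D : Set P} {K : Set E}
    (hD : IsCompact D) (hK : IsCompact K) (Y : P → ι → E → E)
    (hY : ∀ i, ∀ p ∈ D ×ˢ K, AnalyticAt ℝ (fun p : P × E => Y p.1 i p.2) p) (m : ℕ)
    (f : P × E → ℝ) (hf : ∀ p ∈ D ×ˢ K, AnalyticAt ℝ f p) :
    ∃ C, ∀ δ ∈ D, ∀ S ⊆ K, DerivsBoundedBy (Y δ) S C m fun y => f (δ, y) := by
  classical
  have hbase : ∃ C, ∀ p ∈ D ×ˢ K, |f p| ≤ C := by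
    obtain ⟨C, hC⟩ := (hD.prod hK).exists_bound_of_continuousOn
      (f := f) fun p hp => (hf p hp).continuousAt.continuousWithinAt
    exact ⟨C, hC⟩
  have hcont : ∀ δ ∈ D, ∀ S ⊆ K, ContinuousOn (fun y => f (δ, y)) S := fun δ hδ S hS y hy =>
    ((hf (δ, y) ⟨hδ, hS hy⟩).continuousAt.comp (f := fun y => (δ, y))
      (Continuous.prodMk_right δ).continuousAt).continuousWithinAt
  induction m generalizing f with
  | zero =>
    obtain ⟨C, hC⟩ := hbase
    exact ⟨C, fun δ hδ S hS => ⟨hcont δ hδ S hS, fun y hy => hC (δ, y) ⟨hδ, hS hy⟩⟩⟩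
  | succ m ih =>
    obtain ⟨C, hC⟩ := hbase
    have hg : ∀ i, ∀ p ∈ D ×ˢ K,
        AnalyticAt ℝ (fun p : P × E => fderiv ℝ f p ((0 : P), Y p.1 i p.2)) p := fun i p hp =>
      analyticAt_clm_apply (hf p hp).fderiv (analyticAt_const.prod (hY i p hp))
    have hbase' : ∀ i, ∃ C, ∀ p ∈ D ×ˢ K, |fderiv ℝ f p ((0 : P), Y p.1 i p.2)| ≤ C := fun i => by
      obtain ⟨C, hC⟩ := (hD.prod hK).exists_bound_of_continuousOn
        fun p hp => (hg i p hp).continuousAt.continuousWithinAt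
      exact ⟨C, hC⟩
    have hcont' : ∀ i, ∀ δ ∈ D, ∀ S ⊆ K,
        ContinuousOn (fun y => fderiv ℝ f (δ, y) ((0 : P), Y δ i y)) S := fun i δ hδ S hS y hy =>
      ((hg i (δ, y) ⟨hδ, hS hy⟩).continuousAt.comp (f := fun y => (δ, y))
        (Continuous.prodMk_right δ).continuousAt).continuousWithinAt
    choose C' hC' using fun i => ih _ (hg i) (hbase' i) (hcont' i)
    refine ⟨|C| + ∑ i, |C' i|, fun δ hδ S hS => ⟨⟨hcont δ hδ S hS, fun y hy => ?_⟩, fun i => ?_⟩⟩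
    · refine (hC (δ, y) ⟨hδ, hS hy⟩).trans ((le_abs_self C).trans ?_)
      exact le_add_of_nonneg_right (Finset.sum_nonneg fun _ _ => abs_nonneg _)
    · refine ⟨fun y => fderiv ℝ f (δ, y) ((0 : P), Y δ i y), fun y hy σ hσ0 hσ => ?_,
        (hC' i δ hδ S hS).mono ?_⟩
      · have h1 : HasDerivAt σ (Y δ i y) 0 := by
          have := hσ.self_of_nhds
          rwa [hσ0] at this
        have h2 : HasFDerivAt f (fderiv ℝ f (δ, σ 0)) (δ, σ 0) := by
          rw [hσ0]
          exact (hf (δ, y) ⟨hδ, hS hy⟩).differentiableAt.hasFDerivAt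
        have h3 := h2.comp_hasDerivAt (0 : ℝ) ((hasDerivAt_const (0 : ℝ) δ).prodMk h1)
        rw [hσ0] at h3
        exact h3
      · refine (le_abs_self _).trans ?_
        refine (Finset.single_le_sum (f := fun i => |C' i|) (fun _ _ => abs_nonneg _)
          (Finset.mem_univ i)).trans ?_
        exact le_add_of_nonneg_left (abs_nonneg _)

/-! ### Analyticity in coordinates -/

section Coord

variable {E : Type*} [NormedAddCommGroup E] [NormedSpace ℝ E]

theorem analyticAt_coord {n : ℕ} {V : E → Rn n} {a : E} (h : AnalyticAt ℝ V a) (i : Fin n) :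
    AnalyticAt ℝ (fun p => V p i) a :=
  (EuclideanSpace.proj (𝕜 := ℝ) i).analyticAt (V a) |>.comp h

theorem analyticAt_of_coord {n : ℕ} {V : E → Rn n} {a : E}
    (h : ∀ i, AnalyticAt ℝ (fun p => V p i) a) : AnalyticAt ℝ V a := by
  have h1 : AnalyticAt ℝ (fun p => fun i => V p i) a := analyticAt_pi_iff.2 h
  exact ((EuclideanSpace.equiv (Fin n) ℝ).symm.analyticAt _).comp h1

theorem analyticAt_dpow {ν : ℕ} {f : E → Fin ν → ℝ} {a : E} (hf : AnalyticAt ℝ f a)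
    (d : Fin ν → ℕ) : AnalyticAt ℝ (fun p => dpow (f p) d) a := by
  refine Finset.analyticAt_fun_prod _ fun μ _ => ?_
  exact (analyticAt_pi_iff.1 hf μ).pow _

theorem analyticAt_monomial {N : ℕ} {f : E → Rn N} {a : E} (hf : AnalyticAt ℝ f a)
    (α : Fin N → ℕ) : AnalyticAt ℝ (fun p => monomial (f p) α) a :=
  Finset.analyticAt_fun_prod _ fun j _ => (analyticAt_coord hf j).pow _

theorem analyticAt_dilate {N ν : ℕ} (e : Fin N → Fin ν → ℕ) {δ : E → Fin ν → ℝ} {t : E → Rn N}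
    {a : E} (hδ : AnalyticAt ℝ δ a) (ht : AnalyticAt ℝ t a) :
    AnalyticAt ℝ (fun p => dilate e (δ p) (t p)) a :=
  analyticAt_of_coord fun j => (analyticAt_dpow hδ (e j)).mul (analyticAt_coord ht j)

theorem analyticAt_lieBracket {X Y : E → E} {a : E} [CompleteSpace E] (hX : AnalyticAt ℝ X a)
    (hY : AnalyticAt ℝ Y a) : AnalyticAt ℝ (VectorField.lieBracket ℝ X Y) a :=
  (analyticAt_clm_apply hY.fderiv hX).sub (analyticAt_clm_apply hX.fderiv hY)

/-- The germ at `0` of a function; zero if the function is not analytic at `0`. -/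
noncomputable def germ (f : E → ℝ) : anGerm E :=
  open Classical in if h : AnalyticAt ℝ f 0 then toGerm f h else 0

theorem germ_eq {f : E → ℝ} (hf : AnalyticAt ℝ f 0) : germ f = toGerm f hf := dif_pos hf

theorem rep_germ {f : E → ℝ} (hf : AnalyticAt ℝ f 0) : rep (germ f) =ᶠ[𝓝 0] f := by
  rw [germ_eq hf]
  exact rep_toGerm hf

theorem germ_rep (φ : anGerm E) : germ (rep φ) = φ := by
  rw [germ_eq (analyticAt_rep φ), toGerm_rep]

theorem germ_congr {f g : E → ℝ} (hg : AnalyticAt ℝ g 0) (h : f =ᶠ[𝓝 0] g) : germ f = germ g := by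
  rw [germ_eq hg, germ_eq (hg.congr h.symm)]
  exact (toGerm_eq_iff _ _).2 h

theorem germ_add {f g : E → ℝ} (hf : AnalyticAt ℝ f 0) (hg : AnalyticAt ℝ g 0) :
    germ (fun p => f p + g p) = germ f + germ g := by
  rw [germ_eq hf, germ_eq hg]
  exact germ_eq (hf.add hg)

theorem germ_sub {f g : E → ℝ} (hf : AnalyticAt ℝ f 0) (hg : AnalyticAt ℝ g 0) :
    germ (fun p => f p - g p) = germ f - germ g := by
  rw [eq_sub_iff_add_eq]
  refine (germ_add (f := fun p => f p - g p) (hf.sub hg) hg).symm.trans ?_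
  simp

theorem germ_mul {f g : E → ℝ} (hf : AnalyticAt ℝ f 0) (hg : AnalyticAt ℝ g 0) :
    germ (fun p => f p * g p) = germ f * germ g := by
  rw [germ_eq hf, germ_eq hg]
  exact germ_eq (hf.mul hg)

theorem germ_const (c : ℝ) : germ (fun _ : E => c) = algebraMap ℝ (anGerm E) c :=
  germ_eq analyticAt_const

theorem germ_smul (c : ℝ) {f : E → ℝ} (hf : AnalyticAt ℝ f 0) :
    germ (fun p => c * f p) = c • germ f := by
  rw [germ_mul analyticAt_const hf, germ_const, Algebra.smul_def]

theorem germ_pow {f : E → ℝ} (hf : AnalyticAt ℝ f 0) (k : ℕ) :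
    germ (fun p => f p ^ k) = germ f ^ k := by
  rw [germ_eq hf, germ_eq (hf.fun_pow k)]
  refine germ_ext ?_
  filter_upwards [rep_toGerm (hf.fun_pow k), rep_pow (toGerm f hf) k, rep_toGerm hf] with x h1 h2 h3
  rw [h1, h2, h3]

/-- The coordinates of a vector valued function, as germs at `0`. -/
noncomputable def vecGerm {n : ℕ} (V : E → Rn n) : Fin n → anGerm E := fun i => germ fun p => V p i

theorem vecGerm_congr {n : ℕ} {V W : E → Rn n} (hW : AnalyticAt ℝ W 0) (h : V =ᶠ[𝓝 0] W) :
    vecGerm V = vecGerm W :=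
  funext fun i => germ_congr (analyticAt_coord hW i) (h.mono fun _ hx => congrArg (· i) hx)

theorem vecGerm_add {n : ℕ} {V W : E → Rn n} (hV : AnalyticAt ℝ V 0) (hW : AnalyticAt ℝ W 0) :
    vecGerm (fun p => V p + W p) = vecGerm V + vecGerm W :=
  funext fun i => germ_add (analyticAt_coord hV i) (analyticAt_coord hW i)

theorem vecGerm_smul {n : ℕ} {f : E → ℝ} {V : E → Rn n} (hf : AnalyticAt ℝ f 0)
    (hV : AnalyticAt ℝ V 0) : vecGerm (fun p => f p • V p) = germ f • vecGerm V :=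
  funext fun i => germ_mul hf (analyticAt_coord hV i)

theorem vecGerm_zero {n : ℕ} : vecGerm (fun _ : E => (0 : Rn n)) = 0 :=
  funext fun _ => (germ_const (E := E) 0).trans (map_zero _)

end Coord

end Radon

namespace Radon

/-! ### Iterated commutators -/

theorem MemL0.analyticAt {n ν : ℕ} {S : Set (FormalField n ν)}
    (hS : ∀ X ∈ S, AnalyticAt ℝ X.1 0) {X : FormalField n ν} (h : MemL0 S X) :
    AnalyticAt ℝ X.1 0 := by
  induction h with
  | base X hX => exact hS X hX
  | comm X₁ X₂ h₁ _ ih => exact analyticAt_lieBracket (hS X₁ h₁) ih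

theorem MemL0.mono {n ν : ℕ} {S S' : Set (FormalField n ν)} (hS : S ⊆ S') {X : FormalField n ν}
    (h : MemL0 S X) : MemL0 S' X := by
  induction h with
  | base X hX => exact .base X (hS hX)
  | comm X₁ X₂ h₁ _ ih => exact .comm X₁ X₂ (hS h₁) ih

theorem MemL0.exists_finset {n ν : ℕ} {S : Set (FormalField n ν)} {X : FormalField n ν}
    (h : MemL0 S X) : ∃ S₀ : Finset (FormalField n ν), ↑S₀ ⊆ S ∧ MemL0 (↑S₀) X := by
  classical
  induction h with
  | base X hX => exact ⟨{X}, by simpa using hX, .base X (by simp)⟩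
  | comm X₁ X₂ h₁ _ ih =>
    obtain ⟨S₀, hS₀, h⟩ := ih
    refine ⟨insert X₁ S₀, ?_, .comm X₁ X₂ (by simp) (h.mono (by simp))⟩
    rw [Finset.coe_insert]
    exact Set.insert_subset h₁ hS₀

/-- `Z` agrees near `0` with a linear combination of fields of degree `d` in `L₀(S)`. -/
def InSpanL0 {n ν : ℕ} (S : Set (FormalField n ν)) (d : Fin ν → ℕ) (Z : Rn n → Rn n) : Prop :=
  ∃ Z' ∈ Submodule.span ℝ {V : Rn n → Rn n | MemL0 S (V, d)}, Z =ᶠ[𝓝 0] Z'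

section

variable {n ν : ℕ} {S : Set (FormalField n ν)} {d : Fin ν → ℕ}

theorem MemL0.inSpanL0 {X : FormalField n ν} (h : MemL0 S X) : InSpanL0 S X.2 X.1 :=
  ⟨X.1, Submodule.subset_span h, Filter.EventuallyEq.rfl⟩

theorem InSpanL0.congr {Z Z' : Rn n → Rn n} (h : InSpanL0 S d Z) (e : Z' =ᶠ[𝓝 0] Z) :
    InSpanL0 S d Z' := by
  obtain ⟨V, hV, hZ⟩ := h
  exact ⟨V, hV, e.trans hZ⟩

theorem InSpanL0.add {Z Z' : Rn n → Rn n} (h : InSpanL0 S d Z) (h' : InSpanL0 S d Z') :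
    InSpanL0 S d (Z + Z') := by
  obtain ⟨V, hV, hZ⟩ := h
  obtain ⟨V', hV', hZ'⟩ := h'
  exact ⟨V + V', add_mem hV hV', hZ.add hZ'⟩

theorem InSpanL0.smul {Z : Rn n → Rn n} (c : ℝ) (h : InSpanL0 S d Z) : InSpanL0 S d (c • Z) := by
  obtain ⟨V, hV, hZ⟩ := h
  exact ⟨c • V, Submodule.smul_mem _ c hV, hZ.const_smul c⟩

theorem analyticAt_of_mem_span (hS : ∀ X ∈ S, AnalyticAt ℝ X.1 0) {V : Rn n → Rn n}
    (hV : V ∈ Submodule.span ℝ {V : Rn n → Rn n | MemL0 S (V, d)}) : AnalyticAt ℝ V 0 := by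
  induction hV using Submodule.span_induction with
  | mem V hV => exact MemL0.analyticAt hS hV
  | zero => exact analyticAt_const
  | add V W _ _ hV hW => exact hV.add hW
  | smul c V _ hV => exact analyticAt_const.smul hV

theorem InSpanL0.bracket_of_mem (hS : ∀ X ∈ S, AnalyticAt ℝ X.1 0) {X : FormalField n ν}
    (hX : X ∈ S) {Z : Rn n → Rn n} (h : InSpanL0 S d Z) :
    InSpanL0 S (X.2 + d) (VectorField.lieBracket ℝ X.1 Z) := by
  obtain ⟨V, hV, hZ⟩ := h
  refine InSpanL0.congr ?_ (Filter.EventuallyEq.lieBracket_vectorField Filter.EventuallyEq.rfl hZ)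
  clear hZ
  induction hV using Submodule.span_induction with
  | mem V hV => exact (MemL0.comm X (V, d) hX hV).inSpanL0
  | zero =>
    rw [VectorField.lieBracket_zero_right]
    exact ⟨0, zero_mem _, Filter.EventuallyEq.rfl⟩
  | add V W hV hW ihV ihW =>
    refine (ihV.add ihW).congr ?_
    filter_upwards [(analyticAt_of_mem_span hS hV).eventually_analyticAt,
      (analyticAt_of_mem_span hS hW).eventually_analyticAt] with x h1 h2
    exact VectorField.lieBracket_add_right h1.differentiableAt h2.differentiableAt
  | smul c V hV ih =>
    refine (ih.smul c).congr ?_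
    filter_upwards [(analyticAt_of_mem_span hS hV).eventually_analyticAt] with x h1
    exact VectorField.lieBracket_const_smul_right h1.differentiableAt

/-- By the Jacobi identity the commutators nested to the right span a Lie algebra. -/
theorem MemL0.bracket_inSpanL0 (hS : ∀ X ∈ S, AnalyticAt ℝ X.1 0) {X X' : FormalField n ν}
    (hX : MemL0 S X) (hX' : MemL0 S X') : InSpanL0 S (X.2 + X'.2) (bracket X X').1 := by
  induction hX generalizing X' with
  | base X hX => exact (MemL0.comm X X' hX hX').inSpanL0
  | comm X₁ X₂ h₁ h₂ ih =>
    have a₁ := hS X₁ h₁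
    have a₂ := h₂.analyticAt hS
    have a' := hX'.analyticAt hS
    have e1 := (ih hX').bracket_of_mem hS h₁
    have e2 := ih (MemL0.comm X₁ X' h₁ hX')
    have d1 : X₁.2 + (X₂.2 + X'.2) = (bracket X₁ X₂).2 + X'.2 := (add_assoc _ _ _).symm
    have d2 : X₂.2 + (bracket X₁ X').2 = (bracket X₁ X₂).2 + X'.2 := by
      simp only [bracket]
      abel
    rw [d1] at e1
    rw [d2] at e2
    refine (e1.add (e2.smul (-1))).congr ?_
    filter_upwards [a₁.eventually_analyticAt, a₂.eventually_analyticAt, a'.eventually_analyticAt]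
      with x h1 h2 h3
    have := VectorField.leibniz_identity_lieBracket (𝕜 := ℝ) (n := ω) (by simp)
      h1.contDiffAt h2.contDiffAt h3.contDiffAt
    simp only [bracket, Pi.add_apply, Pi.smul_apply]
    rw [this]
    module

end

/-! ### Finite generation -/

/-- The space of the variables `(τ, t, δ, x)`. -/
abbrev TotalSpace (N ν n : ℕ) := ℝ × Rn N × (Fin ν → ℝ) × Rn n

/-- The vector of germs of `δ ^ d X(x)`. -/
noncomputable def fieldGerm {n ν : ℕ} (N : ℕ) (X : FormalField n ν) :
    Fin n → anGerm (TotalSpace N ν n) :=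
  vecGerm fun p => dpow p.2.2.1 X.2 • X.1 p.2.2.2

section

variable {N n ν : ℕ} {S : Set (FormalField n ν)}

theorem analyticAt_totalSpace_delta (a : TotalSpace N ν n) :
    AnalyticAt ℝ (fun p : TotalSpace N ν n => p.2.2.1) a :=
  ((ContinuousLinearMap.fst ℝ _ _).comp ((ContinuousLinearMap.snd ℝ _ _).comp
    (ContinuousLinearMap.snd ℝ ℝ (Rn N × (Fin ν → ℝ) × Rn n)))).analyticAt a

theorem analyticAt_totalSpace_x (a : TotalSpace N ν n) :
    AnalyticAt ℝ (fun p : TotalSpace N ν n => p.2.2.2) a :=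
  ((ContinuousLinearMap.snd ℝ _ _).comp ((ContinuousLinearMap.snd ℝ _ _).comp
    (ContinuousLinearMap.snd ℝ ℝ (Rn N × (Fin ν → ℝ) × Rn n)))).analyticAt a

theorem analyticAt_comp_x {V : Rn n → Rn n} (hV : AnalyticAt ℝ V 0) :
    AnalyticAt ℝ (fun p : TotalSpace N ν n => V p.2.2.2) 0 :=
  hV.comp_of_eq (analyticAt_totalSpace_x 0) rfl

theorem analyticAt_fieldGerm (d : Fin ν → ℕ) {V : Rn n → Rn n} (hV : AnalyticAt ℝ V 0) :
    AnalyticAt ℝ (fun p : TotalSpace N ν n => dpow p.2.2.1 d • V p.2.2.2) 0 :=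
  (analyticAt_dpow (analyticAt_totalSpace_delta 0) d).smul (analyticAt_comp_x hV)

/-- The module over germs in `(τ, t, δ, x)` generated by the `δ ^ d X(x)`, `(X,d) ∈ L₀(S)`. -/
noncomputable def spanL0 (N : ℕ) (S : Set (FormalField n ν)) :
    Submodule (anGerm (TotalSpace N ν n)) (Fin n → anGerm (TotalSpace N ν n)) :=
  Submodule.span _ (fieldGerm N '' {X | MemL0 S X})

theorem InSpanL0.fieldGerm_mem (hS : ∀ X ∈ S, AnalyticAt ℝ X.1 0) {d : Fin ν → ℕ}
    {Z : Rn n → Rn n} (h : InSpanL0 S d Z) : fieldGerm N (Z, d) ∈ spanL0 N S := by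
  obtain ⟨V, hV, hZ⟩ := h
  have e : fieldGerm N (Z, d) = fieldGerm N (V, d) := by
    refine vecGerm_congr (analyticAt_fieldGerm d (analyticAt_of_mem_span hS hV)) ?_
    have ht : Filter.Tendsto (fun p : TotalSpace N ν n => p.2.2.2) (𝓝 0) (𝓝 0) :=
      (analyticAt_totalSpace_x 0).continuousAt
    filter_upwards [ht.eventually hZ] with p hp
    rw [hp]
  rw [e]
  clear e hZ
  induction hV using Submodule.span_induction with
  | mem V hV => exact Submodule.subset_span ⟨(V, d), hV, rfl⟩
  | zero =>
    have : fieldGerm N ((0 : Rn n → Rn n), d) = 0 := by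
      refine Eq.trans ?_ (vecGerm_zero (E := TotalSpace N ν n))
      simp [fieldGerm]
    rw [this]
    exact zero_mem _
  | add V W hV hW ihV ihW =>
    have : fieldGerm N (V + W, d) = fieldGerm N (V, d) + fieldGerm N (W, d) := by
      refine Eq.trans ?_ (vecGerm_add (analyticAt_fieldGerm d (analyticAt_of_mem_span hS hV))
        (analyticAt_fieldGerm d (analyticAt_of_mem_span hS hW)))
      simp [fieldGerm]
    rw [this]
    exact add_mem ihV ihW
  | smul c V hV ih =>
    have : fieldGerm N (c • V, d) =
        germ (fun _ : TotalSpace N ν n => c) • fieldGerm N (V, d) := by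
      refine Eq.trans ?_ (vecGerm_smul analyticAt_const
        (analyticAt_fieldGerm d (analyticAt_of_mem_span hS hV)))
      simp [fieldGerm, smul_comm c]
    rw [this]
    exact Submodule.smul_mem _ _ ih

/-- Noetherianity provides a finite list, starting with elements of `S`, of fields in `L₀` of these
elements, which generates the module of all of `L₀(S)`. -/
theorem exists_generating_list (N : ℕ) (S : Set (FormalField n ν)) :
    ∃ (r : ℕ) (F : Fin r → FormalField n ν) (p : ℕ) (T : Fin p → FormalField n ν),
      (∀ i, F i ∈ S) ∧ (∀ k, MemL0 (Set.range F) (T k)) ∧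
      spanL0 N S = Submodule.span _ (Set.range fun l => fieldGerm N (Fin.append F T l)) := by
  classical
  have hfg : (spanL0 N S).FG := IsNoetherian.noetherian _
  obtain ⟨s, hs, hspan⟩ := (Submodule.fg_span_iff_fg_span_finset_subset _).1 hfg
  obtain ⟨T₀, hT₀, rfl⟩ := Finset.subset_set_image_iff.1 hs
  choose! S₀ hS₀ hmem using fun (X : FormalField n ν) (hX : X ∈ T₀) => (hT₀ hX).exists_finset
  let F₀ := T₀.biUnion S₀
  have hF₀ : ∀ X ∈ F₀, X ∈ S := by
    intro X hX
    obtain ⟨Y, hY, hXY⟩ := Finset.mem_biUnion.1 hX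
    exact hS₀ Y hY hXY
  let F : Fin F₀.card → FormalField n ν := fun i => (F₀.equivFin.symm i).1
  let T : Fin T₀.card → FormalField n ν := fun i => (T₀.equivFin.symm i).1
  have hrange : Set.range F = F₀ := by
    ext X
    constructor
    · rintro ⟨i, rfl⟩
      exact (F₀.equivFin.symm i).2
    · intro hX
      exact ⟨F₀.equivFin ⟨X, hX⟩, by simp [F]⟩
  have hTmem : ∀ k, MemL0 (Set.range F) (T k) := by
    intro k
    refine (hmem _ (T₀.equivFin.symm k).2).mono ?_
    rw [hrange]
    exact_mod_cast Finset.subset_biUnion_of_mem S₀ (T₀.equivFin.symm k).2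
  have hFS : ∀ i, F i ∈ S := fun i => hF₀ _ (F₀.equivFin.symm i).2
  refine ⟨_, F, _, T, hFS, hTmem, le_antisymm ?_ (Submodule.span_le.2 ?_)⟩
  · rw [spanL0, hspan]
    refine Submodule.span_mono ?_
    intro v hv
    obtain ⟨X, hX, rfl⟩ := Finset.mem_image.1 (Finset.mem_coe.1 hv)
    refine ⟨Fin.natAdd _ (T₀.equivFin ⟨X, hX⟩), ?_⟩
    simp [T]
  · rintro _ ⟨l, rfl⟩
    refine Submodule.subset_span ⟨_, ?_, rfl⟩
    refine Fin.addCases (fun i => ?_) (fun k => ?_) l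
    · rw [Fin.append_left]
      exact .base _ (hFS i)
    · rw [Fin.append_right]
      refine (hTmem k).mono ?_
      rintro _ ⟨i, rfl⟩
      exact hFS i

/-- Elements of the module generated by a finite list have analytic coefficients. -/
theorem exists_coefficients {q : ℕ} (Y : Fin q → FormalField n ν)
    (hY : ∀ l, AnalyticAt ℝ (Y l).1 0) {V : TotalSpace N ν n → Rn n} (hV : AnalyticAt ℝ V 0)
    (h : vecGerm V ∈ Submodule.span (anGerm (TotalSpace N ν n))
      (Set.range fun l => fieldGerm N (Y l))) :
    ∃ c : Fin q → TotalSpace N ν n → ℝ, (∀ l, AnalyticAt ℝ (c l) 0) ∧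
      ∀ᶠ p in 𝓝 0, V p = ∑ l, c l p • (dpow p.2.2.1 (Y l).2 • (Y l).1 p.2.2.2) := by
  obtain ⟨c, hc⟩ := (Submodule.mem_span_range_iff_exists_fun _).1 h
  refine ⟨fun l => rep (c l), fun l => analyticAt_rep _, ?_⟩
  have hi : ∀ i : Fin n, ∀ᶠ p in 𝓝 0, V p i =
      ∑ l, rep (c l) p * (dpow p.2.2.1 (Y l).2 • (Y l).1 p.2.2.2) i := by
    intro i
    have hci : ∑ l, c l * fieldGerm N (Y l) i = germ fun p => V p i := by
      have := congrFun hc i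
      rwa [Finset.sum_apply] at this
    have h1 := rep_germ (analyticAt_coord hV i)
    rw [← hci] at h1
    have h2 : ∀ᶠ p in 𝓝 0, ∀ l, rep (c l * fieldGerm N (Y l) i) p =
        rep (c l) p * rep (fieldGerm N (Y l) i) p :=
      Filter.eventually_all.2 fun l => rep_mul _ _
    have h3 : ∀ᶠ p in 𝓝 0, ∀ l, rep (fieldGerm N (Y l) i) p =
        (dpow p.2.2.1 (Y l).2 • (Y l).1 p.2.2.2) i :=
      Filter.eventually_all.2 fun l => rep_germ (analyticAt_coord (analyticAt_fieldGerm _ (hY l)) i)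
    filter_upwards [h1, rep_sum Finset.univ fun l => c l * fieldGerm N (Y l) i, h2, h3]
      with p e1 e2 e3 e4
    rw [← e1, e2]
    exact Finset.sum_congr rfl fun l _ => by rw [e3, e4]
  filter_upwards [Filter.eventually_all.2 hi] with p hp
  ext i
  rw [hp i]
  simp

/-- Krull's intersection theorem: a submodule of a finite module over a Noetherian ring is closed
for the adic topology of an ideal contained in the Jacobson radical. -/
theorem mem_of_forall_mem_sup_pow_smul {R M : Type*} [CommRing R] [IsNoetherianRing R]
    [AddCommGroup M] [Module R M] [Module.Finite R M] (P : Submodule R M) (I : Ideal R)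
    (hI : I ≤ Ideal.jacobson ⊥) (w : M) (h : ∀ k : ℕ, w ∈ P ⊔ I ^ k • (⊤ : Submodule R M)) :
    w ∈ P := by
  have hk := Ideal.iInf_pow_smul_eq_bot_of_le_jacobson (M := M ⧸ P) I hI
  rw [← Submodule.Quotient.mk_eq_zero, ← Submodule.mem_bot R, ← hk, Submodule.mem_iInf]
  intro k
  obtain ⟨a, ha, b, hb, rfl⟩ := Submodule.mem_sup.1 (h k)
  rw [Submodule.Quotient.mk_add, (Submodule.Quotient.mk_eq_zero P).2 ha, zero_add]
  have := Submodule.mem_map_of_mem (f := P.mkQ) hb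
  rw [Submodule.map_smul''] at this
  exact Submodule.smul_mono le_rfl le_top this

end

end Radon

namespace Radon

/-! ### From germs to control on a neighbourhood -/

section

variable {N n ν : ℕ}

theorem dpow_smul (ε : ℝ) (δ : Fin ν → ℝ) (d : Fin ν → ℕ) :
    dpow (ε • δ) d = ε ^ (∑ μ, d μ) * dpow δ d := by
  simp [dpow, mul_pow, Finset.prod_mul_distrib, Finset.prod_pow_eq_pow_sum]

theorem norm_le_one_of_mem_Icc {δ : Fin ν → ℝ} (hδ : δ ∈ Set.Icc (0 : Fin ν → ℝ) 1) : ‖δ‖ ≤ 1 :=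
  (pi_norm_le_iff_of_nonneg zero_le_one).2 fun μ => by
    rw [Real.norm_eq_abs, abs_of_nonneg (hδ.1 μ)]
    exact hδ.2 μ

theorem analyticAt_scaled {q : ℕ} (X : Fin q → FormalField n ν) (j : Fin q)
    {p : (Fin ν → ℝ) × Rn n} (h : AnalyticAt ℝ (X j).1 p.2) :
    AnalyticAt ℝ (fun p : (Fin ν → ℝ) × Rn n => scaled X p.1 j p.2) p :=
  (analyticAt_dpow analyticAt_fst _).smul (h.comp analyticAt_snd)

/-- Coefficients that are analytic near `δ = 0`, `x = 0` give control for all `δ ∈ [0,1]^ν`: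
rescale `δ` to `ε δ`, which multiplies each `δ ^ d` by a constant. -/
theorem controls_of_mem_span {q : ℕ} (Y : Fin q → FormalField n ν)
    (hY : ∀ l, AnalyticAt ℝ (Y l).1 0) {Z : FormalField n ν} (hZ : AnalyticAt ℝ Z.1 0)
    (h : fieldGerm N Z ∈ Submodule.span (anGerm (TotalSpace N ν n))
      (Set.range fun l => fieldGerm N (Y l))) : Controls Y Z := by
  obtain ⟨c, hc, heq⟩ := exists_coefficients Y hY (analyticAt_fieldGerm Z.2 hZ) h
  obtain ⟨ε₁, hε₁, h₁⟩ := Metric.eventually_nhds_iff_ball.1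
    (heq.and (Filter.eventually_all.2 fun l => (hc l).eventually_analyticAt))
  obtain ⟨ε₂, hε₂, h₂⟩ := Metric.eventually_nhds_iff_ball.1
    (hZ.eventually_analyticAt.and (Filter.eventually_all.2 fun l => (hY l).eventually_analyticAt))
  obtain ⟨ε, hε, hε1, hε2⟩ : ∃ ε, 0 < ε ∧ ε < ε₁ ∧ ε < ε₂ :=
    ⟨min ε₁ ε₂ / 2, by positivity, by linarith [min_le_left ε₁ ε₂, lt_min hε₁ hε₂],
      by linarith [min_le_right ε₁ ε₂, lt_min hε₁ hε₂]⟩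
  have hball : ∀ δ ∈ Set.Icc (0 : Fin ν → ℝ) 1, ∀ x ∈ Metric.closedBall (0 : Rn n) ε,
      ((0, 0, ε • δ, x) : TotalSpace N ν n) ∈ Metric.ball 0 ε₁ := by
    intro δ hδ x hx
    rw [mem_ball_zero_iff]
    refine lt_of_le_of_lt ?_ hε1
    rw [mem_closedBall_zero_iff] at hx
    have hδε : ‖ε • δ‖ ≤ ε := by
      rw [norm_smul, Real.norm_eq_abs, abs_of_pos hε]
      exact mul_le_of_le_one_right hε.le (norm_le_one_of_mem_Icc hδ)
    simp only [Prod.norm_def, norm_zero]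
    exact max_le hε.le (max_le hε.le (max_le hδε hx))
  have hxball : ∀ x ∈ Metric.closedBall (0 : Rn n) ε, x ∈ Metric.ball (0 : Rn n) ε₂ :=
    fun x hx => Metric.closedBall_subset_ball hε2 hx
  let f : Fin q → (Fin ν → ℝ) × Rn n → ℝ := fun l p =>
    (ε ^ (∑ μ, Z.2 μ))⁻¹ * ε ^ (∑ μ, (Y l).2 μ) * c l (0, 0, ε • p.1, p.2)
  have hf : ∀ l, ∀ p ∈ Set.Icc (0 : Fin ν → ℝ) 1 ×ˢ Metric.closedBall (0 : Rn n) ε,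
      AnalyticAt ℝ (f l) p := by
    intro l p hp
    refine analyticAt_const.mul ?_
    refine AnalyticAt.comp (f := fun p : (Fin ν → ℝ) × Rn n =>
      ((0, 0, ε • p.1, p.2) : TotalSpace N ν n)) ((h₁ _ (hball p.1 hp.1 p.2 hp.2)).2 l) ?_
    exact analyticAt_const.prod (analyticAt_const.prod
      ((analyticAt_const.fun_smul analyticAt_fst).prod analyticAt_snd))
  refine ⟨Metric.ball 0 ε, Metric.isOpen_ball, fun j x hx => ?_, fun x hx => ?_,
    Metric.ball 0 ε, Metric.isOpen_ball, Metric.mem_ball_self hε, subset_rfl, 1, one_pos,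
    fun δ _ l y => f l (δ, y), ?_, fun m => ?_⟩
  · exact ((h₂ x (hxball x (Metric.ball_subset_closedBall hx))).2 j).contDiffAt.contDiffWithinAt
  · exact (h₂ x (hxball x (Metric.ball_subset_closedBall hx))).1.contDiffAt.contDiffWithinAt
  · intro δ hδ x _ y hy
    have hy' : y ∈ Metric.closedBall (0 : Rn n) ε := Metric.ball_subset_closedBall hy.1
    have hmain := (h₁ _ (hball δ hδ y hy')).1
    simp only [dpow_smul] at hmain
    have hne : ε ^ (∑ μ, Z.2 μ) ≠ 0 := pow_ne_zero _ hε.ne'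
    calc dpow δ Z.2 • Z.1 y
        = (ε ^ (∑ μ, Z.2 μ))⁻¹ • ((ε ^ (∑ μ, Z.2 μ) * dpow δ Z.2) • Z.1 y) := by
          rw [smul_smul, inv_mul_cancel_left₀ hne]
      _ = _ := by
          rw [hmain, Finset.smul_sum]
          refine Finset.sum_congr rfl fun l _ => ?_
          simp only [f, scaled, smul_smul]
          congr 1
          ring
  · choose C hC using fun l => exists_derivsBoundedBy isCompact_Icc
      (isCompact_closedBall (0 : Rn n) ε) (fun δ => scaled Y δ) (fun j p hp =>
        analyticAt_scaled Y j ((h₂ p.2 (hxball p.2 hp.2)).2 j)) m (f l) (hf l)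
    refine ⟨∑ l, |C l|, fun δ hδ x _ l => (hC l δ hδ _ fun y hy =>
      Metric.ball_subset_closedBall hy.1).mono ?_⟩
    exact (le_abs_self _).trans (Finset.single_le_sum (f := fun l => |C l|)
      (fun _ _ => abs_nonneg _) (Finset.mem_univ l))

theorem dilate_smul (e : Fin N → Fin ν → ℕ) (δ : Fin ν → ℝ) (τ : ℝ) (t : Rn N) :
    dilate e δ (τ • t) = τ • dilate e δ t := by
  ext j
  simp only [dilate, PiLp.smul_apply, smul_eq_mul]
  ring

/-- The map `(τ, t, δ, x) ↦ (δ (τ t), x)`. -/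
noncomputable def blowUp (e : Fin N → Fin ν → ℕ) (p : TotalSpace N ν n) : Rn N × Rn n :=
  (dilate e p.2.2.1 (p.1 • p.2.1), p.2.2.2)

theorem analyticAt_blowUp (e : Fin N → Fin ν → ℕ) (a : TotalSpace N ν n) :
    AnalyticAt ℝ (blowUp e) a :=
  (analyticAt_dilate e (analyticAt_totalSpace_delta a) (analyticAt_fst.smul
    (((ContinuousLinearMap.fst ℝ _ _).comp
      (ContinuousLinearMap.snd ℝ ℝ (Rn N × (Fin ν → ℝ) × Rn n))).analyticAt a))).prod
    (analyticAt_totalSpace_x a)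

theorem blowUp_zero (e : Fin N → Fin ν → ℕ) : blowUp e (0 : TotalSpace N ν n) = 0 := by
  have : (0 : ℝ) • (0 : Rn N) = 0 := zero_smul _ _
  refine Prod.ext ?_ rfl
  ext j
  simp [blowUp, dilate]

/-- As for vector fields, coefficients that are analytic near the origin give control of `W` for
all `δ ∈ [0,1]^ν`, after `δ` is replaced by `ε δ` and `t` is rescaled accordingly. -/
theorem controlsParam_of_mem_span (e : Fin N → Fin ν → ℕ) {q : ℕ} (Y : Fin q → FormalField n ν)
    (hY : ∀ l, AnalyticAt ℝ (Y l).1 0) {W : Rn N → Rn n → Rn n}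
    (hW : AnalyticAt ℝ (fun p : Rn N × Rn n => W p.1 p.2) 0)
    (h : vecGerm (fun p : TotalSpace N ν n => W (blowUp e p).1 (blowUp e p).2) ∈
      Submodule.span (anGerm (TotalSpace N ν n)) (Set.range fun l => fieldGerm N (Y l))) :
    ControlsParam e Y W := by
  obtain ⟨c, hc, heq⟩ := exists_coefficients Y hY
    (V := fun p => W (blowUp e p).1 (blowUp e p).2)
    (hW.comp_of_eq (analyticAt_blowUp e 0) (blowUp_zero e)) h
  obtain ⟨ε₁, hε₁, h₁⟩ := Metric.eventually_nhds_iff_ball.1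
    (heq.and (Filter.eventually_all.2 fun l => (hc l).eventually_analyticAt))
  obtain ⟨ε₂, hε₂, h₂⟩ := Metric.eventually_nhds_iff_ball.1
    (Filter.eventually_all.2 fun l => (hY l).eventually_analyticAt)
  obtain ⟨ε, hε, hε1, hε2⟩ : ∃ ε, 0 < ε ∧ ε < ε₁ ∧ ε < ε₂ :=
    ⟨min ε₁ ε₂ / 2, by positivity, by linarith [min_le_left ε₁ ε₂, lt_min hε₁ hε₂],
      by linarith [min_le_right ε₁ ε₂, lt_min hε₁ hε₂]⟩
  -- the rescaling of `t` that undoes `δ ↦ ε δ`, `τ = ε`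
  let a : Fin N → ℝ := fun j => (ε * ε ^ (∑ μ, e j μ))⁻¹
  let Λ : Rn N → Rn N := fun t => WithLp.toLp 2 fun j => a j * t j
  have hΛ : ∀ t, AnalyticAt ℝ Λ t := fun t => analyticAt_of_coord fun j =>
    analyticAt_const.mul (analyticAt_coord analyticAt_id j)
  have hΛ0 : Λ 0 = 0 := by ext j; simp [Λ]
  have hΛd : ∀ δ t, dilate e (ε • δ) (ε • Λ t) = dilate e δ t := by
    intro δ t
    ext j
    have hne : ε * ε ^ (∑ μ, e j μ) ≠ 0 := mul_ne_zero hε.ne' (pow_ne_zero _ hε.ne')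
    simp only [dilate, PiLp.smul_apply, smul_eq_mul, Λ, a, dpow_smul]
    field_simp
  obtain ⟨ρ, hρ, hρΛ⟩ : ∃ ρ > 0, ∀ t ∈ Metric.closedBall (0 : Rn N) ρ, ‖Λ t‖ ≤ ε := by
    have hcont : Filter.Tendsto (fun t => ‖Λ t‖) (𝓝 0) (𝓝 0) := by
      have := (hΛ 0).continuousAt.norm.tendsto
      simpa [hΛ0] using this
    obtain ⟨ρ, hρ, h⟩ := Metric.nhds_basis_closedBall.eventually_iff.1
      (hcont.eventually_le_const hε)
    exact ⟨ρ, hρ, fun t ht => h ht⟩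
  have hball : ∀ δ ∈ Set.Icc (0 : Fin ν → ℝ) 1, ∀ t ∈ Metric.closedBall (0 : Rn N) ρ,
      ∀ x ∈ Metric.closedBall (0 : Rn n) ε,
      ((ε, Λ t, ε • δ, x) : TotalSpace N ν n) ∈ Metric.ball 0 ε₁ := by
    intro δ hδ t ht x hx
    rw [mem_ball_zero_iff]
    refine lt_of_le_of_lt ?_ hε1
    rw [mem_closedBall_zero_iff] at hx
    have hδε : ‖ε • δ‖ ≤ ε := by
      rw [norm_smul, Real.norm_eq_abs, abs_of_pos hε]
      exact mul_le_of_le_one_right hε.le (norm_le_one_of_mem_Icc hδ)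
    have hεε : ‖ε‖ ≤ ε := by rw [Real.norm_eq_abs, abs_of_pos hε]
    simp only [Prod.norm_def]
    exact max_le hεε (max_le (hρΛ t ht) (max_le hδε hx))
  have hxball : ∀ x ∈ Metric.closedBall (0 : Rn n) ε, x ∈ Metric.ball (0 : Rn n) ε₂ :=
    fun x hx => Metric.closedBall_subset_ball hε2 hx
  let f : Fin q → (Fin ν → ℝ) × (Rn N × Rn n) → ℝ := fun l p =>
    ε ^ (∑ μ, (Y l).2 μ) * c l (ε, Λ p.2.1, ε • p.1, p.2.2)
  have hf : ∀ l, ∀ p ∈ Set.Icc (0 : Fin ν → ℝ) 1 ×ˢ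
      (Metric.closedBall (0 : Rn N) ρ ×ˢ Metric.closedBall (0 : Rn n) ε),
      AnalyticAt ℝ (f l) p := by
    intro l p hp
    refine analyticAt_const.mul ?_
    refine AnalyticAt.comp (f := fun p : (Fin ν → ℝ) × (Rn N × Rn n) =>
      ((ε, Λ p.2.1, ε • p.1, p.2.2) : TotalSpace N ν n))
      ((h₁ _ (hball p.1 hp.1 p.2.1 hp.2.1 p.2.2 hp.2.2)).2 l) ?_
    have a1 : AnalyticAt ℝ (fun p : (Fin ν → ℝ) × (Rn N × Rn n) => p.2.1) p :=
      ((ContinuousLinearMap.fst ℝ _ _).comp (ContinuousLinearMap.snd ℝ _ _)).analyticAt p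
    have a2 : AnalyticAt ℝ (fun p : (Fin ν → ℝ) × (Rn N × Rn n) => p.2.2) p :=
      ((ContinuousLinearMap.snd ℝ _ _).comp (ContinuousLinearMap.snd ℝ _ _)).analyticAt p
    exact analyticAt_const.prod (((hΛ _).comp a1).prod
      ((analyticAt_const.fun_smul analyticAt_fst).prod a2))
  refine ⟨Metric.ball 0 ε, Metric.isOpen_ball, fun j x hx => ?_,
    Metric.ball 0 ε, Metric.isOpen_ball, Metric.mem_ball_self hε, subset_rfl, 1, one_pos, ρ, hρ,
    fun δ _ l y => f l (δ, y), ?_, fun m => ?_⟩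
  · exact (h₂ x (hxball x (Metric.ball_subset_closedBall hx)) j).contDiffAt.contDiffWithinAt
  · intro δ hδ x _ t ht y hy
    have hy' : y ∈ Metric.closedBall (0 : Rn n) ε := Metric.ball_subset_closedBall hy.1
    have hmain := (h₁ _ (hball δ hδ t (Metric.ball_subset_closedBall ht) y hy')).1
    simp only [dpow_smul, blowUp, hΛd] at hmain
    rw [hmain]
    refine Finset.sum_congr rfl fun l _ => ?_
    simp only [f, scaled, smul_smul]
    congr 1
    ring
  · choose C hC using fun l => exists_derivsBoundedBy isCompact_Icc
      ((isCompact_closedBall (0 : Rn N) ρ).prod (isCompact_closedBall (0 : Rn n) ε))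
      (fun δ => productFields (N := N) Y δ) (fun j p hp => by
        rcases j with k | j
        · exact analyticAt_const
        · have a2 : AnalyticAt ℝ (fun p : (Fin ν → ℝ) × (Rn N × Rn n) => p.2.2) p :=
            ((ContinuousLinearMap.snd ℝ _ _).comp (ContinuousLinearMap.snd ℝ _ _)).analyticAt p
          refine analyticAt_const.prod ?_
          exact AnalyticAt.comp (f := fun p : (Fin ν → ℝ) × (Rn N × Rn n) => (p.1, p.2.2))
            (analyticAt_scaled Y j (p := (p.1, p.2.2)) (h₂ p.2.2 (hxball p.2.2 hp.2.2) j))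
            (analyticAt_fst.prod a2)) m (f l) (hf l)
    refine ⟨∑ l, |C l|, fun δ hδ x _ l => (hC l δ hδ _ (Set.prod_mono
      Metric.ball_subset_closedBall fun y hy => Metric.ball_subset_closedBall hy.1)).mono ?_⟩
    exact (le_abs_self _).trans (Finset.single_le_sum (f := fun l => |C l|)
      (fun _ _ => abs_nonneg _) (Finset.mem_univ l))

/-! ### The finite type criterion -/

/-- The combinations of the `t`-dependent vector fields `t ^ α Z`, where `(Z, deg α) ∈ L₀(S)`. -/
def gradedSpan (e : Fin N → Fin ν → ℕ) (S : Set (FormalField n ν)) :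
    Submodule ℝ (Rn N × Rn n → Rn n) :=
  Submodule.span ℝ {B | ∃ (α : Fin N → ℕ) (Z : Rn n → Rn n), MemL0 S (Z, deg e α) ∧
    B = fun p => monomial p.1 α • Z p.2}

variable {S : Set (FormalField n ν)} {e : Fin N → Fin ν → ℕ}

theorem analyticAt_monomial_smul (α : Fin N → ℕ) {Z : Rn n → Rn n} (hZ : AnalyticAt ℝ Z 0) :
    AnalyticAt ℝ (fun p : Rn N × Rn n => monomial p.1 α • Z p.2) 0 :=
  (analyticAt_monomial analyticAt_fst α).smul (hZ.comp_of_eq analyticAt_snd rfl)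

theorem analyticAt_of_mem_gradedSpan (hS : ∀ X ∈ S, AnalyticAt ℝ X.1 0)
    {B : Rn N × Rn n → Rn n} (hB : B ∈ gradedSpan e S) : AnalyticAt ℝ B 0 := by
  induction hB using Submodule.span_induction with
  | mem B hB =>
    obtain ⟨α, Z, hZ, rfl⟩ := hB
    exact analyticAt_monomial_smul α (hZ.analyticAt hS)
  | zero => exact analyticAt_const
  | add V W _ _ hV hW => exact hV.add hW
  | smul c V _ hV => exact analyticAt_const.smul hV

theorem monomial_dilate (e : Fin N → Fin ν → ℕ) (δ : Fin ν → ℝ) (t : Rn N) (α : Fin N → ℕ) :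
    monomial (dilate e δ t) α = dpow δ (deg e α) * monomial t α := by
  simp only [monomial, dilate, dpow, deg, mul_pow, Finset.prod_mul_distrib]
  congr 1
  simp_rw [← Finset.prod_pow]
  rw [Finset.prod_comm]
  refine Finset.prod_congr rfl fun μ _ => ?_
  rw [Finset.sum_apply, ← Finset.prod_pow_eq_pow_sum]
  refine Finset.prod_congr rfl fun j _ => ?_
  rw [Pi.smul_apply, smul_eq_mul, mul_comm, pow_mul]

/-- After the dilation `t ↦ δ t` the field `t ^ α Z` becomes `t ^ α δ ^ (deg α) Z`, a multiple of a
generator of `spanL0`. -/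
theorem vecGerm_blowUp_mem (hS : ∀ X ∈ S, AnalyticAt ℝ X.1 0)
    {B : Rn N × Rn n → Rn n} (hB : B ∈ gradedSpan e S) :
    vecGerm (fun p : TotalSpace N ν n => B (blowUp e p)) ∈ spanL0 N S := by
  have ha : ∀ {B : Rn N × Rn n → Rn n}, AnalyticAt ℝ B 0 →
      AnalyticAt ℝ (fun p : TotalSpace N ν n => B (blowUp e p)) 0 := fun h =>
    h.comp_of_eq (analyticAt_blowUp e 0) (blowUp_zero e)
  induction hB using Submodule.span_induction with
  | mem B hB =>
    obtain ⟨α, Z, hZ, rfl⟩ := hB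
    have hm : AnalyticAt ℝ (fun p : TotalSpace N ν n => monomial (p.1 • p.2.1) α) 0 :=
      analyticAt_monomial (analyticAt_fst.smul (((ContinuousLinearMap.fst ℝ _ _).comp
        (ContinuousLinearMap.snd ℝ ℝ (Rn N × (Fin ν → ℝ) × Rn n))).analyticAt 0)) α
    have : vecGerm (fun p : TotalSpace N ν n => monomial (blowUp e p).1 α • Z (blowUp e p).2) =
        germ (fun p : TotalSpace N ν n => monomial (p.1 • p.2.1) α) •
          fieldGerm N (Z, deg e α) := by
      refine Eq.trans ?_ (vecGerm_smul hm (analyticAt_fieldGerm _ (hZ.analyticAt hS)))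
      congr 1
      funext p
      simp only [blowUp, monomial_dilate, smul_smul]
      rw [mul_comm]
    rw [this]
    exact Submodule.smul_mem _ _ (Submodule.subset_span ⟨_, hZ, rfl⟩)
  | zero => exact (vecGerm_zero (E := TotalSpace N ν n) (n := n)) ▸ zero_mem _
  | add V W hV hW ihV ihW =>
    have := vecGerm_add (ha (analyticAt_of_mem_gradedSpan hS hV))
      (ha (analyticAt_of_mem_gradedSpan hS hW))
    exact (this ▸ add_mem ihV ihW :)
  | smul c V hV ih =>
    have := vecGerm_smul (f := fun _ => c) analyticAt_const
      (ha (analyticAt_of_mem_gradedSpan hS hV))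
    exact (this ▸ Submodule.smul_mem _ _ ih :)

/-- A `t`-dependent vector field that is approximated to every order in `t` by combinations of the
`t ^ α Z`, `(Z, deg α) ∈ L₀(S)`, lies in the module generated by `L₀(S)` after the substitution of
`δ (τ t)` for `t`. -/
theorem vecGerm_blowUp_mem_of_approx (hS : ∀ X ∈ S, AnalyticAt ℝ X.1 0) {W : Rn N → Rn n → Rn n}
    (hW : AnalyticAt ℝ (fun p : Rn N × Rn n => W p.1 p.2) 0)
    (happrox : ∀ K : ℕ, ∃ B ∈ gradedSpan e S, ∃ C : ℝ,
      ∀ᶠ p in 𝓝 (0 : Rn N × Rn n), ‖W p.1 p.2 - B p‖ ≤ C * ‖p.1‖ ^ K) :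
    vecGerm (fun p : TotalSpace N ν n => W (blowUp e p).1 (blowUp e p).2) ∈ spanL0 N S := by
  have hτ : AnalyticAt ℝ (fun p : TotalSpace N ν n => p.1) 0 := analyticAt_fst
  let I : Ideal (anGerm (TotalSpace N ν n)) := Ideal.span {germ fun p => p.1}
  have hI : I ≤ Ideal.jacobson ⊥ := by
    rw [Ideal.span_singleton_le_iff_mem, germ_eq hτ]
    exact toGerm_mem_jacobson hτ rfl
  refine mem_of_forall_mem_sup_pow_smul (spanL0 N S) I hI _ fun K => ?_
  obtain ⟨B, hB, C, hC⟩ := happrox K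
  have hBa := analyticAt_of_mem_gradedSpan hS hB
  have aW : AnalyticAt ℝ (fun p : TotalSpace N ν n => W (blowUp e p).1 (blowUp e p).2) 0 :=
    hW.comp_of_eq (analyticAt_blowUp e 0) (blowUp_zero e)
  have aB : AnalyticAt ℝ (fun p : TotalSpace N ν n => B (blowUp e p)) 0 :=
    hBa.comp_of_eq (analyticAt_blowUp e 0) (blowUp_zero e)
  have aR : AnalyticAt ℝ (fun p : TotalSpace N ν n =>
      W (blowUp e p).1 (blowUp e p).2 - B (blowUp e p)) 0 := aW.sub aB
  have hsplit : vecGerm (fun p : TotalSpace N ν n => W (blowUp e p).1 (blowUp e p).2) =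
      vecGerm (fun p : TotalSpace N ν n => B (blowUp e p)) +
      vecGerm (fun p : TotalSpace N ν n =>
        W (blowUp e p).1 (blowUp e p).2 - B (blowUp e p)) := by
    rw [← vecGerm_add aB aR]
    simp
  rw [hsplit]
  refine Submodule.add_mem_sup (vecGerm_blowUp_mem hS hB) ?_
  have hbound : ∀ᶠ p in 𝓝 (0 : TotalSpace N ν n),
      ‖W (blowUp e p).1 (blowUp e p).2 - B (blowUp e p)‖ ≤ |C| * |p.1| ^ K := by
    have h1 : Filter.Tendsto (blowUp e) (𝓝 (0 : TotalSpace N ν n)) (𝓝 0) := by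
      have := (analyticAt_blowUp e (0 : TotalSpace N ν n)).continuousAt.tendsto
      rwa [blowUp_zero] at this
    have h2 : AnalyticAt ℝ (fun p : TotalSpace N ν n => dilate e p.2.2.1 p.2.1) 0 :=
      analyticAt_dilate e (analyticAt_totalSpace_delta 0) (((ContinuousLinearMap.fst ℝ _ _).comp
        (ContinuousLinearMap.snd ℝ ℝ (Rn N × (Fin ν → ℝ) × Rn n))).analyticAt 0)
    have h3 : Filter.Tendsto (fun p : TotalSpace N ν n => ‖dilate e p.2.2.1 p.2.1‖) (𝓝 0)
        (𝓝 0) := by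
      have := h2.continuousAt.norm.tendsto
      have h0 : dilate e (0 : TotalSpace N ν n).2.2.1 (0 : TotalSpace N ν n).2.1 = 0 := by
        ext j
        simp [dilate]
      rwa [h0, norm_zero] at this
    filter_upwards [h1.eventually hC, h3.eventually_le_const one_pos] with p hp hd
    refine hp.trans ?_
    gcongr
    · exact le_abs_self C
    · change ‖dilate e p.2.2.1 (p.1 • p.2.1)‖ ≤ _
      rw [dilate_smul, norm_smul, Real.norm_eq_abs]
      exact mul_le_of_le_one_right (abs_nonneg _) hd
  have hi : ∀ i, ∃ g : anGerm (TotalSpace N ν n),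
      germ (fun p : TotalSpace N ν n =>
        (W (blowUp e p).1 (blowUp e p).2 - B (blowUp e p)) i) =
      germ (fun p : TotalSpace N ν n => p.1) ^ K * g := by
    intro i
    obtain ⟨g, hg, h⟩ := exists_eq_fst_pow_mul K (C := |C|) (analyticAt_coord aR i)
      (hbound.mono fun p hp => (PiLp.norm_apply_le _ i).trans hp)
    refine ⟨germ g, ?_⟩
    rw [← germ_pow hτ, ← germ_mul (hτ.fun_pow K) hg]
    exact germ_congr ((hτ.fun_pow K).mul hg) h
  choose g hg using hi
  have : vecGerm (fun p : TotalSpace N ν n =>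
        W (blowUp e p).1 (blowUp e p).2 - B (blowUp e p)) =
      germ (fun p : TotalSpace N ν n => p.1) ^ K • g := funext hg
  rw [this]
  exact Submodule.smul_mem_smul
    (Ideal.pow_mem_pow (Ideal.mem_span_singleton_self _) K)
    Submodule.mem_top

/-- If `W` is approximated to every order in `t` by combinations of the `t ^ α Z` with `Z` of degree
`deg α` in `L₀` of the fields `X_α`, then the finite type condition holds for `W` and the `X_α`. -/
theorem finiteType_of_approx {W : Rn N → Rn n → Rn n} {X : (Fin N → ℕ) → Rn n → Rn n}
    (hX : ∀ α, α ≠ 0 → AnalyticAt ℝ (X α) 0)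
    (hW : AnalyticAt ℝ (fun p : Rn N × Rn n => W p.1 p.2) 0)
    (happrox : ∀ K : ℕ, ∃ B ∈ gradedSpan e {Z : FormalField n ν | ∃ α, α ≠ 0 ∧ Z = (X α, deg e α)},
      ∃ C : ℝ, ∀ᶠ p in 𝓝 (0 : Rn N × Rn n), ‖W p.1 p.2 - B p‖ ≤ C * ‖p.1‖ ^ K) :
    FiniteType e W X := by
  set S : Set (FormalField n ν) := {Z | ∃ α, α ≠ 0 ∧ Z = (X α, deg e α)} with hSdef
  have hS : ∀ Z ∈ S, AnalyticAt ℝ Z.1 0 := by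
    rintro _ ⟨α, hα, rfl⟩
    exact hX α hα
  obtain ⟨r, F, p, T, hF, hT, hspan⟩ := exists_generating_list N S
  have hFS : Set.range F ⊆ S := by
    rintro _ ⟨i, rfl⟩
    exact hF i
  have hmem : ∀ l, MemL0 S (Fin.append F T l) := fun l => by
    refine Fin.addCases (fun i => ?_) (fun k => ?_) l
    · rw [Fin.append_left]
      exact .base _ (hF i)
    · rw [Fin.append_right]
      exact (hT k).mono hFS
  have hY : ∀ l, AnalyticAt ℝ (Fin.append F T l).1 0 := fun l => (hmem l).analyticAt hS
  refine ⟨r, F, hF, r + p, Fin.append F T, ⟨Nat.le_add_right r p, fun i => ?_, fun j hj => ?_,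
    fun j k => ?_⟩, ?_⟩
  · exact Fin.append_left F T i
  · induction j using Fin.addCases with
    | left i => exact absurd i.2 (not_lt.2 hj)
    | right k =>
      rw [Fin.append_right]
      exact hT k
  · refine controls_of_mem_span (N := N) _ hY (analyticAt_lieBracket (hY j) (hY k)) ?_
    rw [← hspan]
    exact ((hmem j).bracket_inSpanL0 hS (hmem k)).fieldGerm_mem hS
  · refine controlsParam_of_mem_span e _ hY hW ?_
    rw [← hspan]
    exact vecGerm_blowUp_mem_of_approx hS hW happrox

end

end Radon

namespace Radon

/-! ### Pullbacks and derivations of germs -/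

section

variable {E F : Type*} [NormedAddCommGroup E] [NormedSpace ℝ E]
  [NormedAddCommGroup F] [NormedSpace ℝ F]

/-- Composition of germs with an analytic map that fixes the origin. -/
noncomputable def pullback (f : E → F) (hf : AnalyticAt ℝ f 0) (h0 : f 0 = 0) :
    anGerm F →ₐ[ℝ] anGerm E where
  toFun φ := germ fun x => rep φ (f x)
  map_one' := by
    have ht : Filter.Tendsto f (𝓝 0) (𝓝 0) := by simpa [h0] using hf.continuousAt.tendsto
    rw [germ_congr analyticAt_const (ht.eventually rep_one), germ_const, map_one]
  map_zero' := by
    have ht : Filter.Tendsto f (𝓝 0) (𝓝 0) := by simpa [h0] using hf.continuousAt.tendsto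
    rw [germ_congr analyticAt_const (ht.eventually rep_zero), germ_const, map_zero]
  map_mul' φ ψ := by
    have ht : Filter.Tendsto f (𝓝 0) (𝓝 0) := by simpa [h0] using hf.continuousAt.tendsto
    have h1 := (analyticAt_rep φ).comp_of_eq hf h0
    have h2 := (analyticAt_rep ψ).comp_of_eq hf h0
    refine Eq.trans ?_ (germ_mul h1 h2)
    exact germ_congr (h1.mul h2) (ht.eventually (rep_mul φ ψ))
  map_add' φ ψ := by
    have ht : Filter.Tendsto f (𝓝 0) (𝓝 0) := by simpa [h0] using hf.continuousAt.tendsto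
    have h1 := (analyticAt_rep φ).comp_of_eq hf h0
    have h2 := (analyticAt_rep ψ).comp_of_eq hf h0
    refine Eq.trans ?_ (germ_add h1 h2)
    exact germ_congr (h1.add h2) (ht.eventually (rep_add φ ψ))
  commutes' c := by
    have ht : Filter.Tendsto f (𝓝 0) (𝓝 0) := by simpa [h0] using hf.continuousAt.tendsto
    rw [← germ_const c, germ_congr analyticAt_const (ht.eventually (rep_germ analyticAt_const)),
      germ_const]

theorem pullback_germ {f : E → F} (hf : AnalyticAt ℝ f 0) (h0 : f 0 = 0) {g : F → ℝ}
    (hg : AnalyticAt ℝ g 0) : pullback f hf h0 (germ g) = germ fun x => g (f x) := by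
  have ht : Filter.Tendsto f (𝓝 0) (𝓝 0) := by simpa [h0] using hf.continuousAt.tendsto
  exact germ_congr (hg.comp_of_eq hf h0) (ht.eventually (rep_germ hg))

theorem analyticAt_fderiv_apply {f : E → F} {a : E} [CompleteSpace F] (hf : AnalyticAt ℝ f a)
    (w : E) : AnalyticAt ℝ (fun p => fderiv ℝ f p w) a :=
  analyticAt_clm_apply hf.fderiv analyticAt_const

/-- The derivative in the direction `w`, as a derivation of the ring of germs. -/
noncomputable def dirDeriv (w : E) : Derivation ℝ (anGerm E) (anGerm E) :=
  Derivation.mk'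
    { toFun := fun φ => germ fun p => fderiv ℝ (rep φ) p w
      map_add' := fun φ ψ => by
        have h1 := analyticAt_fderiv_apply (analyticAt_rep φ) w
        have h2 := analyticAt_fderiv_apply (analyticAt_rep ψ) w
        rw [← germ_add h1 h2]
        refine germ_congr (h1.add h2) ?_
        filter_upwards [(rep_add φ ψ).fderiv (𝕜 := ℝ), (analyticAt_rep φ).eventually_analyticAt,
          (analyticAt_rep ψ).eventually_analyticAt] with p hp h3 h4
        rw [hp, fderiv_fun_add h3.differentiableAt h4.differentiableAt]
        rfl
      map_smul' := fun c φ => by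
        have h1 := analyticAt_fderiv_apply (analyticAt_rep φ) w
        rw [RingHom.id_apply, ← germ_smul c h1]
        refine germ_congr (analyticAt_const.mul h1) ?_
        filter_upwards [(rep_smul c φ).fderiv (𝕜 := ℝ), (analyticAt_rep φ).eventually_analyticAt]
          with p hp h3
        rw [hp, fderiv_const_mul h3.differentiableAt]
        rfl } fun φ ψ => by
    have a1 := analyticAt_rep φ
    have a2 := analyticAt_rep ψ
    have h1 := analyticAt_fderiv_apply a1 w
    have h2 := analyticAt_fderiv_apply a2 w
    rw [smul_eq_mul, smul_eq_mul]
    conv_rhs => rw [← germ_rep φ, ← germ_rep ψ]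
    refine Eq.trans ?_ (congrArg₂ (· + ·) (germ_mul a1 ?_) (germ_mul a2 ?_))
    · change germ (fun p => fderiv ℝ (rep (φ * ψ)) p w) = _
      rw [germ_rep, germ_rep]
      refine Eq.trans ?_ (germ_add (a1.mul h2) (a2.mul h1))
      refine germ_congr ((a1.mul h2).add (a2.mul h1)) ?_
      filter_upwards [(rep_mul φ ψ).fderiv (𝕜 := ℝ), a1.eventually_analyticAt,
        a2.eventually_analyticAt]
        with p hp h3 h4
      rw [hp, fderiv_fun_mul h3.differentiableAt h4.differentiableAt]
      rfl
    · rw [germ_rep]; exact h2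
    · rw [germ_rep]; exact h1

theorem dirDeriv_germ (w : E) {f : E → ℝ} (hf : AnalyticAt ℝ f 0) :
    dirDeriv w (germ f) = germ fun p => fderiv ℝ f p w := by
  refine germ_congr (analyticAt_fderiv_apply hf w) ?_
  filter_upwards [(rep_germ hf).fderiv (𝕜 := ℝ)] with p hp
  rw [hp]

theorem dirDeriv_comm (v w : E) (φ : anGerm E) :
    dirDeriv v (dirDeriv w φ) = dirDeriv w (dirDeriv v φ) := by
  have a := analyticAt_rep φ
  have e : ∀ u : E, dirDeriv u φ = germ fun p => fderiv ℝ (rep φ) p u := fun u => rfl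
  rw [e v, e w, dirDeriv_germ v (analyticAt_fderiv_apply a w),
    dirDeriv_germ w (analyticAt_fderiv_apply a v)]
  refine germ_congr (analyticAt_fderiv_apply (analyticAt_fderiv_apply a v) w) ?_
  filter_upwards [a.eventually_analyticAt] with p hp
  have h1 : ∀ u u' : E, fderiv ℝ (fun q => fderiv ℝ (rep φ) q u) p u' =
      fderiv ℝ (fderiv ℝ (rep φ)) p u' u := fun u u' => by
    rw [fderiv_clm_apply hp.fderiv.differentiableAt (differentiableAt_const u)]
    simp
  rw [h1, h1]
  exact (hp.contDiffAt (n := ω)).isSymmSndFDerivAt (by simp) v w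

/-! ### Vanishing order in the first variable -/

/-- The germs in `(t,x)` that are `O(|t|^m)`. -/
noncomputable def vanishIdeal (E F : Type*) [NormedAddCommGroup E] [NormedSpace ℝ E]
    [NormedAddCommGroup F] [NormedSpace ℝ F] (m : ℕ) : Ideal (anGerm (E × F)) where
  carrier := {φ | ∃ C, ∀ᶠ p in 𝓝 (0 : E × F), |rep φ p| ≤ C * ‖p.1‖ ^ m}
  zero_mem' := ⟨0, by
    filter_upwards [rep_zero (E := E × F)] with p hp
    simp [hp]⟩
  add_mem' := by
    rintro φ ψ ⟨C, hC⟩ ⟨D, hD⟩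
    refine ⟨C + D, ?_⟩
    filter_upwards [rep_add φ ψ, hC, hD] with p h1 h2 h3
    rw [h1, add_mul]
    exact (abs_add_le _ _).trans (add_le_add h2 h3)
  smul_mem' := by
    rintro φ ψ ⟨C, hC⟩
    refine ⟨(|rep φ 0| + 1) * C, ?_⟩
    filter_upwards [rep_mul φ ψ, hC, (analyticAt_rep φ).continuousAt.abs.eventually_le_const
      (lt_add_one |rep φ 0|)] with p h1 h2 h3
    rw [smul_eq_mul, h1, abs_mul, mul_assoc]
    exact mul_le_mul h3 h2 (abs_nonneg _) (by positivity)

theorem germ_mem_vanishIdeal {m : ℕ} {f : E × F → ℝ} (hf : AnalyticAt ℝ f 0) :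
    germ f ∈ vanishIdeal E F m ↔ ∃ C, ∀ᶠ p in 𝓝 (0 : E × F), |f p| ≤ C * ‖p.1‖ ^ m := by
  constructor
  · rintro ⟨C, hC⟩
    refine ⟨C, ?_⟩
    filter_upwards [hC, rep_germ hf] with p h1 h2
    rwa [← h2]
  · rintro ⟨C, hC⟩
    refine ⟨C, ?_⟩
    filter_upwards [hC, rep_germ hf] with p h1 h2
    rwa [h2]

theorem mem_vanishIdeal_zero (φ : anGerm (E × F)) : φ ∈ vanishIdeal E F 0 :=
  ⟨|rep φ 0| + 1, by
    filter_upwards [(analyticAt_rep φ).continuousAt.abs.eventually_le_const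
      (lt_add_one |rep φ 0|)] with p hp
    simpa using hp⟩

theorem vanishIdeal_anti {k m : ℕ} (h : k ≤ m) : vanishIdeal E F m ≤ vanishIdeal E F k := by
  rintro φ ⟨C, hC⟩
  refine ⟨|C|, ?_⟩
  have h1 : ∀ᶠ p in 𝓝 (0 : E × F), ‖p.1‖ ≤ 1 := by
    have : Filter.Tendsto (fun p : E × F => ‖p.1‖) (𝓝 0) (𝓝 0) := by
      have hc : Continuous fun p : E × F => ‖p.1‖ := by fun_prop
      simpa using hc.tendsto 0
    exact this.eventually_le_const one_pos
  filter_upwards [hC, h1] with p hp hp1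
  refine hp.trans ?_
  exact mul_le_mul (le_abs_self C) (pow_le_pow_of_le_one (norm_nonneg _) hp1 h) (by positivity)
    (abs_nonneg C)

theorem mul_mem_vanishIdeal {k m : ℕ} {φ ψ : anGerm (E × F)} (hφ : φ ∈ vanishIdeal E F k)
    (hψ : ψ ∈ vanishIdeal E F m) : φ * ψ ∈ vanishIdeal E F (k + m) := by
  obtain ⟨C, hC⟩ := hφ
  obtain ⟨D, hD⟩ := hψ
  refine ⟨C * D, ?_⟩
  filter_upwards [rep_mul φ ψ, hC, hD] with p h1 h2 h3
  rw [h1, abs_mul, pow_add]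
  calc _ ≤ (C * ‖p.1‖ ^ k) * (D * ‖p.1‖ ^ m) :=
        mul_le_mul h2 h3 (abs_nonneg _) ((abs_nonneg _).trans h2)
    _ = _ := by ring

theorem smul_mem_vanishIdeal {m : ℕ} (c : ℝ) {φ : anGerm (E × F)} (hφ : φ ∈ vanishIdeal E F m) :
    c • φ ∈ vanishIdeal E F m := by
  rw [Algebra.smul_def]
  exact Ideal.mul_mem_left _ _ hφ

/-- The map `(τ, t, x) ↦ (τ t, x)`. -/
def cone (p : ℝ × E × F) : E × F := (p.1 • p.2.1, p.2.2)

theorem analyticAt_cone (a : ℝ × E × F) : AnalyticAt ℝ (cone (E := E) (F := F)) a := by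
  have a1 : AnalyticAt ℝ (fun p : ℝ × E × F => p.2.1) a :=
    ((ContinuousLinearMap.fst ℝ _ _).comp (ContinuousLinearMap.snd ℝ _ _)).analyticAt a
  have a2 : AnalyticAt ℝ (fun p : ℝ × E × F => p.2.2) a :=
    ((ContinuousLinearMap.snd ℝ _ _).comp (ContinuousLinearMap.snd ℝ _ _)).analyticAt a
  exact (analyticAt_fst.smul a1).prod a2

theorem cone_zero : cone (0 : ℝ × E × F) = 0 := Prod.ext (smul_zero _) rfl

theorem tendsto_cone : Filter.Tendsto (cone (E := E) (F := F)) (𝓝 0) (𝓝 0) := by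
  have := (analyticAt_cone (0 : ℝ × E × F)).continuousAt.tendsto
  rwa [cone_zero] at this

/-- A bound by `|τ|^k` of `h(τ t, x)` gives a bound by `|t|^k` of `h`: write a small `s` as `τ t`
with `|t|` of fixed size. -/
theorem bound_of_cone_bound {h : E × F → ℝ} {k : ℕ} {C : ℝ}
    (hC : ∀ᶠ p in 𝓝 (0 : ℝ × E × F), |h (cone p)| ≤ C * |p.1| ^ k) :
    ∃ C, ∀ᶠ p in 𝓝 (0 : E × F), |h p| ≤ C * ‖p.1‖ ^ k := by
  obtain ⟨r, hr, H⟩ := Metric.eventually_nhds_iff_ball.1 hC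
  refine ⟨C * (2 / r) ^ k, ?_⟩
  filter_upwards [Metric.ball_mem_nhds (0 : E × F) (ε := min r (r * r / 2)) (by positivity)]
    with p hp
  rw [mem_ball_zero_iff, Prod.norm_def] at hp
  obtain ⟨hp1, hp2⟩ := max_lt_iff.1 hp
  have hp1' : ‖p.1‖ < r * r / 2 := hp1.trans_le (min_le_right _ _)
  have hp2' : ‖p.2‖ < r := hp2.trans_le (min_le_left _ _)
  let q : ℝ × E × F := (2 / r * ‖p.1‖, (r / 2 * ‖p.1‖⁻¹) • p.1, p.2)
  have hq : cone q = p := by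
    refine Prod.ext ?_ rfl
    change (2 / r * ‖p.1‖) • (r / 2 * ‖p.1‖⁻¹) • p.1 = p.1
    by_cases h0 : p.1 = 0
    · simp [h0]
    · have : ‖p.1‖ ≠ 0 := norm_ne_zero_iff.2 h0
      rw [smul_smul]
      have e : 2 / r * ‖p.1‖ * (r / 2 * ‖p.1‖⁻¹) = 1 := by field_simp
      rw [e, one_smul]
  have hq1 : |q.1| = 2 / r * ‖p.1‖ := abs_of_nonneg (by positivity)
  have hqb : q ∈ Metric.ball (0 : ℝ × E × F) r := by
    rw [mem_ball_zero_iff, Prod.norm_def, Prod.norm_def]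
    refine max_lt ?_ (max_lt ?_ hp2')
    · rw [Real.norm_eq_abs, hq1]
      calc 2 / r * ‖p.1‖ < 2 / r * (r * r / 2) := by gcongr
        _ = r := by field_simp
    · change ‖(r / 2 * ‖p.1‖⁻¹) • p.1‖ < r
      rw [norm_smul, Real.norm_eq_abs, abs_of_nonneg (by positivity), mul_assoc]
      have : ‖p.1‖⁻¹ * ‖p.1‖ ≤ 1 := inv_mul_le_one
      nlinarith
  have := H q hqb
  rw [hq, hq1, mul_pow, ← mul_assoc] at this
  exact this

theorem exists_cone_eq [FiniteDimensional ℝ E] [FiniteDimensional ℝ F] {f : E × F → ℝ} {m : ℕ}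
    (hf : AnalyticAt ℝ f 0) {C : ℝ} (hC : ∀ᶠ p in 𝓝 (0 : E × F), |f p| ≤ C * ‖p.1‖ ^ m) :
    ∃ g : ℝ × E × F → ℝ, AnalyticAt ℝ g 0 ∧ ∀ᶠ p in 𝓝 0, f (cone p) = p.1 ^ m * g p := by
  refine exists_eq_fst_pow_mul m (C := |C|) (hf.comp_of_eq (analyticAt_cone 0) cone_zero) ?_
  have h1 : ∀ᶠ p in 𝓝 (0 : ℝ × E × F), ‖p.2.1‖ ≤ 1 := by
    have : Filter.Tendsto (fun p : ℝ × E × F => ‖p.2.1‖) (𝓝 0) (𝓝 0) := by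
      have hc : Continuous fun p : ℝ × E × F => ‖p.2.1‖ := by fun_prop
      simpa using hc.tendsto 0
    exact this.eventually_le_const one_pos
  filter_upwards [tendsto_cone.eventually hC, h1] with p hp hp1
  refine hp.trans ?_
  gcongr
  · exact le_abs_self C
  · change ‖p.1 • p.2.1‖ ≤ _
    rw [norm_smul, Real.norm_eq_abs]
    exact mul_le_of_le_one_right (abs_nonneg _) hp1

/-- Differentiation of `f(τ t, x) = τ ^ m g(τ, t, x)` in `(t,x)`. -/
theorem exists_fderiv_cone_bound [FiniteDimensional ℝ E] [FiniteDimensional ℝ F] {f : E × F → ℝ}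
    {m : ℕ} (hf : AnalyticAt ℝ f 0) {C : ℝ}
    (hC : ∀ᶠ p in 𝓝 (0 : E × F), |f p| ≤ C * ‖p.1‖ ^ m) (u : E) (v : F) :
    ∃ C, ∀ᶠ p in 𝓝 (0 : ℝ × E × F), |fderiv ℝ f (cone p) (p.1 • u, v)| ≤ C * |p.1| ^ m := by
  obtain ⟨g, hg, h⟩ := exists_cone_eq hf hC
  have hg' : AnalyticAt ℝ (fun p => fderiv ℝ g p ((0 : ℝ), u, v)) 0 := analyticAt_fderiv_apply hg _
  refine ⟨|fderiv ℝ g 0 ((0 : ℝ), u, v)| + 1, ?_⟩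
  filter_upwards [h.eventually_nhds, tendsto_cone.eventually hf.eventually_analyticAt,
    hg.eventually_analyticAt, hg'.continuousAt.abs.eventually_le_const (lt_add_one _)]
    with p hp hfp hgp hb
  -- both sides are differentiated along the line `p + s (0, u, v)`
  have hline : HasDerivAt (fun s : ℝ => p + s • ((0 : ℝ), u, v)) ((0 : ℝ), u, v) 0 := by
    simpa using ((hasDerivAt_id (0 : ℝ)).smul_const ((0 : ℝ), u, v)).const_add p
  have hp0 : p + (0 : ℝ) • ((0 : ℝ), u, v) = p := by simp
  have d1 : HasDerivAt (fun s : ℝ => f (cone (p + s • ((0 : ℝ), u, v))))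
      (fderiv ℝ f (cone p) (p.1 • u, v)) 0 := by
    have e : (fun s : ℝ => cone (p + s • ((0 : ℝ), u, v))) =
        fun s : ℝ => cone p + s • (p.1 • u, v) := by
      funext s
      refine Prod.ext ?_ ?_
      · simp [cone, smul_smul, mul_comm]
      · simp [cone]
    have hl : HasDerivAt (fun s : ℝ => cone (p + s • ((0 : ℝ), u, v))) (p.1 • u, v) 0 := by
      rw [e]
      simpa using ((hasDerivAt_id (0 : ℝ)).smul_const (p.1 • u, v)).const_add (cone p)
    have hfd : HasFDerivAt f (fderiv ℝ f (cone p)) (cone (p + (0 : ℝ) • ((0 : ℝ), u, v))) := by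
      rw [hp0]
      exact hfp.differentiableAt.hasFDerivAt
    exact hfd.comp_hasDerivAt (0 : ℝ) hl
  have d2 : HasDerivAt (fun s : ℝ => p.1 ^ m * g (p + s • ((0 : ℝ), u, v)))
      (p.1 ^ m * fderiv ℝ g p ((0 : ℝ), u, v)) 0 := by
    have hgd : HasFDerivAt g (fderiv ℝ g p) (p + (0 : ℝ) • ((0 : ℝ), u, v)) := by
      rw [hp0]
      exact hgp.differentiableAt.hasFDerivAt
    exact (hgd.comp_hasDerivAt (0 : ℝ) hline).const_mul _
  have heq : (fun s : ℝ => f (cone (p + s • ((0 : ℝ), u, v)))) =ᶠ[𝓝 0]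
      fun s : ℝ => p.1 ^ m * g (p + s • ((0 : ℝ), u, v)) := by
    have ht : Filter.Tendsto (fun s : ℝ => p + s • ((0 : ℝ), u, v)) (𝓝 0) (𝓝 p) := by
      have := hline.continuousAt.tendsto
      rwa [hp0] at this
    filter_upwards [ht.eventually hp] with s hs
    rw [hs]
    simp
  rw [d1.unique (d2.congr_of_eventuallyEq heq), abs_mul, abs_pow, mul_comm]
  gcongr

theorem dirDeriv_snd_mem_vanishIdeal [FiniteDimensional ℝ E] [FiniteDimensional ℝ F] {m : ℕ}
    (v : F) {φ : anGerm (E × F)} (hφ : φ ∈ vanishIdeal E F m) :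
    dirDeriv ((0 : E), v) φ ∈ vanishIdeal E F m := by
  obtain ⟨C, hC⟩ := hφ
  obtain ⟨D, hD⟩ := exists_fderiv_cone_bound (analyticAt_rep φ) hC 0 v
  refine (germ_mem_vanishIdeal (analyticAt_fderiv_apply (analyticAt_rep φ) _)).2 ?_
  refine bound_of_cone_bound (C := D) ?_
  filter_upwards [hD] with p hp
  rwa [smul_zero] at hp

theorem dirDeriv_fst_mem_vanishIdeal [FiniteDimensional ℝ E] [FiniteDimensional ℝ F] {m : ℕ}
    (u : E) {φ : anGerm (E × F)} (hφ : φ ∈ vanishIdeal E F (m + 1)) :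
    dirDeriv (u, (0 : F)) φ ∈ vanishIdeal E F m := by
  obtain ⟨C, hC⟩ := hφ
  obtain ⟨D, hD⟩ := exists_fderiv_cone_bound (analyticAt_rep φ) hC u 0
  have ha := analyticAt_fderiv_apply (analyticAt_rep φ) (u, (0 : F))
  refine (germ_mem_vanishIdeal ha).2 ?_
  refine bound_of_cone_bound (C := D) ?_
  refine eventually_le_of_fst_ne_zero
    ((ha.comp_of_eq (analyticAt_cone 0) cone_zero).eventually_analyticAt.mono
      fun p hp => hp.continuousAt.abs)
    (Filter.Eventually.of_forall fun p => by fun_prop) ?_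
  filter_upwards [hD] with p hp hp0
  have e : (p.1 • u, (0 : F)) = p.1 • (u, (0 : F)) := by simp
  rw [e, map_smul, smul_eq_mul, abs_mul, pow_succ, ← mul_assoc, mul_comm |p.1|] at hp
  exact le_of_mul_le_mul_right hp (abs_pos.2 hp0)

end

end Radon

namespace Radon

/-! ### Taylor expansion in the first variable -/

section

variable {N n : ℕ}

/-- The germs of functions of `x`, as germs in `(t,x)`. -/
noncomputable def ofX (N n : ℕ) : anGerm (Rn n) →ₐ[ℝ] anGerm (Rn N × Rn n) :=
  pullback Prod.snd analyticAt_snd rfl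

/-- Restriction to `t = 0`. -/
noncomputable def atZero (N n : ℕ) : anGerm (Rn N × Rn n) →ₐ[ℝ] anGerm (Rn n) :=
  pullback (fun x => ((0 : Rn N), x)) (analyticAt_const.prod analyticAt_id) rfl

/-- The germ of the monomial `t ^ α`. -/
noncomputable def tmon (n : ℕ) {N : ℕ} (α : Fin N → ℕ) : anGerm (Rn N × Rn n) :=
  germ fun p => monomial p.1 α

/-- The derivation `∂_{t_j}`. -/
noncomputable def partialT (N n : ℕ) (j : Fin N) :
    Derivation ℝ (anGerm (Rn N × Rn n)) (anGerm (Rn N × Rn n)) :=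
  dirDeriv ((EuclideanSpace.single j (1 : ℝ) : Rn N), (0 : Rn n))

theorem ofX_germ {g : Rn n → ℝ} (hg : AnalyticAt ℝ g 0) :
    ofX N n (germ g) = germ fun p : Rn N × Rn n => g p.2 := pullback_germ _ _ hg

theorem atZero_germ {g : Rn N × Rn n → ℝ} (hg : AnalyticAt ℝ g 0) :
    atZero N n (germ g) = germ fun x => g (0, x) := pullback_germ _ _ hg

theorem atZero_ofX (g : anGerm (Rn n)) : atZero N n (ofX N n g) = g := by
  have h := analyticAt_rep g
  have h2 : AnalyticAt ℝ (fun p : Rn N × Rn n => rep g p.2) 0 := h.comp_of_eq analyticAt_snd rfl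
  rw [← germ_rep g, ofX_germ h, atZero_germ h2]

theorem partialT_ofX (j : Fin N) (g : anGerm (Rn n)) : partialT N n j (ofX N n g) = 0 := by
  have h := analyticAt_rep g
  have h2 : AnalyticAt ℝ (fun p : Rn N × Rn n => rep g p.2) 0 := h.comp_of_eq analyticAt_snd rfl
  rw [← germ_rep g, ofX_germ h, partialT, dirDeriv_germ _ h2]
  refine (germ_congr (g := fun _ => (0 : ℝ)) analyticAt_const ?_).trans
    ((germ_const _).trans (map_zero _))
  have hs : Filter.Tendsto (Prod.snd : Rn N × Rn n → Rn n) (𝓝 0) (𝓝 0) :=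
    continuous_snd.tendsto 0
  filter_upwards [hs.eventually h.eventually_analyticAt] with p hp
  have := (hp.differentiableAt.hasFDerivAt.comp p
    (hasFDerivAt_snd (𝕜 := ℝ) (E := Rn N) (F := Rn n))).fderiv
  change fderiv ℝ (rep g ∘ Prod.snd) p _ = 0
  rw [this]
  simp

theorem analyticAt_monomial_fst (α : Fin N → ℕ) :
    AnalyticAt ℝ (fun p : Rn N × Rn n => monomial p.1 α) 0 :=
  analyticAt_monomial analyticAt_fst α

theorem monomial_zero_right (t : Rn N) : monomial t 0 = 1 := by simp [monomial]

theorem monomial_add (t : Rn N) (α β : Fin N → ℕ) :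
    monomial t (α + β) = monomial t α * monomial t β := by
  simp [monomial, pow_add, Finset.prod_mul_distrib]

theorem tmon_zero : tmon n (0 : Fin N → ℕ) = 1 := by
  simp only [tmon, monomial_zero_right]
  exact (germ_const _).trans (map_one _)

theorem tmon_add (α β : Fin N → ℕ) : tmon n (α + β) = tmon n α * tmon n β := by
  simp only [tmon, monomial_add]
  exact germ_mul (analyticAt_monomial_fst α) (analyticAt_monomial_fst β)

theorem abs_monomial_le (t : Rn N) (α : Fin N → ℕ) : |monomial t α| ≤ ‖t‖ ^ ∑ j, α j := by
  rw [monomial, Finset.abs_prod, ← Finset.prod_pow_eq_pow_sum]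
  refine Finset.prod_le_prod (fun _ _ => abs_nonneg _) fun j _ => ?_
  rw [abs_pow]
  exact pow_le_pow_left₀ (abs_nonneg _) (PiLp.norm_apply_le t j) _

theorem tmon_mem_vanishIdeal (α : Fin N → ℕ) : tmon n α ∈ vanishIdeal (Rn N) (Rn n) (∑ j, α j) :=
  (germ_mem_vanishIdeal (analyticAt_monomial_fst α)).2
    ⟨1, Filter.Eventually.of_forall fun p => by rw [one_mul]; exact abs_monomial_le _ _⟩

theorem atZero_of_mem_vanishIdeal {φ : anGerm (Rn N × Rn n)}
    (h : φ ∈ vanishIdeal (Rn N) (Rn n) 1) : atZero N n φ = 0 := by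
  obtain ⟨C, hC⟩ := h
  have hz : Filter.Tendsto (fun x : Rn n => ((0 : Rn N), x)) (𝓝 0) (𝓝 0) :=
    (Continuous.prodMk_right (0 : Rn N)).tendsto 0
  refine (germ_congr (g := fun _ => (0 : ℝ)) analyticAt_const ?_).trans
    ((germ_const _).trans (map_zero _))
  filter_upwards [hz.eventually hC] with x hx
  simpa using hx

theorem atZero_tmon {α : Fin N → ℕ} (hα : α ≠ 0) : atZero N n (tmon n α) = 0 := by
  refine atZero_of_mem_vanishIdeal (vanishIdeal_anti ?_ (tmon_mem_vanishIdeal α))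
  rw [Nat.one_le_iff_ne_zero, ne_eq, Finset.sum_eq_zero_iff]
  exact fun h => hα (funext fun j => h j (Finset.mem_univ _))

theorem tmon_single (j : Fin N) : tmon n (Pi.single j 1) = germ fun p : Rn N × Rn n => p.1 j := by
  have : ∀ t : Rn N, monomial t (Pi.single j 1) = t j := fun t => by
    rw [monomial, Finset.prod_eq_single j]
    · simp
    · intro k _ hk; simp [hk]
    · simp
  simp only [tmon, this]

theorem partialT_tmon_single (j k : Fin N) :
    partialT N n j (tmon n (Pi.single k 1)) = if j = k then 1 else 0 := by
  have ha : AnalyticAt ℝ (fun p : Rn N × Rn n => p.1 k) 0 := analyticAt_coord analyticAt_fst k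
  rw [tmon_single, partialT, dirDeriv_germ _ ha]
  have : ∀ p : Rn N × Rn n, fderiv ℝ (fun p : Rn N × Rn n => p.1 k) p
      ((EuclideanSpace.single j (1 : ℝ) : Rn N), (0 : Rn n)) = if j = k then 1 else 0 := fun p => by
    let L : Rn N × Rn n →L[ℝ] ℝ :=
      (EuclideanSpace.proj (𝕜 := ℝ) k).comp (ContinuousLinearMap.fst ℝ (Rn N) (Rn n))
    have h : fderiv ℝ (fun p : Rn N × Rn n => p.1 k) p = L := L.fderiv (x := p)
    rw [h]
    simp [L, eq_comm]
  simp only [this]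
  rw [germ_const]
  split_ifs <;> simp

theorem tmon_nsmul (m : ℕ) (α : Fin N → ℕ) : tmon n (m • α) = tmon n α ^ m := by
  induction m with
  | zero => rw [zero_smul, pow_zero, tmon_zero]
  | succ m ih => rw [succ_nsmul, tmon_add, ih, pow_succ]

theorem eq_update_zero_add (α : Fin N → ℕ) (j : Fin N) :
    α = Function.update α j 0 + α j • Pi.single j 1 := by
  funext k
  by_cases h : k = j
  · subst h; simp
  · simp [h]

theorem partialT_tmon_of_eq_zero (α : Fin N → ℕ) (j : Fin N) (h : α j = 0) :
    partialT N n j (tmon n α) = 0 := by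
  have hprod : tmon n α = ∏ k, tmon n (α k • Pi.single k 1) := by
    have : ∀ s : Finset (Fin N), ∏ k ∈ s, tmon n (α k • Pi.single k 1) =
        tmon n (∑ k ∈ s, α k • Pi.single k 1) := fun s => by
      classical
      induction s using Finset.induction_on with
      | empty => simp [tmon_zero]
      | insert a s ha ih => rw [Finset.prod_insert ha, Finset.sum_insert ha, ih, tmon_add]
    rw [this]
    congr 1
    funext k
    simp [Finset.sum_apply, Pi.single_apply]
  rw [hprod]
  have : ∀ s : Finset (Fin N), partialT N n j (∏ k ∈ s, tmon n (α k • Pi.single k 1)) = 0 :=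
    fun s => by
      classical
      induction s using Finset.induction_on with
      | empty => simp
      | insert a s ha ih =>
        rw [Finset.prod_insert ha, Derivation.leibniz, ih, smul_zero, zero_add, tmon_nsmul,
          Derivation.leibniz_pow, partialT_tmon_single]
        split_ifs with hj
        · subst hj; simp [h]
        · simp
  exact this _

theorem partialT_tmon (α : Fin N → ℕ) (j : Fin N) :
    partialT N n j (tmon n α) = (α j : ℝ) • tmon n (Function.update α j (α j - 1)) := by
  have h0 : partialT N n j (tmon n (Function.update α j 0)) = 0 :=
    partialT_tmon_of_eq_zero _ _ (by simp)
  have h1 : Function.update α j (α j - 1) =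
      Function.update α j 0 + (α j - 1) • Pi.single j 1 := by
    conv_lhs => rw [eq_update_zero_add (Function.update α j (α j - 1)) j]
    simp
  rw [h1, tmon_add, tmon_nsmul]
  conv_lhs => rw [eq_update_zero_add α j, tmon_add, Derivation.leibniz, h0, smul_zero, add_zero,
    tmon_nsmul, Derivation.leibniz_pow, partialT_tmon_single, if_pos rfl]
  rw [smul_eq_mul, smul_eq_mul, mul_one, nsmul_eq_mul, Algebra.smul_def, map_natCast]
  ring

/-- The iterated derivative `∂_t^α` on germs. -/
noncomputable def iterPartialT (α : Fin N → ℕ) (φ : anGerm (Rn N × Rn n)) :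
    anGerm (Rn N × Rn n) :=
  (List.finRange N).foldr (fun j ψ => (partialT N n j)^[α j] ψ) φ

theorem iterPartialT_eq (α : Fin N → ℕ) (φ : anGerm (Rn N × Rn n)) :
    iterPartialT α φ =
      ((List.finRange N).map fun j =>
        ((partialT N n j : anGerm (Rn N × Rn n) →ₗ[ℝ] anGerm (Rn N × Rn n)) :
          Module.End ℝ (anGerm (Rn N × Rn n))) ^ α j).prod φ := by
  rw [iterPartialT]
  induction List.finRange N with
  | nil => rfl
  | cons j l ih =>
    rw [List.foldr_cons, List.map_cons, List.prod_cons, Module.End.mul_apply, ← ih,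
      Module.End.pow_apply]
    rfl

/-- Commuting factors can be collected in a product of powers. -/
theorem prod_map_pow_add_single {ι M : Type*} [DecidableEq ι] [Monoid M] (a : ι → M)
    (hc : ∀ i j, Commute (a i) (a j)) (β : ι → ℕ) (j : ι) (l : List ι) (hl : l.Nodup) :
    (l.map fun i => a i ^ (β + Pi.single j 1 : ι → ℕ) i).prod =
      (l.map fun i => a i ^ β i).prod * if j ∈ l then a j else 1 := by
  induction l with
  | nil => simp
  | cons k l ih =>
    rw [List.nodup_cons] at hl
    rw [List.map_cons, List.prod_cons, ih hl.2, List.map_cons, List.prod_cons]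
    by_cases hjk : j = k
    · subst hjk
      have : Commute (a j) (l.map fun i => a i ^ β i).prod :=
        Commute.list_prod_right _ _ fun x hx => by
          obtain ⟨i, _, rfl⟩ := List.mem_map.1 hx
          exact (hc j i).pow_right _
      simp only [hl.1, if_false, mul_one, Pi.add_apply, Pi.single_eq_same, pow_succ,
        List.mem_cons, true_or, if_true]
      rw [mul_assoc, this.eq, mul_assoc]
    · simp [Ne.symm hjk, hjk, mul_assoc]

theorem iterPartialT_partialT (β : Fin N → ℕ) (j : Fin N) (φ : anGerm (Rn N × Rn n)) :
    iterPartialT β (partialT N n j φ) = iterPartialT (β + Pi.single j 1) φ := by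
  rw [iterPartialT_eq, iterPartialT_eq, prod_map_pow_add_single _ _ _ _ _ (List.nodup_finRange N),
    if_pos (List.mem_finRange j)]
  · rfl
  · intro i k
    exact LinearMap.ext fun φ => dirDeriv_comm _ _ φ

theorem iterPartialT_zero (φ : anGerm (Rn N × Rn n)) : iterPartialT 0 φ = φ := by
  rw [iterPartialT_eq]
  simp

theorem iterPartialT_sub (β : Fin N → ℕ) (φ ψ : anGerm (Rn N × Rn n)) :
    iterPartialT β (φ - ψ) = iterPartialT β φ - iterPartialT β ψ := by
  simp only [iterPartialT_eq, map_sub]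

theorem iterPartialT_sum {ι : Type*} (s : Finset ι) (β : Fin N → ℕ)
    (φ : ι → anGerm (Rn N × Rn n)) :
    iterPartialT β (∑ i ∈ s, φ i) = ∑ i ∈ s, iterPartialT β (φ i) := by
  simp only [iterPartialT_eq, map_sum]

theorem partialT_iterate_tmon (j : Fin N) (m : ℕ) (α : Fin N → ℕ) (g : anGerm (Rn n)) :
    (partialT N n j)^[m] (tmon n α * ofX N n g) =
      ((α j).descFactorial m : ℝ) • (tmon n (Function.update α j (α j - m)) * ofX N n g) := by
  induction m with
  | zero => simp
  | succ m ih =>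
    rw [Function.iterate_succ_apply', ih, Derivation.map_smul, Derivation.leibniz, partialT_ofX,
      smul_zero, zero_add, partialT_tmon, Nat.descFactorial_succ]
    simp only [Function.update_self, Function.update_idem, smul_eq_mul, Algebra.smul_def,
      map_natCast, Nat.cast_mul, map_mul, Nat.sub_sub]
    ring

theorem foldr_partialT_tmon (β α : Fin N → ℕ) (g : anGerm (Rn n)) (l : List (Fin N))
    (hl : l.Nodup) :
    l.foldr (fun j ψ => (partialT N n j)^[β j] ψ) (tmon n α * ofX N n g) =
      ((l.map fun j => (α j).descFactorial (β j)).prod : ℝ) •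
        (tmon n (fun j => if j ∈ l then α j - β j else α j) * ofX N n g) := by
  induction l with
  | nil => simp
  | cons k l ih =>
    rw [List.nodup_cons] at hl
    rw [List.foldr_cons, ih hl.2]
    have h1 : ∀ (c : ℝ) (φ : anGerm (Rn N × Rn n)) (m : ℕ),
        (partialT N n k)^[m] (c • φ) = c • (partialT N n k)^[m] φ := fun c φ m => by
      induction m with
      | zero => rfl
      | succ m ih' => rw [Function.iterate_succ_apply', ih', Function.iterate_succ_apply',
          Derivation.map_smul]
    rw [h1, partialT_iterate_tmon, if_neg hl.1, smul_smul, List.map_cons, List.prod_cons]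
    congr 1
    · push_cast; ring
    · congr 2
      funext i
      by_cases hi : i = k
      · subst hi; simp
      · simp [hi]

theorem atZero_iterPartialT_tmon_mul (β α : Fin N → ℕ) (g : anGerm (Rn n)) :
    atZero N n (iterPartialT β (tmon n α * ofX N n g)) =
      if α = β then ((∏ j, (β j).factorial : ℕ) : ℝ) • g else 0 := by
  rw [iterPartialT, foldr_partialT_tmon _ _ _ _ (List.nodup_finRange N), map_smul, map_mul,
    atZero_ofX]
  simp only [List.mem_finRange, if_true]
  rw [← List.ofFn_eq_map, List.prod_ofFn]
  split_ifs with h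
  · subst h
    have h0 : (fun j => α j - α j) = 0 := funext fun j => Nat.sub_self _
    simp only [h0, tmon_zero, map_one, one_mul, Nat.descFactorial_self]
  · by_cases hle : ∀ j, β j ≤ α j
    · have hne : (fun j => α j - β j) ≠ 0 := fun h0 => h (funext fun j =>
        le_antisymm (Nat.sub_eq_zero_iff_le.1 (congrFun h0 j)) (hle j))
      rw [atZero_tmon hne, zero_mul, smul_zero]
    · push Not at hle
      obtain ⟨j, hj⟩ := hle
      rw [Finset.prod_eq_zero (Finset.mem_univ j) (Nat.descFactorial_of_lt hj), Nat.cast_zero,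
        zero_smul]

/-- A germ that vanishes at `t = 0` and whose derivatives in `t` are `O(|t|^K)` is
`O(|t|^(K+1))`, by the mean value inequality on the segment from `(0,x)` to `(t,x)`. -/
theorem mem_vanishIdeal_succ {K : ℕ} {φ : anGerm (Rn N × Rn n)} (h0 : atZero N n φ = 0)
    (h : ∀ j, partialT N n j φ ∈ vanishIdeal (Rn N) (Rn n) K) :
    φ ∈ vanishIdeal (Rn N) (Rn n) (K + 1) := by
  have ha := analyticAt_rep φ
  have hz : ∀ᶠ x in 𝓝 (0 : Rn n), rep φ (0, x) = 0 := by
    have h1 : AnalyticAt ℝ (fun x : Rn n => rep φ ((0 : Rn N), x)) 0 :=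
      ha.comp_of_eq (analyticAt_const.prod analyticAt_id) rfl
    have h2 := rep_germ h1
    have h3 : germ (fun x : Rn n => rep φ ((0 : Rn N), x)) = 0 := h0
    rw [h3] at h2
    filter_upwards [h2, rep_zero (E := Rn n)] with x h4 h5
    rw [← h4, h5]
  have hd : ∀ j, ∃ C, ∀ᶠ p in 𝓝 (0 : Rn N × Rn n),
      |fderiv ℝ (rep φ) p (EuclideanSpace.single j (1 : ℝ), 0)| ≤ C * ‖p.1‖ ^ K := fun j =>
    (germ_mem_vanishIdeal (analyticAt_fderiv_apply ha _)).1 (h j)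
  choose C hC using hd
  have hz' : ∀ᶠ p in 𝓝 (0 : Rn N × Rn n), rep φ (0, p.2) = 0 :=
    (continuous_snd.tendsto (0 : Rn N × Rn n)).eventually hz
  obtain ⟨r, hr, H⟩ := Metric.eventually_nhds_iff_ball.1
    ((Filter.eventually_all.2 hC).and (hz'.and ha.eventually_analyticAt))
  refine ⟨∑ j, |C j|, ?_⟩
  filter_upwards [Metric.ball_mem_nhds (0 : Rn N × Rn n) hr] with p hp
  have hb : ∀ s ∈ Set.Icc (0 : ℝ) 1, (s • p.1, p.2) ∈ Metric.ball (0 : Rn N × Rn n) r := by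
    intro s hs
    rw [mem_ball_zero_iff, Prod.norm_def] at hp ⊢
    refine max_lt ?_ ((le_max_right _ _).trans_lt hp)
    refine lt_of_le_of_lt ?_ ((le_max_left _ _).trans_lt hp)
    change ‖s • p.1‖ ≤ _
    rw [norm_smul, Real.norm_eq_abs, abs_of_nonneg hs.1]
    exact mul_le_of_le_one_left (norm_nonneg _) hs.2
  have hderiv : ∀ s ∈ Set.Icc (0 : ℝ) 1, HasDerivAt (fun s : ℝ => rep φ (s • p.1, p.2))
      (fderiv ℝ (rep φ) (s • p.1, p.2) (p.1, 0)) s := by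
    intro s hs
    have hl : HasDerivAt (fun s : ℝ => (s • p.1, p.2)) (p.1, (0 : Rn n)) s := by
      simpa using ((hasDerivAt_id s).smul_const p.1).prodMk (hasDerivAt_const s p.2)
    exact (H _ (hb s hs)).2.2.differentiableAt.hasFDerivAt.comp_hasDerivAt s hl
  have hbound : ∀ s ∈ Set.Icc (0 : ℝ) 1,
      ‖fderiv ℝ (rep φ) (s • p.1, p.2) (p.1, 0)‖ ≤ (∑ j, |C j|) * ‖p.1‖ ^ (K + 1) := by
    intro s hs
    have hsum : (p.1, (0 : Rn n)) =
        ∑ j, p.1 j • ((EuclideanSpace.single j (1 : ℝ) : Rn N), (0 : Rn n)) := by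
      refine Prod.ext ?_ ?_
      · rw [Prod.fst_sum]
        ext k
        simp [Finset.sum_apply, Pi.single_apply]
      · rw [Prod.snd_sum]
        simp
    rw [hsum, map_sum, Finset.sum_mul]
    refine (norm_sum_le _ _).trans (Finset.sum_le_sum fun j _ => ?_)
    rw [map_smul, norm_smul, Real.norm_eq_abs, Real.norm_eq_abs, pow_succ', ← mul_assoc,
      mul_comm |C j|, mul_assoc]
    refine mul_le_mul (PiLp.norm_apply_le p.1 j) (((H _ (hb s hs)).1 j).trans ?_) (abs_nonneg _)
      (norm_nonneg _)
    refine mul_le_mul (le_abs_self _) (pow_le_pow_left₀ (norm_nonneg _) ?_ _)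
      (by positivity) (abs_nonneg _)
    change ‖s • p.1‖ ≤ _
    rw [norm_smul, Real.norm_eq_abs, abs_of_nonneg hs.1]
    exact mul_le_of_le_one_left (norm_nonneg _) hs.2
  have := norm_image_sub_le_of_norm_deriv_le_segment_01'
    (fun s hs => (hderiv s hs).hasDerivWithinAt)
    (fun s hs => hbound s (Set.Ico_subset_Icc_self hs))
  rw [zero_smul, one_smul, (H p hp).2.1, sub_zero] at this
  exact this

/-- A germ all of whose derivatives in `t` of order less than `K` vanish at `t = 0` is
`O(|t|^K)`. -/
theorem mem_vanishIdeal_of_iterPartialT (K : ℕ) (φ : anGerm (Rn N × Rn n))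
    (h : ∀ β : Fin N → ℕ, ∑ j, β j < K → atZero N n (iterPartialT β φ) = 0) :
    φ ∈ vanishIdeal (Rn N) (Rn n) K := by
  induction K generalizing φ with
  | zero => exact mem_vanishIdeal_zero φ
  | succ K ih =>
    refine mem_vanishIdeal_succ ?_ fun j => ih _ fun β hβ => ?_
    · have := h 0 (by simp)
      rwa [iterPartialT_zero] at this
    · rw [iterPartialT_partialT]
      refine h _ ?_
      simpa [Finset.sum_add_distrib] using hβ

/-- The Taylor coefficient `(1/α!) ∂_t^α φ` at `t = 0`. -/
noncomputable def taylorCoeff (α : Fin N → ℕ) (φ : anGerm (Rn N × Rn n)) : anGerm (Rn n) :=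
  ((∏ j, (α j).factorial : ℕ) : ℝ)⁻¹ • atZero N n (iterPartialT α φ)

/-- Taylor's theorem in the variable `t`. -/
theorem sub_taylor_mem_vanishIdeal (K : ℕ) (φ : anGerm (Rn N × Rn n)) :
    φ - ∑ k ∈ Finset.range K, ∑ α ∈ Finset.piAntidiag (Finset.univ : Finset (Fin N)) k,
      tmon n α * ofX N n (taylorCoeff α φ) ∈ vanishIdeal (Rn N) (Rn n) K := by
  refine mem_vanishIdeal_of_iterPartialT K _ fun β hβ => ?_
  have hf : ((∏ j, (β j).factorial : ℕ) : ℝ) ≠ 0 :=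
    Nat.cast_ne_zero.2 (Finset.prod_ne_zero_iff.2 fun j _ => Nat.factorial_ne_zero _)
  simp only [iterPartialT_sub, iterPartialT_sum, map_sub, map_sum, atZero_iterPartialT_tmon_mul]
  rw [Finset.sum_eq_single (∑ j, β j), Finset.sum_eq_single β, if_pos rfl, taylorCoeff,
    smul_inv_smul₀ hf, sub_self]
  · exact fun α _ hα => if_neg hα
  · exact fun h => absurd (Finset.mem_piAntidiag.2 ⟨rfl, fun j _ => Finset.mem_univ j⟩) h
  · intro k _ hk
    refine Finset.sum_eq_zero fun α hα => if_neg ?_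
    rintro rfl
    exact hk (Finset.mem_piAntidiag.1 hα).1.symm
  · exact fun h => absurd (Finset.mem_range.2 hβ) h

end

end Radon

namespace Radon

section

variable {E F : Type*} [NormedAddCommGroup E] [NormedSpace ℝ E]
  [NormedAddCommGroup F] [NormedSpace ℝ F] {N n : ℕ}

/-! ### Taylor coefficients of parameter dependent vector fields -/

/-- The iterated partial derivatives of `W` in `t` are, near the origin, an analytic function whose
coordinate germs are given by the corresponding derivations of germs. -/
theorem exists_foldr_lineDeriv_eq {W : Rn N → Rn n → Rn n}
    (hW : AnalyticAt ℝ (fun p : Rn N × Rn n => W p.1 p.2) 0) (α : Fin N → ℕ) :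
    ∃ f : Rn N × Rn n → Rn n, AnalyticAt ℝ f 0 ∧
      (∀ᶠ p in 𝓝 (0 : Rn N × Rn n), iteratedPartial α (fun t => W t p.2) p.1 = f p) ∧
      ∀ i, germ (fun p => f p i) =
        iterPartialT α (germ fun p : Rn N × Rn n => W p.1 p.2 i) := by
  -- one derivative
  have step : ∀ (j : Fin N) (h : Rn n → Rn N → Rn n) (f : Rn N × Rn n → Rn n)
      (φ : Fin n → anGerm (Rn N × Rn n)), AnalyticAt ℝ f 0 → (∀ᶠ p in 𝓝 0, h p.2 p.1 = f p) →
      (∀ i, germ (fun p => f p i) = φ i) → ∃ f' : Rn N × Rn n → Rn n, AnalyticAt ℝ f' 0 ∧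
      (∀ᶠ p in 𝓝 (0 : Rn N × Rn n),
        lineDeriv ℝ (h p.2) p.1 (EuclideanSpace.single j (1 : ℝ)) = f' p) ∧
      ∀ i, germ (fun p => f' p i) = partialT N n j (φ i) := by
    intro j h f φ hf hh hφ
    refine ⟨fun p => fderiv ℝ f p (EuclideanSpace.single j (1 : ℝ), 0),
      analyticAt_fderiv_apply hf _, ?_, fun i => ?_⟩
    · filter_upwards [hh.eventually_nhds, hf.eventually_analyticAt] with p hp hfp
      have ht : Filter.Tendsto (fun t : Rn N => (t, p.2)) (𝓝 p.1) (𝓝 p) :=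
        (Continuous.prodMk_left p.2).tendsto p.1
      have he : h p.2 =ᶠ[𝓝 p.1] fun t => f (t, p.2) := ht.eventually hp
      rw [he.lineDeriv_eq]
      have hd : HasFDerivAt (fun t => f (t, p.2))
          ((fderiv ℝ f p).comp (ContinuousLinearMap.inl ℝ (Rn N) (Rn n))) p.1 :=
        HasFDerivAt.comp (g := f) p.1 hfp.differentiableAt.hasFDerivAt
          (hasFDerivAt_prodMk_left p.1 p.2)
      exact (hd.hasLineDerivAt _).lineDeriv
    · rw [← hφ i, partialT, dirDeriv_germ _ (analyticAt_coord hf i)]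
      refine germ_congr (analyticAt_fderiv_apply (analyticAt_coord hf i) _) ?_
      filter_upwards [hf.eventually_analyticAt] with p hfp
      have := ((EuclideanSpace.proj (𝕜 := ℝ) (ι := Fin n) i).hasFDerivAt.comp p
        hfp.differentiableAt.hasFDerivAt).fderiv
      exact (congrArg (fun L : Rn N × Rn n →L[ℝ] ℝ =>
        L (EuclideanSpace.single j (1 : ℝ), 0)) this).symm
  suffices H : ∀ l : List (Fin N), ∃ f : Rn N × Rn n → Rn n, AnalyticAt ℝ f 0 ∧
      (∀ᶠ p in 𝓝 (0 : Rn N × Rn n), l.foldr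
        (fun j g => (fun h t => lineDeriv ℝ h t (EuclideanSpace.single j (1 : ℝ)))^[α j] g)
          (fun t => W t p.2) p.1 = f p) ∧
      ∀ i, germ (fun p => f p i) = l.foldr (fun j ψ => (partialT N n j)^[α j] ψ)
        (germ fun p : Rn N × Rn n => W p.1 p.2 i) from H _
  intro l
  induction l with
  | nil => exact ⟨_, hW, Filter.Eventually.of_forall fun _ => rfl, fun _ => rfl⟩
  | cons j l ih =>
    obtain ⟨f, hf, h1, h2⟩ := ih
    simp only [List.foldr_cons]
    generalize α j = m
    induction m with
    | zero => exact ⟨f, hf, h1, h2⟩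
    | succ m ihm =>
      obtain ⟨f', hf', h1', h2'⟩ := ihm
      simp only [Function.iterate_succ_apply']
      exact step j (fun x => (fun h t => lineDeriv ℝ h t (EuclideanSpace.single j (1 : ℝ)))^[m]
        (l.foldr (fun j g => (fun h t => lineDeriv ℝ h t (EuclideanSpace.single j (1 : ℝ)))^[α j] g)
          (fun t => W t x))) f' _ hf' h1' h2'

theorem analyticAt_taylorField {W : Rn N → Rn n → Rn n}
    (hW : AnalyticAt ℝ (fun p : Rn N × Rn n => W p.1 p.2) 0) (α : Fin N → ℕ) :
    AnalyticAt ℝ (taylorField W α) 0 ∧ ∀ i, germ (fun x => taylorField W α x i) =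
      taylorCoeff α (germ fun p : Rn N × Rn n => W p.1 p.2 i) := by
  obtain ⟨f, hf, h1, h2⟩ := exists_foldr_lineDeriv_eq hW α
  have ht : Filter.Tendsto (fun x : Rn n => ((0 : Rn N), x)) (𝓝 0) (𝓝 0) :=
    (Continuous.prodMk_right (0 : Rn N)).tendsto 0
  have hf0 : AnalyticAt ℝ (fun x : Rn n => f ((0 : Rn N), x)) 0 :=
    hf.comp_of_eq (analyticAt_const.prod analyticAt_id) rfl
  set c : ℝ := ((∏ j, (α j).factorial : ℕ) : ℝ)⁻¹ with hc
  have he : taylorField W α =ᶠ[𝓝 0] fun x => c • f (0, x) := by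
    filter_upwards [ht.eventually h1] with x hx
    simp only [taylorField, ← hc]
    rw [hx]
  have ha : AnalyticAt ℝ (fun x : Rn n => c • f ((0 : Rn N), x)) 0 := analyticAt_const.fun_smul hf0
  refine ⟨ha.congr he.symm, fun i => ?_⟩
  rw [taylorCoeff, ← h2 i, atZero_germ (analyticAt_coord hf i), ← hc,
    ← germ_smul c (analyticAt_coord hf0 i)]
  exact germ_congr (analyticAt_coord ha i) (he.mono fun _ hx => congrArg (· i) hx)

theorem norm_le_of_vecGerm_mem {V : E × F → Rn n} (hV : AnalyticAt ℝ V 0) {K : ℕ}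
    (h : ∀ i, vecGerm V i ∈ vanishIdeal E F K) :
    ∃ C, ∀ᶠ p in 𝓝 (0 : E × F), ‖V p‖ ≤ C * ‖p.1‖ ^ K := by
  choose C hC using fun i => (germ_mem_vanishIdeal (analyticAt_coord hV i)).1 (h i)
  refine ⟨∑ i, C i, ?_⟩
  filter_upwards [Filter.eventually_all.2 hC] with p hp
  have : V p = ∑ i, EuclideanSpace.single i (V p i) := by
    ext k
    simp [Finset.sum_apply, Pi.single_apply]
  rw [this, Finset.sum_mul]
  refine (norm_sum_le _ _).trans (Finset.sum_le_sum fun i _ => ?_)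
  rw [PiLp.norm_single]
  exact hp i

/-- The partial sums of an expansion in vector fields `X_α`, as germs. -/
noncomputable def truncGerm (X : (Fin N → ℕ) → Rn n → Rn n) (K : ℕ) (i : Fin n) :
    anGerm (Rn N × Rn n) :=
  ∑ k ∈ Finset.Ico 1 K, ∑ α ∈ Finset.piAntidiag (Finset.univ : Finset (Fin N)) k,
    tmon n α * ofX N n (germ fun x => X α x i)

theorem ne_zero_of_mem_piAntidiag {k : ℕ} (hk : 1 ≤ k) {α : Fin N → ℕ}
    (hα : α ∈ Finset.piAntidiag Finset.univ k) : α ≠ 0 := by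
  rintro rfl
  have := (Finset.mem_piAntidiag.1 hα).1
  simp at this
  omega

theorem analyticAt_truncated {X : (Fin N → ℕ) → Rn n → Rn n}
    (hX : ∀ α, α ≠ 0 → AnalyticAt ℝ (X α) 0) (K : ℕ) :
    AnalyticAt ℝ (fun p : Rn N × Rn n => truncated X K p.1 p.2) 0 := by
  refine Finset.analyticAt_fun_sum _ fun k hk => Finset.analyticAt_fun_sum _ fun α hα => ?_
  exact analyticAt_monomial_smul α
    (hX α (ne_zero_of_mem_piAntidiag (Finset.mem_Ico.1 hk).1 hα))

theorem vecGerm_sum {ι : Type*} (s : Finset ι) {V : ι → E → Rn n}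
    (hV : ∀ k ∈ s, AnalyticAt ℝ (V k) 0) :
    vecGerm (fun p => ∑ k ∈ s, V k p) = ∑ k ∈ s, vecGerm (V k) := by
  classical
  induction s using Finset.induction_on with
  | empty => simpa using vecGerm_zero
  | insert a s ha ih =>
    have h1 : ∀ k ∈ s, AnalyticAt ℝ (V k) 0 := fun k hk => hV k (Finset.mem_insert_of_mem hk)
    simp only [Finset.sum_insert ha]
    rw [vecGerm_add (hV a (Finset.mem_insert_self _ _)) (Finset.analyticAt_fun_sum _ h1), ih h1]

theorem vecGerm_truncated {X : (Fin N → ℕ) → Rn n → Rn n}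
    (hX : ∀ α, α ≠ 0 → AnalyticAt ℝ (X α) 0) (K : ℕ) :
    vecGerm (fun p : Rn N × Rn n => truncated X K p.1 p.2) = truncGerm X K := by
  have h1 : ∀ k ∈ Finset.Ico 1 K, ∀ α ∈ Finset.piAntidiag (Finset.univ : Finset (Fin N)) k,
      AnalyticAt ℝ (fun p : Rn N × Rn n => monomial p.1 α • X α p.2) 0 := fun k hk α hα =>
    analyticAt_monomial_smul α (hX α (ne_zero_of_mem_piAntidiag (Finset.mem_Ico.1 hk).1 hα))
  simp only [truncated]
  rw [vecGerm_sum _ fun k hk => Finset.analyticAt_fun_sum _ (h1 k hk)]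
  funext i
  rw [Finset.sum_apply, truncGerm]
  refine Finset.sum_congr rfl fun k hk => ?_
  rw [vecGerm_sum _ (h1 k hk), Finset.sum_apply]
  refine Finset.sum_congr rfl fun α hα => ?_
  have hXα := hX α (ne_zero_of_mem_piAntidiag (Finset.mem_Ico.1 hk).1 hα)
  have h2 : AnalyticAt ℝ (fun p : Rn N × Rn n => X α p.2) 0 := hXα.comp_of_eq analyticAt_snd rfl
  rw [vecGerm_smul (f := fun p : Rn N × Rn n => monomial p.1 α) (analyticAt_monomial_fst α) h2,
    ofX_germ (analyticAt_coord hXα i)]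
  rfl

/-! ### The vector field `W` -/

/-- The analytic inverse of `γ_t`, from the inverse function theorem for `(t, x) ↦ (t, γ_t x)`. -/
theorem exists_analyticAt_isLocalInverse {γ : Rn N → Rn n → Rn n}
    (hγ : AnalyticAt ℝ (fun p : Rn N × Rn n => γ p.1 p.2) 0)
    (hγ₀ : ∀ᶠ x in 𝓝 (0 : Rn n), γ 0 x = x) :
    ∃ g : Rn N × Rn n → Rn n, AnalyticAt ℝ g 0 ∧ g 0 = 0 ∧
      ∀ᶠ p in 𝓝 (0 : Rn N × Rn n), γ p.1 (g p) = p.2 := by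
  have h00 : γ 0 0 = 0 := hγ₀.self_of_nhds
  let Γ : Rn N × Rn n → Rn N × Rn n := fun p => (p.1, γ p.1 p.2)
  have hΓ : AnalyticAt ℝ Γ 0 := analyticAt_fst.prod hγ
  have hΓ0 : Γ 0 = 0 := Prod.ext rfl h00
  have hL : ∀ w, fderiv ℝ Γ 0 w = (w.1, fderiv ℝ (fun p : Rn N × Rn n => γ p.1 p.2) 0 w) := by
    intro w
    have : fderiv ℝ Γ 0 = _ :=
      (hasFDerivAt_fst.prodMk hγ.differentiableAt.hasFDerivAt).fderiv
    rw [this]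
    rfl
  have hL2 : ∀ v : Rn n, fderiv ℝ (fun p : Rn N × Rn n => γ p.1 p.2) 0 (0, v) = v := by
    have h1 : HasFDerivAt (fun x : Rn n => ((0 : Rn N), x))
        (ContinuousLinearMap.inr ℝ (Rn N) (Rn n)) (0 : Rn n) :=
      (ContinuousLinearMap.inr ℝ (Rn N) (Rn n)).hasFDerivAt
    have h2 := HasFDerivAt.comp (0 : Rn n) (g := fun p : Rn N × Rn n => γ p.1 p.2)
      hγ.differentiableAt.hasFDerivAt h1
    have h4 := h2.unique ((hasFDerivAt_id (0 : Rn n)).congr_of_eventuallyEq hγ₀)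
    intro v
    exact congrArg (fun A : Rn n →L[ℝ] Rn n => A v) h4
  have hinj : Function.Injective (fderiv ℝ Γ 0 : Rn N × Rn n →ₗ[ℝ] Rn N × Rn n) := by
    refine (injective_iff_map_eq_zero _).2 fun w hw => ?_
    have hw' : fderiv ℝ Γ 0 w = 0 := hw
    rw [hL] at hw'
    obtain ⟨t, v⟩ := w
    obtain rfl : t = 0 := congrArg Prod.fst hw'
    have := congrArg Prod.snd hw'
    rw [hL2] at this
    exact Prod.ext rfl this
  let i : (Rn N × Rn n) ≃L[ℝ] (Rn N × Rn n) :=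
    (LinearEquiv.ofInjectiveEndo _ hinj).toContinuousLinearEquiv
  have hi : fderiv ℝ Γ 0 = i := ContinuousLinearMap.ext fun w => rfl
  have hs : HasStrictFDerivAt Γ (i : (Rn N × Rn n) →L[ℝ] (Rn N × Rn n)) 0 := by
    rw [← hi]; exact hΓ.hasStrictFDerivAt
  let P := hs.toOpenPartialHomeomorph Γ
  have hP : AnalyticAt ℝ P.symm (Γ 0) :=
    P.analyticAt_symm' hs.mem_toOpenPartialHomeomorph_source hΓ hi
  rw [hΓ0] at hP
  have hP0 : P.symm 0 = 0 := by
    have := P.left_inv hs.mem_toOpenPartialHomeomorph_source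
    change P.symm (Γ 0) = 0 at this
    rwa [hΓ0] at this
  refine ⟨fun p => (P.symm p).2, analyticAt_snd.comp hP, congrArg Prod.snd hP0, ?_⟩
  have hr : ∀ᶠ p in 𝓝 (Γ 0), Γ (P.symm p) = p := hs.eventually_right_inverse
  rw [hΓ0] at hr
  filter_upwards [hr] with p hp
  have h1 : (Γ (P.symm p)).1 = p.1 := congrArg Prod.fst hp
  change (P.symm p).1 = p.1 at h1
  have h2 := congrArg Prod.snd hp
  change γ (P.symm p).1 (P.symm p).2 = p.2 at h2
  rwa [h1] at h2

variable {γ : Rn N → Rn n → Rn n}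

theorem isLocalInverse_localInverse
    (hγ : AnalyticAt ℝ (fun p : Rn N × Rn n => γ p.1 p.2) 0)
    (hγ₀ : ∀ᶠ x in 𝓝 (0 : Rn n), γ 0 x = x) : IsLocalInverse γ (localInverse γ) :=
  Classical.epsilon_spec (exists_isLocalInverse γ hγ hγ₀)

theorem analyticAt_localInverse (hγ : AnalyticAt ℝ (fun p : Rn N × Rn n => γ p.1 p.2) 0)
    (hγ₀ : ∀ᶠ x in 𝓝 (0 : Rn n), γ 0 x = x) :
    AnalyticAt ℝ (fun p : Rn N × Rn n => localInverse γ p.1 p.2) 0 ∧ localInverse γ 0 0 = 0 := by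
  obtain ⟨g, hg, hg0, h⟩ := exists_analyticAt_isLocalInverse hγ hγ₀
  have hl := isLocalInverse_localInverse hγ hγ₀
  have ht : Filter.Tendsto (fun p : Rn N × Rn n => (p.1, g p)) (𝓝 0) (𝓝 (0, 0)) := by
    have := (analyticAt_fst (𝕜 := ℝ) (p := (0 : Rn N × Rn n))).prod hg |>.continuousAt.tendsto
    simpa [hg0] using this
  have he : (fun p : Rn N × Rn n => localInverse γ p.1 p.2) =ᶠ[𝓝 0] g := by
    filter_upwards [h, ht.eventually hl] with p h1 h2
    have := h2.2
    simp only [h1] at this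
    exact this
  exact ⟨hg.congr he.symm, he.self_of_nhds.trans hg0⟩

theorem tendsto_shear (hγ : AnalyticAt ℝ (fun p : Rn N × Rn n => γ p.1 p.2) 0)
    (hγ₀ : ∀ᶠ x in 𝓝 (0 : Rn n), γ 0 x = x) :
    Filter.Tendsto (fun p : Rn N × Rn n => (p.1, γ p.1 p.2)) (𝓝 0) (𝓝 0) := by
  have h00 : γ 0 0 = 0 := hγ₀.self_of_nhds
  have := (analyticAt_fst (𝕜 := ℝ) (p := (0 : Rn N × Rn n))).prod hγ |>.continuousAt.tendsto
  rw [Prod.fst_zero, Prod.snd_zero, h00] at this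
  exact this

theorem tendsto_shear_localInverse (hγ : AnalyticAt ℝ (fun p : Rn N × Rn n => γ p.1 p.2) 0)
    (hγ₀ : ∀ᶠ x in 𝓝 (0 : Rn n), γ 0 x = x) :
    Filter.Tendsto (fun p : Rn N × Rn n => (p.1, localInverse γ p.1 p.2)) (𝓝 0) (𝓝 0) := by
  obtain ⟨hg, hg0⟩ := analyticAt_localInverse hγ hγ₀
  have := (analyticAt_fst (𝕜 := ℝ) (p := (0 : Rn N × Rn n))).prod hg |>.continuousAt.tendsto
  rw [Prod.fst_zero, Prod.snd_zero, hg0] at this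
  exact this

theorem fieldW_eventuallyEq (hγ : AnalyticAt ℝ (fun p : Rn N × Rn n => γ p.1 p.2) 0)
    (hγ₀ : ∀ᶠ x in 𝓝 (0 : Rn n), γ 0 x = x) :
    (fun p : Rn N × Rn n => fieldW γ p.1 p.2) =ᶠ[𝓝 0] fun p =>
      fderiv ℝ (fun p : Rn N × Rn n => γ p.1 p.2) (p.1, localInverse γ p.1 p.2) (p.1, 0) := by
  filter_upwards [(tendsto_shear_localInverse hγ hγ₀).eventually hγ.eventually_analyticAt]
    with p hp
  have hl : HasDerivAt (fun ε : ℝ => (ε • p.1, localInverse γ p.1 p.2)) (p.1, (0 : Rn n)) 1 := by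
    simpa using ((hasDerivAt_id (1 : ℝ)).smul_const p.1).prodMk
      (hasDerivAt_const (1 : ℝ) (localInverse γ p.1 p.2))
  have hd : HasFDerivAt (fun p : Rn N × Rn n => γ p.1 p.2)
      (fderiv ℝ (fun p : Rn N × Rn n => γ p.1 p.2) (p.1, localInverse γ p.1 p.2))
      ((1 : ℝ) • p.1, localInverse γ p.1 p.2) := by
    rw [one_smul]; exact hp.differentiableAt.hasFDerivAt
  exact (hd.comp_hasDerivAt (1 : ℝ) hl).deriv

theorem analyticAt_fieldW (hγ : AnalyticAt ℝ (fun p : Rn N × Rn n => γ p.1 p.2) 0)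
    (hγ₀ : ∀ᶠ x in 𝓝 (0 : Rn n), γ 0 x = x) :
    AnalyticAt ℝ (fun p : Rn N × Rn n => fieldW γ p.1 p.2) 0 := by
  obtain ⟨hg, hg0⟩ := analyticAt_localInverse hγ hγ₀
  refine AnalyticAt.congr ?_ (fieldW_eventuallyEq hγ hγ₀).symm
  refine analyticAt_clm_apply ?_ (analyticAt_fst.prod analyticAt_const)
  exact hγ.fderiv.comp_of_eq (f := fun p : Rn N × Rn n => (p.1, localInverse γ p.1 p.2))
    (analyticAt_fst.prod hg) (Prod.ext rfl hg0)

/-- The differential equation `W(t, γ_t(x)) = (t ⋅ ∂_t) γ_t(x)` that characterizes `W`. -/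
theorem fieldW_comp (hγ : AnalyticAt ℝ (fun p : Rn N × Rn n => γ p.1 p.2) 0)
    (hγ₀ : ∀ᶠ x in 𝓝 (0 : Rn n), γ 0 x = x) :
    ∀ᶠ p in 𝓝 (0 : Rn N × Rn n), fieldW γ p.1 (γ p.1 p.2) =
      fderiv ℝ (fun p : Rn N × Rn n => γ p.1 p.2) p (p.1, 0) := by
  filter_upwards [(tendsto_shear hγ hγ₀).eventually (fieldW_eventuallyEq hγ hγ₀),
    isLocalInverse_localInverse hγ hγ₀] with p h1 h2
  refine h1.trans ?_
  simp only [h2.2]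

theorem fieldW_zero (γ : Rn N → Rn n → Rn n) (x : Rn n) : fieldW γ 0 x = 0 := by
  simp [fieldW]

/-! ### The finite type condition for the Taylor coefficients of `W` -/

theorem truncated_mem_gradedSpan {ν : ℕ} (e : Fin N → Fin ν → ℕ)
    (X : (Fin N → ℕ) → Rn n → Rn n) (K : ℕ) :
    (fun p : Rn N × Rn n => truncated X K p.1 p.2) ∈
      gradedSpan e {Z : FormalField n ν | ∃ α, α ≠ 0 ∧ Z = (X α, deg e α)} := by
  have : (fun p : Rn N × Rn n => truncated X K p.1 p.2) =
      ∑ k ∈ Finset.Ico 1 K, ∑ α ∈ Finset.piAntidiag (Finset.univ : Finset (Fin N)) k,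
        fun p : Rn N × Rn n => monomial p.1 α • X α p.2 := by
    funext p
    simp [truncated, Finset.sum_apply]
  rw [this]
  refine sum_mem fun k hk => sum_mem fun α hα => Submodule.subset_span ⟨α, X α, ?_, rfl⟩
  exact .base _ ⟨α, ne_zero_of_mem_piAntidiag (Finset.mem_Ico.1 hk).1 hα, rfl⟩

/-- For the Taylor coefficients of `W` the approximation required by `finiteType_of_approx` is the
Taylor expansion in `t`. -/
theorem finiteType_taylorField {ν : ℕ} (e : Fin N → Fin ν → ℕ) {W : Rn N → Rn n → Rn n}
    (hW : AnalyticAt ℝ (fun p : Rn N × Rn n => W p.1 p.2) 0) (hW0 : ∀ x, W 0 x = 0) :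
    FiniteType e W (taylorField W) := by
  have hX : ∀ α, α ≠ 0 → AnalyticAt ℝ (taylorField W α) 0 := fun α _ =>
    (analyticAt_taylorField hW α).1
  refine finiteType_of_approx hX hW fun K => ⟨_, truncated_mem_gradedSpan e (taylorField W) K, ?_⟩
  have hT := analyticAt_truncated hX K
  refine norm_le_of_vecGerm_mem (hW.sub hT) fun i => ?_
  have h1 : vecGerm (fun p : Rn N × Rn n => W p.1 p.2 - truncated (taylorField W) K p.1 p.2) i =
      germ (fun p : Rn N × Rn n => W p.1 p.2 i) - truncGerm (taylorField W) K i := by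
    rw [← vecGerm_truncated hX K]
    exact germ_sub (analyticAt_coord hW i) (analyticAt_coord hT i)
  refine (congrArg (· ∈ vanishIdeal (Rn N) (Rn n) K) h1).mpr ?_
  have h2 := sub_taylor_mem_vanishIdeal K (germ (fun p : Rn N × Rn n => W p.1 p.2 i))
  rcases Nat.eq_zero_or_pos K with rfl | hK
  · exact mem_vanishIdeal_zero _
  rw [Finset.range_eq_Ico, Finset.sum_eq_sum_Ico_succ_bot hK] at h2
  have h3 : ∑ α ∈ Finset.piAntidiag (Finset.univ : Finset (Fin N)) 0, tmon n α * ofX N n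
      (taylorCoeff α (germ fun p : Rn N × Rn n => W p.1 p.2 i)) = 0 := by
    rw [Finset.piAntidiag_zero, Finset.sum_singleton, taylorCoeff, iterPartialT_zero,
      atZero_germ (analyticAt_coord hW i)]
    simp only [hW0]
    have : germ (fun _ : Rn n => (0 : Rn n) i) = 0 := (germ_const 0).trans (map_zero _)
    rw [this, smul_zero, map_zero, mul_zero]
  rw [h3, zero_add] at h2
  simpa only [truncGerm, (analyticAt_taylorField hW _).2] using h2

end

end Radon

namespace Radon

/-! ### Truncated exponentials of endomorphisms -/

section

variable {R : Type*} [Ring R] [Algebra ℝ R]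

/-- The truncated exponential `∑_{k < K} a ^ k / k!`. -/
noncomputable def expTrunc (K : ℕ) (a : R) : R :=
  ∑ k ∈ Finset.range K, ((k.factorial : ℝ)⁻¹) • a ^ k

/-- The iterated commutator `[… [[e, a], a] …, a]` with `j` brackets. -/
def iterComm (a e : R) : ℕ → R
  | 0 => e
  | j + 1 => iterComm a e j * a - a * iterComm a e j

/-- Right multiplication by `a` is the sum of the commuting operators of left multiplication by `a`
and of the commutator with `a`, so the binomial theorem applies to its powers. -/
theorem mul_pow_eq_sum_iterComm (a e : R) (k : ℕ) :
    e * a ^ k = ∑ m ∈ Finset.HasAntidiagonal.antidiagonal k,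
      k.choose m.1 • (a ^ m.1 * iterComm a e m.2) := by
  have hc : Commute (LinearMap.mulLeft ℝ a) (LinearMap.mulRight ℝ a - LinearMap.mulLeft ℝ a) :=
    (LinearMap.commute_mulLeft_right (R := ℝ) a a).sub_right (Commute.refl _)
  have hp := hc.add_pow' k
  rw [add_sub_cancel] at hp
  have had : ∀ j, ((LinearMap.mulRight ℝ a - LinearMap.mulLeft ℝ a) ^ j) e = iterComm a e j := by
    intro j
    induction j with
    | zero => rfl
    | succ j ih =>
      rw [pow_succ', Module.End.mul_apply, ih]
      rfl
  have := congrArg (fun T : Module.End ℝ R => T e) hp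
  simp only [LinearMap.pow_mulRight, LinearMap.mulRight_apply, LinearMap.sum_apply,
    LinearMap.smul_apply, Module.End.mul_apply, had, LinearMap.pow_mulLeft,
    LinearMap.mulLeft_apply] at this
  exact this

theorem mul_expTrunc (a e : R) (K : ℕ) :
    e * expTrunc K a = ∑ k ∈ Finset.range K, ∑ m ∈ Finset.HasAntidiagonal.antidiagonal k,
      (((m.1.factorial : ℝ)⁻¹) • a ^ m.1) * (((m.2.factorial : ℝ)⁻¹) • iterComm a e m.2) := by
  rw [expTrunc, Finset.mul_sum]
  refine Finset.sum_congr rfl fun k _ => ?_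
  rw [mul_smul_comm, mul_pow_eq_sum_iterComm, Finset.smul_sum]
  refine Finset.sum_congr rfl fun m hm => ?_
  rw [Finset.HasAntidiagonal.mem_antidiagonal] at hm
  rw [smul_mul_smul_comm, ← Nat.cast_smul_eq_nsmul ℝ, smul_smul]
  congr 1
  rw [← hm, Nat.cast_add_choose]
  have h1 : ((m.1 + m.2).factorial : ℝ) ≠ 0 := Nat.cast_ne_zero.2 (Nat.factorial_ne_zero _)
  field_simp

end

/-! ### Derivations along parameter dependent vector fields -/

section

variable {N n : ℕ}

/-- The derivation `∂_{x_i}`. -/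
noncomputable def partialX (N n : ℕ) (i : Fin n) :
    Derivation ℝ (anGerm (Rn N × Rn n)) (anGerm (Rn N × Rn n)) :=
  dirDeriv ((0 : Rn N), (EuclideanSpace.single i (1 : ℝ) : Rn n))

/-- The derivation `∑_i B_i ∂_{x_i}`. -/
noncomputable def fieldDeriv (B : Fin n → anGerm (Rn N × Rn n)) :
    Derivation ℝ (anGerm (Rn N × Rn n)) (anGerm (Rn N × Rn n)) :=
  ∑ i, B i • partialX N n i

/-- The Euler derivation `∑_j t_j ∂_{t_j}`. -/
noncomputable def euler (N n : ℕ) :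
    Derivation ℝ (anGerm (Rn N × Rn n)) (anGerm (Rn N × Rn n)) :=
  ∑ j, tmon n (Pi.single j 1) • partialT N n j

/-- The derivation along a parameter dependent vector field, as an endomorphism. -/
noncomputable def fieldOp (B : Fin n → anGerm (Rn N × Rn n)) :
    Module.End ℝ (anGerm (Rn N × Rn n)) :=
  ((fieldDeriv B : Derivation ℝ _ _) : Module.End ℝ (anGerm (Rn N × Rn n)))

/-- The Euler derivation, as an endomorphism. -/
noncomputable def eulerOp (N n : ℕ) : Module.End ℝ (anGerm (Rn N × Rn n)) :=
  ((euler N n : Derivation ℝ _ _) : Module.End ℝ (anGerm (Rn N × Rn n)))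

/-- The germ of the coordinate `x_i`. -/
noncomputable def xcoord (N : ℕ) {n : ℕ} (i : Fin n) : anGerm (Rn N × Rn n) :=
  germ fun p => p.2 i

theorem fieldDeriv_apply (B : Fin n → anGerm (Rn N × Rn n)) (φ : anGerm (Rn N × Rn n)) :
    fieldDeriv B φ = ∑ i, B i * partialX N n i φ := by
  rw [fieldDeriv, ← Derivation.coeFnAddMonoidHom_apply, map_sum, Finset.sum_apply]
  rfl

theorem euler_apply (φ : anGerm (Rn N × Rn n)) :
    euler N n φ = ∑ j, tmon n (Pi.single j 1) * partialT N n j φ := by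
  rw [euler, ← Derivation.coeFnAddMonoidHom_apply, map_sum, Finset.sum_apply]
  rfl

theorem partialX_ofX (i : Fin n) (g : anGerm (Rn n)) :
    partialX N n i (ofX N n g) = ofX N n (dirDeriv (EuclideanSpace.single i (1 : ℝ)) g) := by
  have h := analyticAt_rep g
  have h2 : AnalyticAt ℝ (fun p : Rn N × Rn n => rep g p.2) 0 := h.comp_of_eq analyticAt_snd rfl
  have h3 := analyticAt_fderiv_apply h (EuclideanSpace.single i (1 : ℝ))
  have h4 : AnalyticAt ℝ
    (fun p : Rn N × Rn n => fderiv ℝ (rep g) p.2 (EuclideanSpace.single i (1 : ℝ))) 0 :=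
    h3.comp_of_eq (f := Prod.snd) analyticAt_snd rfl
  rw [← germ_rep g, ofX_germ h, partialX, dirDeriv_germ _ h2, dirDeriv_germ _ h, ofX_germ h3]
  refine germ_congr h4 ?_
  have hs : Filter.Tendsto (Prod.snd : Rn N × Rn n → Rn n) (𝓝 0) (𝓝 0) :=
    continuous_snd.tendsto 0
  filter_upwards [hs.eventually h.eventually_analyticAt] with p hp
  have := (hp.differentiableAt.hasFDerivAt.comp p
    (hasFDerivAt_snd (𝕜 := ℝ) (E := Rn N) (F := Rn n))).fderiv
  change fderiv ℝ (rep g ∘ Prod.snd) p _ = _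
  rw [this]
  rfl

theorem partialX_tmon (i : Fin n) (α : Fin N → ℕ) : partialX N n i (tmon n α) = 0 := by
  rw [tmon, partialX, dirDeriv_germ _ (analyticAt_monomial_fst α)]
  refine (germ_congr (g := fun _ => (0 : ℝ)) analyticAt_const ?_).trans
    ((germ_const _).trans (map_zero _))
  refine Filter.Eventually.of_forall fun p => ?_
  have hm : DifferentiableAt ℝ (fun t : Rn N => monomial t α) p.1 :=
    (analyticAt_monomial (f := fun t : Rn N => t) analyticAt_id α).differentiableAt
  have := (hm.hasFDerivAt.comp p (hasFDerivAt_fst (𝕜 := ℝ) (E := Rn N) (F := Rn n))).fderiv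
  change fderiv ℝ ((fun t : Rn N => monomial t α) ∘ Prod.fst) p _ = _
  rw [this]
  simp

theorem xcoord_eq (i : Fin n) : xcoord N i = ofX N n (germ fun x => x i) :=
  (ofX_germ (analyticAt_coord analyticAt_id i)).symm

theorem fieldDeriv_xcoord (B : Fin n → anGerm (Rn N × Rn n)) (i : Fin n) :
    fieldDeriv B (xcoord N i) = B i := by
  have h : ∀ k, partialX N n k (xcoord N i) = if k = i then 1 else 0 := fun k => by
    have ha : AnalyticAt ℝ (fun x : Rn n => x i) 0 := analyticAt_coord analyticAt_id i
    rw [xcoord_eq, partialX_ofX, dirDeriv_germ _ ha]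
    have : ∀ x : Rn n, fderiv ℝ (fun x : Rn n => x i) x (EuclideanSpace.single k (1 : ℝ)) =
        if k = i then 1 else 0 := fun x => by
      have h : fderiv ℝ (fun x : Rn n => x i) x = EuclideanSpace.proj (𝕜 := ℝ) i :=
        (EuclideanSpace.proj (𝕜 := ℝ) (ι := Fin n) i).fderiv
      rw [h]
      simp [eq_comm]
    simp only [this]
    rw [germ_const]
    split_ifs <;> simp
  rw [fieldDeriv_apply]
  simp [h]

theorem euler_xcoord (i : Fin n) : euler N n (xcoord N i) = 0 := by
  rw [euler_apply]
  exact Finset.sum_eq_zero fun j _ => by rw [xcoord_eq, partialT_ofX, mul_zero]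

theorem fieldDeriv_add (B C : Fin n → anGerm (Rn N × Rn n)) :
    fieldDeriv (B + C) = fieldDeriv B + fieldDeriv C := by
  simp [fieldDeriv, add_smul, Finset.sum_add_distrib]

/-- The commutator of two derivations along vector fields is the derivation along their bracket; the
terms of second order cancel. -/
theorem lie_fieldDeriv (B C : Fin n → anGerm (Rn N × Rn n)) (φ : anGerm (Rn N × Rn n)) :
    fieldDeriv B (fieldDeriv C φ) - fieldDeriv C (fieldDeriv B φ) =
      fieldDeriv (fun k => fieldDeriv B (C k) - fieldDeriv C (B k)) φ := by
  have h : ∀ B C : Fin n → anGerm (Rn N × Rn n), fieldDeriv B (fieldDeriv C φ) =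
      (∑ k, ∑ i, C k * B i * partialX N n i (partialX N n k φ)) +
        ∑ k, fieldDeriv B (C k) * partialX N n k φ := fun B C => by
    conv_lhs => rw [fieldDeriv_apply C, map_sum]
    rw [← Finset.sum_add_distrib]
    refine Finset.sum_congr rfl fun k _ => ?_
    rw [Derivation.leibniz, smul_eq_mul, smul_eq_mul, fieldDeriv_apply B (partialX N n k φ),
      Finset.mul_sum, mul_comm (partialX N n k φ)]
    simp only [mul_assoc]
  rw [h B C, h C B, Finset.sum_comm (f := fun k i => B k * C i * _), fieldDeriv_apply]
  have : ∀ i k, partialX N n i (partialX N n k φ) = partialX N n k (partialX N n i φ) :=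
    fun i k => dirDeriv_comm _ _ φ
  simp only [sub_mul, Finset.sum_sub_distrib]
  have h2 : ∑ k, ∑ i, C k * B i * partialX N n i (partialX N n k φ) =
      ∑ k, ∑ i, B i * C k * partialX N n k (partialX N n i φ) := by
    refine Finset.sum_congr rfl fun k _ => Finset.sum_congr rfl fun i _ => ?_
    rw [this, mul_comm (C k)]
  rw [h2]
  ring

/-- The Euler derivation acts on a derivation along a vector field through its coefficients. -/
theorem lie_euler_fieldDeriv (C : Fin n → anGerm (Rn N × Rn n)) (φ : anGerm (Rn N × Rn n)) :
    euler N n (fieldDeriv C φ) - fieldDeriv C (euler N n φ) =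
      fieldDeriv (fun k => euler N n (C k)) φ := by
  have h : ∀ k, euler N n (partialX N n k φ) = partialX N n k (euler N n φ) := fun k => by
    rw [euler_apply, euler_apply, map_sum]
    refine Finset.sum_congr rfl fun j _ => ?_
    rw [Derivation.leibniz, partialX_tmon, smul_zero, add_zero, smul_eq_mul]
    congr 1
    exact dirDeriv_comm _ _ φ
  rw [fieldDeriv_apply C, fieldDeriv_apply C, fieldDeriv_apply, map_sum, ← Finset.sum_sub_distrib]
  refine Finset.sum_congr rfl fun k _ => ?_
  rw [Derivation.leibniz, smul_eq_mul, smul_eq_mul, h]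
  ring

/-! ### The filtration by order in `t` -/

/-- The operators that raise the order of vanishing in `t` by at least `m`. -/
def RaisesOrder (m : ℕ) (D : Module.End ℝ (anGerm (Rn N × Rn n))) : Prop :=
  ∀ k, ∀ φ ∈ vanishIdeal (Rn N) (Rn n) k, D φ ∈ vanishIdeal (Rn N) (Rn n) (k + m)

theorem RaisesOrder.mul {m m' : ℕ} {D D' : Module.End ℝ (anGerm (Rn N × Rn n))}
    (h : RaisesOrder m D) (h' : RaisesOrder m' D') : RaisesOrder (m + m') (D * D') := by
  intro k φ hφ
  rw [add_comm m, ← add_assoc]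
  exact h _ _ (h' _ _ hφ)

theorem RaisesOrder.add {m : ℕ} {D D' : Module.End ℝ (anGerm (Rn N × Rn n))}
    (h : RaisesOrder m D) (h' : RaisesOrder m D') : RaisesOrder m (D + D') :=
  fun k φ hφ => add_mem (h k φ hφ) (h' k φ hφ)

theorem RaisesOrder.sub {m : ℕ} {D D' : Module.End ℝ (anGerm (Rn N × Rn n))}
    (h : RaisesOrder m D) (h' : RaisesOrder m D') : RaisesOrder m (D - D') :=
  fun k φ hφ => sub_mem (h k φ hφ) (h' k φ hφ)

theorem RaisesOrder.anti {m m' : ℕ} {D : Module.End ℝ (anGerm (Rn N × Rn n))}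
    (h : RaisesOrder m D) (hm : m' ≤ m) : RaisesOrder m' D :=
  fun k φ hφ => vanishIdeal_anti (Nat.add_le_add_left hm k) (h k φ hφ)

theorem raisesOrder_one : RaisesOrder 0 (1 : Module.End ℝ (anGerm (Rn N × Rn n))) :=
  fun _ _ hφ => hφ

theorem RaisesOrder.pow {D : Module.End ℝ (anGerm (Rn N × Rn n))} (h : RaisesOrder 1 D) (k : ℕ) :
    RaisesOrder k (D ^ k) := by
  induction k with
  | zero => exact raisesOrder_one
  | succ k ih =>
    rw [pow_succ]
    exact ih.mul h

theorem raisesOrder_fieldDeriv {m : ℕ} {B : Fin n → anGerm (Rn N × Rn n)}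
    (hB : ∀ i, B i ∈ vanishIdeal (Rn N) (Rn n) m) :
    RaisesOrder m (fieldOp B) := by
  intro k φ hφ
  change fieldDeriv B φ ∈ _
  rw [fieldDeriv_apply]
  refine sum_mem fun i _ => ?_
  rw [add_comm k]
  exact mul_mem_vanishIdeal (hB i) (dirDeriv_snd_mem_vanishIdeal _ hφ)

theorem raisesOrder_euler :
    RaisesOrder 0 (eulerOp N n) := by
  intro k φ hφ
  change euler N n φ ∈ _
  rw [euler_apply]
  refine sum_mem fun j _ => ?_
  rcases k with _ | k
  · exact mem_vanishIdeal_zero _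
  · rw [add_zero, add_comm k]
    refine mul_mem_vanishIdeal ?_ (dirDeriv_fst_mem_vanishIdeal _ hφ)
    simpa using tmon_mem_vanishIdeal (n := n) (Pi.single j 1 : Fin N → ℕ)

theorem RaisesOrder.iterComm {a e : Module.End ℝ (anGerm (Rn N × Rn n))} (ha : RaisesOrder 1 a)
    (he : RaisesOrder 0 e) (j : ℕ) : RaisesOrder j (iterComm a e j) := by
  induction j with
  | zero => exact he
  | succ j ih =>
    refine (ih.mul ha).sub ?_
    rw [add_comm]
    exact ha.mul ih

theorem expTrunc_apply {M : Type*} [AddCommGroup M] [Module ℝ M] (K : ℕ) (a : Module.End ℝ M)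
    (φ : M) : expTrunc K a φ = ∑ k ∈ Finset.range K, ((k.factorial : ℝ)⁻¹) • (a ^ k) φ := by
  simp [expTrunc, LinearMap.sum_apply]

/-- Moving an operator past the exponential: `e P - P (∑_j b_j / j!)` raises the order by `K`, where
`P` is the exponential of `a` and the `b_j` are the iterated commutators of `e` with `a`. -/
theorem RaisesOrder.mul_expTrunc_sub {a e : Module.End ℝ (anGerm (Rn N × Rn n))}
    (ha : RaisesOrder 1 a) (he : RaisesOrder 0 e) (K : ℕ) :
    RaisesOrder K (e * expTrunc K a -
      expTrunc K a * ∑ j ∈ Finset.range K, ((j.factorial : ℝ)⁻¹) • Radon.iterComm a e j) := by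
  set g : ℕ × ℕ → Module.End ℝ (anGerm (Rn N × Rn n)) := fun m =>
    (((m.1.factorial : ℝ)⁻¹) • a ^ m.1) * (((m.2.factorial : ℝ)⁻¹) • Radon.iterComm a e m.2)
    with hg
  have h1 : e * expTrunc K a =
      ∑ m ∈ (Finset.range K ×ˢ Finset.range K).filter (fun m => m.1 + m.2 < K), g m := by
    rw [mul_expTrunc]
    have := Finset.sum_fiberwise_of_maps_to
      (s := (Finset.range K ×ˢ Finset.range K).filter (fun m => m.1 + m.2 < K))
      (t := Finset.range K) (g := fun m : ℕ × ℕ => m.1 + m.2) (f := g)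
      (fun m hm => Finset.mem_range.2 (Finset.mem_filter.1 hm).2)
    rw [← this]
    refine Finset.sum_congr rfl fun k hk => Finset.sum_congr ?_ fun _ _ => rfl
    ext m
    simp only [Finset.HasAntidiagonal.mem_antidiagonal, Finset.mem_filter, Finset.mem_product,
      Finset.mem_range]
      at hk ⊢
    omega
  have h2 : expTrunc K a * ∑ j ∈ Finset.range K, ((j.factorial : ℝ)⁻¹) • Radon.iterComm a e j =
      ∑ m ∈ Finset.range K ×ˢ Finset.range K, g m := by
    rw [expTrunc, Finset.sum_mul_sum, Finset.sum_product]
  rw [h1, h2, ← Finset.sum_filter_add_sum_filter_not (Finset.range K ×ˢ Finset.range K)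
    (fun m => m.1 + m.2 < K), sub_add_cancel_left]
  intro k φ hφ
  rw [LinearMap.neg_apply, LinearMap.sum_apply]
  refine neg_mem (sum_mem fun m hm => ?_)
  have hm' : K ≤ m.1 + m.2 := not_lt.1 (Finset.mem_filter.1 hm).2
  have := ((ha.pow m.1).mul (ha.iterComm he m.2)).anti hm' k φ hφ
  simp only [hg, smul_mul_smul_comm]
  exact smul_mem_vanishIdeal _ this

end

end Radon

namespace Radon

section

variable {N n : ℕ}

/-! ### Taylor expansion along integral curves -/

theorem apply_eq_sum_coord {E F : Type*} [NormedAddCommGroup E] [NormedSpace ℝ E]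
    [NormedAddCommGroup F] [NormedSpace ℝ F] (L : E × Rn n →L[ℝ] F) (v : Rn n) :
    L (0, v) = ∑ i, v i • L (0, EuclideanSpace.single i (1 : ℝ)) := by
  have hsum : ((0 : E), v) = ∑ i, v i • ((0 : E), (EuclideanSpace.single i (1 : ℝ) : Rn n)) := by
    refine Prod.ext ?_ ?_
    · rw [Prod.fst_sum]
      simp
    · rw [Prod.snd_sum]
      ext k
      simp [Finset.sum_apply, Pi.single_apply]
  rw [hsum, map_sum]
  simp only [map_smul]

/-- On germs of functions `fieldDeriv` is differentiation along the vector field. -/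
theorem fieldDeriv_vecGerm {A : Rn N × Rn n → Rn n} (hA : AnalyticAt ℝ A 0)
    {f : Rn N × Rn n → ℝ} (hf : AnalyticAt ℝ f 0) :
    fieldDeriv (vecGerm A) (germ f) = germ fun p => fderiv ℝ f p (0, A p) := by
  have h1 : ∀ i : Fin n, AnalyticAt ℝ (fun p : Rn N × Rn n =>
      fderiv ℝ f p (0, EuclideanSpace.single i (1 : ℝ))) 0 := fun i =>
    analyticAt_fderiv_apply hf _
  have h2 : ∀ i : Fin n, AnalyticAt ℝ (fun p : Rn N × Rn n =>
      A p i * fderiv ℝ f p (0, EuclideanSpace.single i (1 : ℝ))) 0 := fun i =>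
    (analyticAt_coord hA i).mul (h1 i)
  have h3 : ∀ i, vecGerm A i * partialX N n i (germ f) =
      germ fun p => A p i * fderiv ℝ f p (0, EuclideanSpace.single i (1 : ℝ)) := fun i => by
    rw [partialX, dirDeriv_germ _ hf]
    exact (germ_mul (analyticAt_coord hA i) (h1 i)).symm
  rw [fieldDeriv_apply]
  simp only [h3]
  have h4 := Finset.analyticAt_fun_sum Finset.univ fun i _ => h2 i
  refine germ_ext ?_
  have h5 : AnalyticAt ℝ (fun p : Rn N × Rn n => fderiv ℝ f p (0, A p)) 0 :=
    analyticAt_clm_apply hf.fderiv (analyticAt_const.prod hA)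
  filter_upwards [rep_sum Finset.univ fun i => germ fun p : Rn N × Rn n =>
      A p i * fderiv ℝ f p (0, EuclideanSpace.single i (1 : ℝ)),
    Filter.eventually_all.2 fun i => rep_germ (h2 i), rep_germ h5] with p e1 e2 e3
  rw [e1, e3, apply_eq_sum_coord]
  exact Finset.sum_congr rfl fun i _ => e2 i

theorem euler_germ {f : Rn N × Rn n → ℝ} (hf : AnalyticAt ℝ f 0) :
    euler N n (germ f) = germ fun p => fderiv ℝ f p (p.1, 0) := by
  have h1 : ∀ j : Fin N, AnalyticAt ℝ (fun p : Rn N × Rn n =>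
      fderiv ℝ f p (EuclideanSpace.single j (1 : ℝ), 0)) 0 := fun i =>
    analyticAt_fderiv_apply hf _
  have h0 : ∀ j : Fin N, AnalyticAt ℝ (fun p : Rn N × Rn n => p.1 j) 0 := fun j =>
    analyticAt_coord analyticAt_fst j
  have h2 : ∀ j : Fin N, AnalyticAt ℝ (fun p : Rn N × Rn n =>
      p.1 j * fderiv ℝ f p (EuclideanSpace.single j (1 : ℝ), 0)) 0 := fun j =>
    (h0 j).mul (h1 j)
  have h3 : ∀ j, tmon n (Pi.single j 1) * partialT N n j (germ f) =
      germ fun p => p.1 j * fderiv ℝ f p (EuclideanSpace.single j (1 : ℝ), 0) := fun j => by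
    rw [partialT, dirDeriv_germ _ hf, tmon_single]
    exact (germ_mul (h0 j) (h1 j)).symm
  rw [euler_apply]
  simp only [h3]
  refine germ_ext ?_
  have h5 : AnalyticAt ℝ (fun p : Rn N × Rn n => fderiv ℝ f p (p.1, 0)) 0 :=
    analyticAt_clm_apply hf.fderiv (analyticAt_fst.prod analyticAt_const)
  filter_upwards [rep_sum Finset.univ fun j => germ fun p : Rn N × Rn n =>
      p.1 j * fderiv ℝ f p (EuclideanSpace.single j (1 : ℝ), 0),
    Filter.eventually_all.2 fun j => rep_germ (h2 j), rep_germ h5] with p e1 e2 e3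
  have hsum : (p.1, (0 : Rn n)) =
      ∑ j, p.1 j • ((EuclideanSpace.single j (1 : ℝ) : Rn N), (0 : Rn n)) := by
    refine Prod.ext ?_ ?_
    · rw [Prod.fst_sum]
      ext k
      simp [Finset.sum_apply, Pi.single_apply]
    · rw [Prod.snd_sum]
      simp
  rw [e1, e3, hsum, map_sum]
  refine Finset.sum_congr rfl fun j _ => (e2 j).trans ?_
  rw [map_smul, smul_eq_mul]

/-- An integral curve of a small vector field stays in a ball for time `1`. -/
theorem norm_lt_of_isIntegralCurveOn {E : Type*} [NormedAddCommGroup E] [NormedSpace ℝ E]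
    {V : E → E} {ρ : ℝ} (hV : ∀ y, ‖y‖ < ρ → ‖V y‖ < ρ / 2) {σ : ℝ → E} (h0 : ‖σ 0‖ < ρ / 2)
    (hσ : IsIntegralCurveOn σ (fun _ => V) (Set.Icc 0 1)) : ∀ s ∈ Set.Icc (0 : ℝ) 1, ‖σ s‖ < ρ := by
  have hB : ∀ s : ℝ, HasDerivAt (fun s : ℝ => ‖σ 0‖ + ρ / 2 * s) (ρ / 2) s := fun s => by
    simpa using ((hasDerivAt_id s).const_mul (ρ / 2)).const_add ‖σ 0‖
  have hρ : 0 < ρ := by linarith [norm_nonneg (σ 0)]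
  have hlt : ∀ s ∈ Set.Icc (0 : ℝ) 1, ‖σ 0‖ + ρ / 2 * s < ρ := fun s hs => by nlinarith [hs.2]
  intro s hs
  refine lt_of_le_of_lt ?_ (hlt s hs)
  refine image_norm_le_of_norm_deriv_right_lt_deriv_boundary' (f := σ) (f' := fun s => V (σ s))
    (B := fun s => ‖σ 0‖ + ρ / 2 * s) (B' := fun _ => ρ / 2)
    (fun s hs => (hσ s hs).continuousWithinAt) (fun s hs => ?_) (by simp)
    (fun s _ => (hB s).continuousAt.continuousWithinAt) (fun s _ => (hB s).hasDerivWithinAt)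
    (fun s hs h => ?_) hs
  · exact (hσ s (Set.Ico_subset_Icc_self hs)).mono_of_mem_nhdsWithin
      (Icc_mem_nhdsGE_of_mem hs)
  · exact hV _ (h.trans_lt (hlt s (Set.Ico_subset_Icc_self hs)))

/-- Taylor's formula with remainder at `s = 1`, for a chain of functions of which each is the
derivative of the one before. -/
theorem abs_sub_sum_le_of_hasDerivWithinAt (m : ℕ) (g : ℕ → ℝ → ℝ) {C : ℝ}
    (hg : ∀ k ≤ m, ∀ s ∈ Set.Icc (0 : ℝ) 1, HasDerivWithinAt (g k) (g (k + 1) s) (Set.Icc 0 1) s)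
    (hC : ∀ s ∈ Set.Icc (0 : ℝ) 1, |g (m + 1) s| ≤ C) :
    |g 0 1 - ∑ k ∈ Finset.range (m + 1), ((k.factorial : ℝ)⁻¹) * g k 0| ≤ C := by
  have hderiv : ∀ j ≤ m, ∀ s ∈ Set.Icc (0 : ℝ) 1,
      HasDerivWithinAt (fun s => ∑ k ∈ Finset.range (j + 1),
        ((k.factorial : ℝ)⁻¹) * (1 - s) ^ k * g k s)
        (((j.factorial : ℝ)⁻¹) * (1 - s) ^ j * g (j + 1) s) (Set.Icc 0 1) s := by
    intro j hj s hs
    induction j with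
    | zero => simpa using hg 0 hj s hs
    | succ j ih =>
      simp only [Finset.sum_range_succ _ (j + 1)]
      have h1 : HasDerivWithinAt (fun s : ℝ => (((j + 1).factorial : ℝ)⁻¹) * (1 - s) ^ (j + 1))
          ((((j + 1).factorial : ℝ)⁻¹) * (((j + 1 : ℕ) : ℝ) * (1 - s) ^ j * (-1)))
          (Set.Icc 0 1) s := by
        have := (((hasDerivAt_id s).const_sub 1).pow (j + 1)).const_mul
          (((j + 1).factorial : ℝ)⁻¹)
        simpa using this.hasDerivWithinAt
      refine ((ih (by omega)).add (h1.mul (hg (j + 1) hj s hs))).congr_deriv ?_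
      have hf : ((j.factorial : ℝ)) ≠ 0 := Nat.cast_ne_zero.2 (Nat.factorial_ne_zero _)
      have hj1 : ((j : ℝ) + 1) ≠ 0 := by positivity
      rw [Nat.factorial_succ]
      push_cast
      field_simp
      ring
  have := norm_image_sub_le_of_norm_deriv_le_segment_01' (hderiv m le_rfl) (C := C) fun s hs => by
    have hs' := Set.Ico_subset_Icc_self hs
    rw [Real.norm_eq_abs, abs_mul]
    refine (mul_le_of_le_one_left (abs_nonneg _) ?_).trans (hC s hs')
    have h1 : 0 ≤ 1 - s := by linarith [hs.2]
    rw [abs_of_nonneg (by positivity)]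
    refine mul_le_one₀ ?_ (by positivity) (pow_le_one₀ h1 (by linarith [hs.1]))
    exact inv_le_one_of_one_le₀ (Nat.one_le_cast.2 (Nat.factorial_pos m))
  have h1 : ∑ k ∈ Finset.range (m + 1), ((k.factorial : ℝ)⁻¹) * (1 - (1 : ℝ)) ^ k * g k 1 =
      g 0 1 := by
    rw [Finset.sum_range_succ']
    simp
  simp only [h1, sub_zero, one_pow, mul_one] at this
  exact this

/-- The values of an analytic function at the end points of the integral curves of a vector field
that vanishes at `t = 0` are given by the truncated exponential, up to `O(|t|^K)`. -/
theorem exists_expTrunc_bound {A : Rn N × Rn n → Rn n} (hA : AnalyticAt ℝ A 0)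
    (hA1 : ∀ i, vecGerm A i ∈ vanishIdeal (Rn N) (Rn n) 1) (K : ℕ) {f : Rn N × Rn n → ℝ}
    (hf : AnalyticAt ℝ f 0) :
    ∃ r > 0, ∃ C : ℝ, ∀ t : Rn N, ‖t‖ < r → ∀ x : Rn n, ‖x‖ < r → ∀ σ : ℝ → Rn n, σ 0 = x →
      IsIntegralCurveOn σ (fun _ y => A (t, y)) (Set.Icc 0 1) →
      |f (t, σ 1) - rep (expTrunc K (fieldOp (vecGerm A)) (germ f)) (t, x)| ≤ C * ‖t‖ ^ K := by
  set a := fieldOp (vecGerm A)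
  set φ := germ f
  have hao : RaisesOrder 1 a := raisesOrder_fieldDeriv hA1
  let g : ℕ → Rn N × Rn n → ℝ := fun k => rep ((a ^ k) φ)
  have hga : ∀ k, AnalyticAt ℝ (g k) 0 := fun k => analyticAt_rep _
  have hstep : ∀ k, ∀ᶠ p in 𝓝 0, g (k + 1) p = fderiv ℝ (g k) p (0, A p) := fun k => by
    have h1 : (a ^ (k + 1)) φ = germ fun p => fderiv ℝ (g k) p (0, A p) := by
      rw [pow_succ', Module.End.mul_apply, ← fieldDeriv_vecGerm hA (hga k)]
      exact congrArg a (germ_rep _).symm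
    have h5 : AnalyticAt ℝ (fun p : Rn N × Rn n => fderiv ℝ (g k) p (0, A p)) 0 :=
      analyticAt_clm_apply (hga k).fderiv (analyticAt_const.prod hA)
    have := rep_germ h5
    rw [← h1] at this
    exact this
  have hexp : ∀ᶠ p in 𝓝 0, rep (expTrunc K a φ) p =
      ∑ k ∈ Finset.range K, ((k.factorial : ℝ)⁻¹) * g k p := by
    rw [expTrunc_apply]
    have h1 : ∀ᶠ p in 𝓝 (0 : Rn N × Rn n), ∀ k ∈ Finset.range K,
        rep (((k.factorial : ℝ)⁻¹) • (a ^ k) φ) p = ((k.factorial : ℝ)⁻¹) * g k p :=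
      (Finset.range K).eventually_all.2 fun k _ => rep_smul _ _
    filter_upwards [rep_sum (Finset.range K) fun k => ((k.factorial : ℝ)⁻¹) • (a ^ k) φ, h1]
      with p e1 e2
    rw [e1]
    exact Finset.sum_congr rfl e2
  obtain ⟨C, hC⟩ : ∃ C, ∀ᶠ p in 𝓝 (0 : Rn N × Rn n), |g K p| ≤ C * ‖p.1‖ ^ K := by
    have := hao.pow K 0 φ (mem_vanishIdeal_zero φ)
    rwa [zero_add] at this
  obtain ⟨D, hD⟩ := norm_le_of_vecGerm_mem hA hA1
  obtain ⟨ρ, hρ, H⟩ := Metric.eventually_nhds_iff_ball.1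
    (((Finset.range K).eventually_all.2 fun k _ => hstep k).and
      (((Finset.range K).eventually_all.2 fun k _ => (hga k).eventually_analyticAt).and
        (hexp.and (hC.and (hD.and (rep_germ hf))))))
  have hr : 0 < min (ρ / 2) (ρ / 2 / (|D| + 1)) := by positivity
  refine ⟨_, hr, C, fun t ht x hx σ hσ0 hσ => ?_⟩
  have ht1 : ‖t‖ < ρ / 2 := ht.trans_le (min_le_left _ _)
  have ht2 : ‖t‖ * (|D| + 1) < ρ / 2 :=
    (lt_div_iff₀ (by positivity)).1 (ht.trans_le (min_le_right _ _))
  have hx1 : ‖x‖ < ρ / 2 := hx.trans_le (min_le_left _ _)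
  have hmem : ∀ y : Rn n, ‖y‖ < ρ → (t, y) ∈ Metric.ball (0 : Rn N × Rn n) ρ := fun y hy => by
    rw [mem_ball_zero_iff, Prod.norm_def]
    exact max_lt (ht1.trans (half_lt_self hρ)) hy
  have hconf := norm_lt_of_isIntegralCurveOn (V := fun y => A (t, y)) (ρ := ρ) (fun y hy => by
    refine ((H _ (hmem y hy)).2.2.2.2.1).trans_lt ?_
    rw [pow_one]
    change D * ‖t‖ < ρ / 2
    nlinarith [le_abs_self D, norm_nonneg t]) (by rwa [hσ0]) hσ
  have hball : ∀ s ∈ Set.Icc (0 : ℝ) 1, (t, σ s) ∈ Metric.ball (0 : Rn N × Rn n) ρ :=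
    fun s hs => hmem _ (hconf s hs)
  have hderiv : ∀ k < K, ∀ s ∈ Set.Icc (0 : ℝ) 1,
      HasDerivWithinAt (fun s => g k (t, σ s)) (g (k + 1) (t, σ s)) (Set.Icc 0 1) s := by
    intro k hk s hs
    have h1 := H _ (hball s hs)
    have hl : HasDerivWithinAt (fun s => (t, σ s)) ((0 : Rn N), A (t, σ s)) (Set.Icc 0 1) s :=
      (hasDerivWithinAt_const s _ t).prodMk (hσ s hs)
    rw [h1.1 k (Finset.mem_range.2 hk)]
    exact (h1.2.1 k (Finset.mem_range.2 hk)).differentiableAt.hasFDerivAt.comp_hasDerivWithinAt s hl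
  have hbd : ∀ s ∈ Set.Icc (0 : ℝ) 1, |g K (t, σ s)| ≤ C * ‖t‖ ^ K := fun s hs =>
    (H _ (hball s hs)).2.2.2.1
  have h0 := (H _ (hball 0 (by simp))).2.2.1
  rw [hσ0] at h0
  rw [h0, ← (H _ (hball 1 (by simp))).2.2.2.2.2]
  rcases K with _ | m
  · rw [Finset.sum_range_zero, sub_zero]
    exact hbd 1 (by simp)
  · have := abs_sub_sum_le_of_hasDerivWithinAt m (fun k s => g k (t, σ s))
      (fun k hk => hderiv k (by omega)) hbd
    simp only [hσ0] at this
    exact this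

end

end Radon

namespace Radon

section

variable {N n ν : ℕ}

/-! ### Brackets of graded vector fields -/

/-- The coefficients of the commutator of `∑_k v_k ∂_{x_k}` and `∑_k w_k ∂_{x_k}`, as a bilinear
map. -/
noncomputable def lieCoeff (N n : ℕ) : (Fin n → anGerm (Rn N × Rn n)) →ₗ[ℝ]
    (Fin n → anGerm (Rn N × Rn n)) →ₗ[ℝ] (Fin n → anGerm (Rn N × Rn n)) :=
  LinearMap.mk₂ ℝ (fun v w k => fieldDeriv v (w k) - fieldDeriv w (v k))
    (fun v v' w => by
      funext k
      simp only [fieldDeriv_add, Derivation.add_apply, Pi.add_apply, map_add]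
      ring)
    (fun c v w => by
      funext k
      simp only [fieldDeriv_apply, Pi.smul_apply, Derivation.map_smul, smul_mul_assoc,
        ← Finset.smul_sum, smul_sub])
    (fun v w w' => by
      funext k
      simp only [fieldDeriv_add, Derivation.add_apply, Pi.add_apply, map_add]
      ring)
    (fun c v w => by
      funext k
      simp only [fieldDeriv_apply, Pi.smul_apply, Derivation.map_smul, smul_mul_assoc,
        ← Finset.smul_sum, smul_sub])

/-- The coefficients of the vector field `t ^ α Z(x)`. -/
noncomputable def monGerm (α : Fin N → ℕ) (Z : Rn n → Rn n) : Fin n → anGerm (Rn N × Rn n) :=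
  fun i => tmon n α * ofX N n (germ fun x => Z x i)

/-- The real span of the coefficient vectors of the `t ^ α Z(x)`, `(Z, deg α) ∈ L₀(S)`. -/
noncomputable def gradedGerms (e : Fin N → Fin ν → ℕ) (S : Set (FormalField n ν)) :
    Submodule ℝ (Fin n → anGerm (Rn N × Rn n)) :=
  Submodule.span ℝ {v | ∃ (α : Fin N → ℕ) (Z : Rn n → Rn n), MemL0 S (Z, deg e α) ∧
    v = monGerm α Z}

theorem vecGerm_monomial_smul (α : Fin N → ℕ) {Z : Rn n → Rn n} (hZ : AnalyticAt ℝ Z 0) :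
    vecGerm (fun p : Rn N × Rn n => monomial p.1 α • Z p.2) = monGerm α Z := by
  have h2 : AnalyticAt ℝ (fun p : Rn N × Rn n => Z p.2) 0 := hZ.comp_of_eq analyticAt_snd rfl
  funext i
  rw [vecGerm_smul (f := fun p : Rn N × Rn n => monomial p.1 α) (analyticAt_monomial_fst α) h2,
    monGerm, ofX_germ (analyticAt_coord hZ i)]
  rfl

theorem exists_vecGerm_eq {e : Fin N → Fin ν → ℕ} {S : Set (FormalField n ν)}
    (hS : ∀ X ∈ S, AnalyticAt ℝ X.1 0) {v : Fin n → anGerm (Rn N × Rn n)}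
    (hv : v ∈ gradedGerms e S) : ∃ B ∈ gradedSpan e S, vecGerm B = v := by
  induction hv using Submodule.span_induction with
  | mem v hv =>
    obtain ⟨α, Z, hZ, rfl⟩ := hv
    exact ⟨_, Submodule.subset_span ⟨α, Z, hZ, rfl⟩, vecGerm_monomial_smul α (hZ.analyticAt hS)⟩
  | zero => exact ⟨0, zero_mem _, vecGerm_zero⟩
  | add v w _ _ hv hw =>
    obtain ⟨B, hB, rfl⟩ := hv
    obtain ⟨C, hC, rfl⟩ := hw
    exact ⟨B + C, add_mem hB hC,
      vecGerm_add (analyticAt_of_mem_gradedSpan hS hB) (analyticAt_of_mem_gradedSpan hS hC)⟩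
  | smul c v _ hv =>
    obtain ⟨B, hB, rfl⟩ := hv
    refine ⟨c • B, Submodule.smul_mem _ _ hB, ?_⟩
    funext i
    exact germ_smul c (analyticAt_coord (analyticAt_of_mem_gradedSpan hS hB) i)

theorem deg_add (e : Fin N → Fin ν → ℕ) (α β : Fin N → ℕ) : deg e (α + β) = deg e α + deg e β := by
  simp [deg, add_smul, Finset.sum_add_distrib]

theorem fieldDeriv_monGerm (α β : Fin N → ℕ) {Z : Rn n → Rn n} (hZ : AnalyticAt ℝ Z 0)
    {f : Rn n → ℝ} (hf : AnalyticAt ℝ f 0) :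
    fieldDeriv (monGerm α Z) (tmon n β * ofX N n (germ f)) =
      tmon n (α + β) * ofX N n (germ fun x => fderiv ℝ f x (Z x)) := by
  have h1 : ∀ i : Fin n, AnalyticAt ℝ (fun x => fderiv ℝ f x (EuclideanSpace.single i (1 : ℝ))) 0 :=
    fun i => analyticAt_fderiv_apply hf _
  have h2 : ∀ i : Fin n, AnalyticAt ℝ (fun x => Z x i *
      fderiv ℝ f x (EuclideanSpace.single i (1 : ℝ))) 0 := fun i =>
    (analyticAt_coord hZ i).mul (h1 i)
  have h3 : germ (fun x => fderiv ℝ f x (Z x)) = ∑ i, (germ fun x => Z x i) *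
      germ fun x => fderiv ℝ f x (EuclideanSpace.single i (1 : ℝ)) := by
    simp only [← germ_mul (analyticAt_coord hZ _) (h1 _)]
    refine germ_ext ?_
    filter_upwards [rep_sum Finset.univ fun i => germ fun x => Z x i *
        fderiv ℝ f x (EuclideanSpace.single i (1 : ℝ)),
      Filter.eventually_all.2 fun i => rep_germ (h2 i),
      rep_germ (analyticAt_clm_apply hf.fderiv hZ)] with x e1 e2 e3
    have hsum : Z x = ∑ i, Z x i • (EuclideanSpace.single i (1 : ℝ) : Rn n) := by
      ext k
      simp [Finset.sum_apply, Pi.single_apply]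
    rw [e1, e3]
    conv_lhs => rw [hsum, map_sum]
    exact Finset.sum_congr rfl fun i _ => by rw [map_smul, smul_eq_mul, e2 i]
  rw [h3, map_sum, Finset.mul_sum, fieldDeriv_apply]
  refine Finset.sum_congr rfl fun i _ => ?_
  rw [Derivation.leibniz, partialX_tmon, smul_zero, add_zero, partialX_ofX, dirDeriv_germ _ hf,
    smul_eq_mul, monGerm, map_mul, tmon_add]
  ring

/-- The bracket of `t ^ α Z` and `t ^ β Y` is again homogeneous, of exponent `β + α`. -/
theorem lieCoeff_monGerm (α β : Fin N → ℕ) {Z Y : Rn n → Rn n} (hZ : AnalyticAt ℝ Z 0)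
    (hY : AnalyticAt ℝ Y 0) : lieCoeff N n (monGerm α Z) (monGerm β Y) =
      monGerm (β + α) (fun x => - VectorField.lieBracket ℝ Y Z x) := by
  funext k
  change fieldDeriv (monGerm α Z) (tmon n β * ofX N n (germ fun x => Y x k)) -
    fieldDeriv (monGerm β Y) (tmon n α * ofX N n (germ fun x => Z x k)) = _
  have hYk := analyticAt_coord hY k
  have hZk := analyticAt_coord hZ k
  have a1 := analyticAt_clm_apply hYk.fderiv hZ
  have a2 := analyticAt_clm_apply hZk.fderiv hY
  rw [fieldDeriv_monGerm α β hZ hYk, fieldDeriv_monGerm β α hY hZk, add_comm α, ← mul_sub,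
    ← map_sub, ← germ_sub a1 a2, monGerm]
  congr 2
  refine (germ_congr (f := fun x => (-VectorField.lieBracket ℝ Y Z x) k) (a1.sub a2) ?_).symm
  filter_upwards [hY.eventually_analyticAt, hZ.eventually_analyticAt] with x h1 h2
  have e1 := ((EuclideanSpace.proj (𝕜 := ℝ) (ι := Fin n) k).hasFDerivAt.comp x
    h1.differentiableAt.hasFDerivAt).fderiv
  have e2 := ((EuclideanSpace.proj (𝕜 := ℝ) (ι := Fin n) k).hasFDerivAt.comp x
    h2.differentiableAt.hasFDerivAt).fderiv
  have e1' : fderiv ℝ (fun x => Y x k) x (Z x) = (fderiv ℝ Y x (Z x)) k :=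
    congrArg (fun L : Rn n →L[ℝ] ℝ => L (Z x)) e1
  have e2' : fderiv ℝ (fun x => Z x k) x (Y x) = (fderiv ℝ Z x (Y x)) k :=
    congrArg (fun L : Rn n →L[ℝ] ℝ => L (Y x)) e2
  simp only [Pi.sub_apply, e1', e2', VectorField.lieBracket, neg_sub]
  rfl

theorem monGerm_neg (α : Fin N → ℕ) {Z : Rn n → Rn n} (hZ : AnalyticAt ℝ Z 0) :
    monGerm α (fun x => - Z x) = -monGerm α Z := by
  funext i
  have h := germ_smul (-1) (analyticAt_coord hZ i)
  simp only [neg_one_mul, neg_one_smul] at h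
  change tmon n α * ofX N n (germ fun x => -(Z x i)) = -(tmon n α * ofX N n _)
  rw [h, map_neg, mul_neg]

/-- The span of the graded fields `t ^ α Z`, `(Z, deg α) ∈ L₀(S)`, is stable under brackets with `t
^ β Y`, `(Y, deg β) ∈ S`: this is the closure property that defines `L₀(S)`. -/
theorem lieCoeff_mem_gradedGerms {e : Fin N → Fin ν → ℕ} {S : Set (FormalField n ν)}
    (hS : ∀ X ∈ S, AnalyticAt ℝ X.1 0) {v : Fin n → anGerm (Rn N × Rn n)}
    (hv : v ∈ gradedGerms e S) {β : Fin N → ℕ} {Y : Rn n → Rn n} (hY : (Y, deg e β) ∈ S) :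
    lieCoeff N n v (monGerm β Y) ∈ gradedGerms e S := by
  have hYa := hS _ hY
  have : gradedGerms e S ≤
      (gradedGerms e S).comap ((lieCoeff N n).flip (monGerm β Y)) := by
    refine Submodule.span_le.2 ?_
    rintro _ ⟨α, Z, hZ, rfl⟩
    change lieCoeff N n (monGerm α Z) (monGerm β Y) ∈ gradedGerms e S
    have hZa := hZ.analyticAt hS
    rw [lieCoeff_monGerm α β hZa hYa, monGerm_neg _ (analyticAt_lieBracket hYa hZa)]
    refine neg_mem (Submodule.subset_span ⟨β + α, _, ?_, rfl⟩)
    rw [deg_add]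
    exact .comm (Y, deg e β) (Z, deg e α) hY hZ
  exact this hv

theorem truncGerm_eq_sum (X : (Fin N → ℕ) → Rn n → Rn n) (K : ℕ) :
    truncGerm X K = ∑ k ∈ Finset.Ico 1 K,
      ∑ α ∈ Finset.piAntidiag (Finset.univ : Finset (Fin N)) k, monGerm α (X α) := by
  funext i
  simp only [truncGerm, Finset.sum_apply]
  rfl

theorem lieCoeff_truncGerm_mem {e : Fin N → Fin ν → ℕ} {X : (Fin N → ℕ) → Rn n → Rn n}
    (hX : ∀ α, α ≠ 0 → AnalyticAt ℝ (X α) 0) (K : ℕ) {v : Fin n → anGerm (Rn N × Rn n)}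
    (hv : v ∈ gradedGerms e {Z : FormalField n ν | ∃ α, α ≠ 0 ∧ Z = (X α, deg e α)}) :
    lieCoeff N n v (truncGerm X K) ∈
      gradedGerms e {Z : FormalField n ν | ∃ α, α ≠ 0 ∧ Z = (X α, deg e α)} := by
  rw [truncGerm_eq_sum, map_sum]
  refine sum_mem fun k hk => ?_
  rw [map_sum]
  refine sum_mem fun α hα => lieCoeff_mem_gradedGerms ?_ hv
    ⟨α, ne_zero_of_mem_piAntidiag (Finset.mem_Ico.1 hk).1 hα, rfl⟩
  rintro _ ⟨α, hα, rfl⟩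
  exact hX α hα

theorem euler_tmon_mul (α : Fin N → ℕ) (g : anGerm (Rn n)) :
    euler N n (tmon n α * ofX N n g) = ((∑ j, α j : ℕ) : ℝ) • (tmon n α * ofX N n g) := by
  rw [euler_apply, Nat.cast_sum, Finset.sum_smul]
  refine Finset.sum_congr rfl fun j _ => ?_
  rw [Derivation.leibniz, partialT_ofX, smul_zero, zero_add, partialT_tmon]
  rcases Nat.eq_zero_or_pos (α j) with h | h
  · simp only [h, Nat.cast_zero, zero_smul, smul_zero, mul_zero]
  · have : α = Pi.single j 1 + Function.update α j (α j - 1) := by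
      funext k
      by_cases hk : k = j
      · subst hk; simp; omega
      · simp [hk]
    conv_rhs => rw [this, tmon_add]
    simp only [smul_eq_mul, Algebra.smul_def, Pi.add_apply, Pi.single_eq_same,
      Function.update_self, add_tsub_cancel_of_le (Nat.succ_le_of_lt h)]
    ring

/-- The Euler derivation multiplies `t ^ α X_α` by `|α|`. -/
theorem euler_truncGerm_mem {e : Fin N → Fin ν → ℕ} {X : (Fin N → ℕ) → Rn n → Rn n} (K : ℕ) :
    (fun k => euler N n (truncGerm X K k)) ∈
      gradedGerms e {Z : FormalField n ν | ∃ α, α ≠ 0 ∧ Z = (X α, deg e α)} := by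
  have : (fun k => euler N n (truncGerm X K k)) = ∑ k ∈ Finset.Ico 1 K,
      ∑ α ∈ Finset.piAntidiag (Finset.univ : Finset (Fin N)) k,
        ((∑ j, α j : ℕ) : ℝ) • monGerm α (X α) := by
    funext i
    simp only [truncGerm, map_sum, euler_tmon_mul, Finset.sum_apply]
    rfl
  rw [this]
  refine sum_mem fun k hk => sum_mem fun α hα => Submodule.smul_mem _ _
    (Submodule.subset_span ⟨α, X α, .base _ ⟨α, ?_, rfl⟩, rfl⟩)
  exact ne_zero_of_mem_piAntidiag (Finset.mem_Ico.1 hk).1 hα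

/-- The iterated commutators of the Euler derivation with the derivation along
`∑_α t ^ α X_α` are derivations along graded vector fields. -/
theorem exists_iterComm_eq {e : Fin N → Fin ν → ℕ} {X : (Fin N → ℕ) → Rn n → Rn n}
    (hX : ∀ α, α ≠ 0 → AnalyticAt ℝ (X α) 0) (K j : ℕ) :
    ∃ v ∈ gradedGerms e {Z : FormalField n ν | ∃ α, α ≠ 0 ∧ Z = (X α, deg e α)},
      iterComm (fieldOp (truncGerm X K)) (eulerOp N n) (j + 1) = fieldOp v := by
  induction j with
  | zero =>
    exact ⟨_, euler_truncGerm_mem K, LinearMap.ext fun φ => lie_euler_fieldDeriv _ φ⟩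
  | succ j ih =>
    obtain ⟨v, hv, h⟩ := ih
    refine ⟨_, lieCoeff_truncGerm_mem hX K hv, ?_⟩
    rw [iterComm, h]
    exact LinearMap.ext fun φ => lie_fieldDeriv _ _ φ

/-- The coefficients of `∑_j [… [e, a] …, a] / j!`, where `e` is the Euler derivation and `a` the
derivation along `∑_α t ^ α X_α`, are those of a graded vector field. -/
theorem sum_iterComm_xcoord_mem {e : Fin N → Fin ν → ℕ} {X : (Fin N → ℕ) → Rn n → Rn n}
    (hX : ∀ α, α ≠ 0 → AnalyticAt ℝ (X α) 0) (K : ℕ) :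
    (fun l => (∑ j ∈ Finset.range K, ((j.factorial : ℝ)⁻¹) •
      iterComm (fieldOp (truncGerm X K)) (eulerOp N n) j) (xcoord N l)) ∈
      gradedGerms e {Z : FormalField n ν | ∃ α, α ≠ 0 ∧ Z = (X α, deg e α)} := by
  have : (fun l => (∑ j ∈ Finset.range K, ((j.factorial : ℝ)⁻¹) •
      iterComm (fieldOp (truncGerm X K)) (eulerOp N n) j) (xcoord N l)) =
      ∑ j ∈ Finset.range K, ((j.factorial : ℝ)⁻¹) • fun l : Fin n =>
        iterComm (fieldOp (truncGerm X K)) (eulerOp N n) j (xcoord N l) := by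
    funext l
    simp only [LinearMap.sum_apply, LinearMap.smul_apply, Finset.sum_apply, Pi.smul_apply]
  rw [this]
  refine sum_mem fun j _ => Submodule.smul_mem _ _ ?_
  rcases j with _ | j
  · have : (fun l : Fin n => iterComm (fieldOp (truncGerm X K)) (eulerOp N n) 0 (xcoord N l)) = 0 :=
      funext fun l => euler_xcoord l
    rw [this]
    exact zero_mem _
  · obtain ⟨v, hv, h⟩ := exists_iterComm_eq (e := e) hX K j
    rw [h]
    have : (fun l => fieldOp v (xcoord N l)) = v := funext fun l => fieldDeriv_xcoord v l
    rwa [this]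

theorem truncGerm_mem_vanishIdeal (X : (Fin N → ℕ) → Rn n → Rn n) (K : ℕ) (i : Fin n) :
    truncGerm X K i ∈ vanishIdeal (Rn N) (Rn n) 1 := by
  refine sum_mem fun k hk => sum_mem fun α hα => Ideal.mul_mem_right _ _ ?_
  refine vanishIdeal_anti ?_ (tmon_mem_vanishIdeal α)
  rw [(Finset.mem_piAntidiag.1 hα).1]
  exact (Finset.mem_Ico.1 hk).1

end

end Radon

namespace Radon

section

variable {N n ν : ℕ} {γ : Rn N → Rn n → Rn n}

/-! ### The finite type condition for exponential expansions -/

/-- Composition with `(t,x) ↦ (t, γ_t(x))`. -/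
noncomputable def shear (hγ : AnalyticAt ℝ (fun p : Rn N × Rn n => γ p.1 p.2) 0)
    (h00 : γ 0 0 = 0) : anGerm (Rn N × Rn n) →ₐ[ℝ] anGerm (Rn N × Rn n) :=
  pullback (fun p => (p.1, γ p.1 p.2)) (analyticAt_fst.prod hγ) (Prod.ext rfl h00)

/-- Composition with `γ` preserves the order of vanishing in `t`, since it has an inverse over each
`t`. -/
theorem shear_mem_vanishIdeal_iff (hγ : AnalyticAt ℝ (fun p : Rn N × Rn n => γ p.1 p.2) 0)
    (hγ₀ : ∀ᶠ x in 𝓝 (0 : Rn n), γ 0 x = x) (K : ℕ) (φ : anGerm (Rn N × Rn n)) :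
    shear hγ hγ₀.self_of_nhds φ ∈ vanishIdeal (Rn N) (Rn n) K ↔
      φ ∈ vanishIdeal (Rn N) (Rn n) K := by
  have ha : AnalyticAt ℝ (fun p : Rn N × Rn n => rep φ (p.1, γ p.1 p.2)) 0 :=
    (analyticAt_rep φ).comp_of_eq (f := fun p : Rn N × Rn n => (p.1, γ p.1 p.2))
      (analyticAt_fst.prod hγ) (Prod.ext rfl hγ₀.self_of_nhds)
  refine (germ_mem_vanishIdeal ha).trans ⟨?_, ?_⟩
  · rintro ⟨C, hC⟩
    refine ⟨C, ?_⟩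
    have hl : ∀ᶠ p in 𝓝 (0 : Rn N × Rn n), _ := isLocalInverse_localInverse hγ hγ₀
    filter_upwards [(tendsto_shear_localInverse hγ hγ₀).eventually hC, hl] with p h1 h2
    simpa only [h2.1] using h1
  · rintro ⟨C, hC⟩
    exact ⟨C, (tendsto_shear hγ hγ₀).eventually hC⟩

/-- The definition of `W`, read as an identity between germs: `W ∘ γ = e γ` for the Euler derivation
`e`. -/
theorem shear_fieldW (hγ : AnalyticAt ℝ (fun p : Rn N × Rn n => γ p.1 p.2) 0)
    (hγ₀ : ∀ᶠ x in 𝓝 (0 : Rn n), γ 0 x = x) (l : Fin n) :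
    shear hγ hγ₀.self_of_nhds (germ fun p => fieldW γ p.1 p.2 l) =
      euler N n (shear hγ hγ₀.self_of_nhds (xcoord N l)) := by
  have hγl := analyticAt_coord hγ l
  have h1 : shear hγ hγ₀.self_of_nhds (xcoord N l) = germ fun p => γ p.1 p.2 l :=
    pullback_germ _ _ (analyticAt_coord analyticAt_snd l)
  have h2 : shear hγ hγ₀.self_of_nhds (germ fun p => fieldW γ p.1 p.2 l) =
      germ fun p => fieldW γ p.1 (γ p.1 p.2) l :=
    pullback_germ _ _ (analyticAt_coord (analyticAt_fieldW hγ hγ₀) l)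
  rw [h1, h2, euler_germ hγl]
  refine germ_congr (analyticAt_clm_apply hγl.fderiv (analyticAt_fst.prod analyticAt_const)) ?_
  filter_upwards [fieldW_comp hγ hγ₀, hγ.eventually_analyticAt] with p h3 h4
  have := ((EuclideanSpace.proj (𝕜 := ℝ) (ι := Fin n) l).hasFDerivAt.comp p
    h4.differentiableAt.hasFDerivAt).fderiv
  rw [h3]
  exact (congrArg (fun L : Rn N × Rn n →L[ℝ] ℝ => L (p.1, 0)) this).symm

/-- If composition with `γ` agrees to every order with the exponential of `∑_α t ^ α X_α`, then `W`
satisfies the finite type condition for the `X_α`. Indeed `W ∘ γ = e γ` for the Euler derivation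
`e`, and `e` is moved past the exponential by means of commutators. -/
theorem finiteType_of_shear_sub_expTrunc_mem (e : Fin N → Fin ν → ℕ)
    (hγ : AnalyticAt ℝ (fun p : Rn N × Rn n => γ p.1 p.2) 0)
    (hγ₀ : ∀ᶠ x in 𝓝 (0 : Rn n), γ 0 x = x) {X : (Fin N → ℕ) → Rn n → Rn n}
    (hX : ∀ α, α ≠ 0 → AnalyticAt ℝ (X α) 0)
    (hexp : ∀ (K : ℕ) (φ : anGerm (Rn N × Rn n)), shear hγ hγ₀.self_of_nhds φ -
      expTrunc K (fieldOp (truncGerm X K)) φ ∈ vanishIdeal (Rn N) (Rn n) K) :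
    FiniteType e (fieldW γ) X := by
  have hW := analyticAt_fieldW hγ hγ₀
  have hS : ∀ Z ∈ {Z : FormalField n ν | ∃ α, α ≠ 0 ∧ Z = (X α, deg e α)},
      AnalyticAt ℝ Z.1 0 := by
    rintro _ ⟨α, hα, rfl⟩
    exact hX α hα
  refine finiteType_of_approx hX hW fun K => ?_
  obtain ⟨B, hB, hBv⟩ := exists_vecGerm_eq hS (sum_iterComm_xcoord_mem (e := e) hX K)
  refine ⟨B, hB, ?_⟩
  have hBa := analyticAt_of_mem_gradedSpan hS hB
  refine norm_le_of_vecGerm_mem (hW.sub hBa) fun l => ?_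
  have h1 : vecGerm (fun p : Rn N × Rn n => fieldW γ p.1 p.2 - B p) l =
      germ (fun p : Rn N × Rn n => fieldW γ p.1 p.2 l) - vecGerm B l :=
    germ_sub (analyticAt_coord hW l) (analyticAt_coord hBa l)
  refine (congrArg (· ∈ vanishIdeal (Rn N) (Rn n) K) h1).mpr ?_
  rw [hBv, ← shear_mem_vanishIdeal_iff hγ hγ₀, map_sub, shear_fieldW hγ hγ₀]
  set a := fieldOp (truncGerm X K) with ha
  set b := ∑ j ∈ Finset.range K, ((j.factorial : ℝ)⁻¹) • iterComm a (eulerOp N n) j with hb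
  have hao : RaisesOrder 1 a := raisesOrder_fieldDeriv (truncGerm_mem_vanishIdeal X K)
  have m1 : euler N n (shear hγ hγ₀.self_of_nhds (xcoord N l) - expTrunc K a (xcoord N l)) ∈
      vanishIdeal (Rn N) (Rn n) K := raisesOrder_euler K _ (hexp K _)
  have m2 : (eulerOp N n * expTrunc K a - expTrunc K a * b) (xcoord N l) ∈
      vanishIdeal (Rn N) (Rn n) K := by
    have := hao.mul_expTrunc_sub raisesOrder_euler K 0 _ (mem_vanishIdeal_zero (xcoord N l))
    rwa [zero_add] at this
  have m3 := hexp K (b (xcoord N l))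
  have := sub_mem (add_mem m1 m2) m3
  rw [map_sub] at this
  convert this using 1
  change _ = euler N n _ - euler N n _ + (euler N n _ - expTrunc K a (b (xcoord N l))) - _
  ring

/-- Composition with `γ` is, modulo `O(|t|^K)`, the truncated exponential of the derivation along `∑
t ^ α X_α`. Both are compared with the values at time `1` of the integral curves of that field. -/
theorem shear_sub_expTrunc_mem (hγ : AnalyticAt ℝ (fun p : Rn N × Rn n => γ p.1 p.2) 0)
    (h00 : γ 0 0 = 0) {X : (Fin N → ℕ) → Rn n → Rn n}
    (hX : HasExpExpansion γ X) (K : ℕ) (φ : anGerm (Rn N × Rn n)) :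
    shear hγ h00 φ - expTrunc K (fieldOp (truncGerm X K)) φ ∈ vanishIdeal (Rn N) (Rn n) K := by
  rcases Nat.eq_zero_or_pos K with rfl | hK
  · exact mem_vanishIdeal_zero _
  obtain ⟨hXa, hexp⟩ := hX
  obtain ⟨r, hr, C, hC⟩ := hexp K
  have hA := analyticAt_truncated hXa K
  obtain ⟨r', hr', C', hC'⟩ := exists_expTrunc_bound hA (fun i => by
    rw [vecGerm_truncated hXa]; exact truncGerm_mem_vanishIdeal X K i) K (analyticAt_rep φ)
  rw [vecGerm_truncated hXa, germ_rep] at hC'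
  have hφ := analyticAt_rep φ
  obtain ⟨L, s, hs, hL⟩ := (hφ.contDiffAt (n := 1)).exists_lipschitzOnWith
  obtain ⟨ρ, hρ, hρs⟩ := Metric.mem_nhds_iff.1 hs
  have hsh : AnalyticAt ℝ (fun p : Rn N × Rn n => rep φ (p.1, γ p.1 p.2)) 0 :=
    hφ.comp_of_eq (f := fun p : Rn N × Rn n => (p.1, γ p.1 p.2))
      (analyticAt_fst.prod hγ) (Prod.ext rfl h00)
  have hr1 : 0 < min (min r r') (min 1 (ρ / 2 / (|C| + 1))) := by positivity
  have hγt : Filter.Tendsto (fun p : Rn N × Rn n => γ p.1 p.2) (𝓝 0) (𝓝 0) := by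
    have := hγ.continuousAt.tendsto
    rwa [Prod.fst_zero, Prod.snd_zero, h00] at this
  refine ⟨L * C + C', ?_⟩
  filter_upwards [rep_sub (shear hγ h00 φ) (expTrunc K (fieldOp (truncGerm X K)) φ),
    rep_germ hsh, Metric.ball_mem_nhds (0 : Rn N × Rn n) hr1,
    hγt (Metric.ball_mem_nhds (0 : Rn n) (half_pos hρ))] with p h1 h2 h3 h4
  have h2' : rep (shear hγ h00 φ) p = rep φ (p.1, γ p.1 p.2) := h2
  rw [mem_ball_zero_iff, Prod.norm_def, max_lt_iff, lt_min_iff, lt_min_iff, lt_min_iff,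
    lt_min_iff, lt_min_iff, lt_min_iff] at h3
  obtain ⟨⟨⟨hpr, hpr'⟩, hp1, hpC⟩, ⟨hxr, hxr'⟩, -, -⟩ := h3
  obtain ⟨σ, hσ0, hσ, hb⟩ := hC p.1 hpr p.2 hxr
  have hb' := hC' p.1 hpr' p.2 hxr' σ hσ0 hσ
  have hg : ‖γ p.1 p.2‖ < ρ / 2 := by
    simpa using h4
  have hpC' : ‖p.1‖ * (|C| + 1) < ρ / 2 := (lt_div_iff₀ (by positivity)).1 hpC
  -- the end point `σ 1` stays in the neighbourhood where `φ` is Lipschitz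
  have hpow : ‖p.1‖ ^ K ≤ ‖p.1‖ := pow_le_of_le_one (norm_nonneg _) hp1.le hK.ne'
  have hd : ‖γ p.1 p.2 - σ 1‖ < ρ / 2 := by
    refine hb.trans_lt (lt_of_le_of_lt ?_ hpC')
    calc C * ‖p.1‖ ^ K ≤ |C| * ‖p.1‖ := mul_le_mul (le_abs_self C) hpow (by positivity)
          (abs_nonneg C)
      _ ≤ ‖p.1‖ * (|C| + 1) := by nlinarith [norm_nonneg p.1]
  have hσ1 : ‖σ 1‖ < ρ := by
    have := norm_sub_le (γ p.1 p.2) (γ p.1 p.2 - σ 1)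
    rw [sub_sub_cancel] at this
    linarith
  have hp1ρ : ‖p.1‖ < ρ := by nlinarith [norm_nonneg p.1, abs_nonneg C]
  have mem1 : (p.1, γ p.1 p.2) ∈ s := hρs (by
    rw [mem_ball_zero_iff, Prod.norm_def]
    exact max_lt hp1ρ (hg.trans (half_lt_self hρ)))
  have mem2 : (p.1, σ 1) ∈ s := hρs (by
    rw [mem_ball_zero_iff, Prod.norm_def]
    exact max_lt hp1ρ hσ1)
  have hlip : |rep φ (p.1, γ p.1 p.2) - rep φ (p.1, σ 1)| ≤ L * (C * ‖p.1‖ ^ K) := by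
    have := hL.dist_le_mul _ mem1 _ mem2
    rw [Real.dist_eq, dist_eq_norm] at this
    refine this.trans ?_
    gcongr
    refine le_trans (le_of_eq ?_) hb
    simp [Prod.norm_def]
  rw [h1, h2', add_mul]
  refine (abs_sub_le _ (rep φ (p.1, σ 1)) _).trans (add_le_add ?_ hb')
  rw [mul_assoc]
  exact hlip

/-! ### Existence of the exponential expansion -/

/-- The integral curves near `0` of a vector field that vanishes at `t = 0` exist for time `1` when
`t` is small. -/
theorem exists_isIntegralCurveOn_Icc {A : Rn N × Rn n → Rn n} (hA : AnalyticAt ℝ A 0)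
    (hA1 : ∀ i, vecGerm A i ∈ vanishIdeal (Rn N) (Rn n) 1) :
    ∃ r > 0, ∀ t : Rn N, ‖t‖ < r → ∀ x : Rn n, ‖x‖ < r → ∃ σ : ℝ → Rn n, σ 0 = x ∧
      IsIntegralCurveOn σ (fun _ y => A (t, y)) (Set.Icc 0 1) := by
  obtain ⟨D, hD⟩ := norm_le_of_vecGerm_mem hA hA1
  obtain ⟨L, s, hs, hL⟩ := (hA.contDiffAt (n := 1)).exists_lipschitzOnWith
  obtain ⟨ρ, hρ, H⟩ := Metric.eventually_nhds_iff_ball.1 (hD.and hs)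
  have hr : 0 < min (ρ / 2) (ρ / 4 / (|D| + 1)) := by positivity
  refine ⟨_, hr, fun t ht x hx => ?_⟩
  have ht1 : ‖t‖ < ρ / 2 := ht.trans_le (min_le_left _ _)
  have ht2 : ‖t‖ * (|D| + 1) < ρ / 4 :=
    (lt_div_iff₀ (by positivity)).1 (ht.trans_le (min_le_right _ _))
  have hx1 : ‖x‖ < ρ / 2 := hx.trans_le (min_le_left _ _)
  let c : NNReal := ⟨ρ / 4, by positivity⟩
  have hball : ∀ y ∈ Metric.closedBall x (c : ℝ), (t, y) ∈ Metric.ball (0 : Rn N × Rn n) ρ := by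
    intro y hy
    rw [mem_ball_zero_iff, Prod.norm_def]
    refine max_lt (ht1.trans (half_lt_self hρ)) ?_
    have h1 : ‖y - x‖ ≤ ρ / 4 := by
      rw [← dist_eq_norm]; exact hy
    have h2 := norm_le_norm_add_norm_sub' y x
    change ‖y‖ < ρ
    linarith
  have hPL : IsPicardLindelof (fun (_ : ℝ) y => A (t, y)) (tmin := 0) (tmax := 1)
      ⟨0, by simp⟩ x c 0 c L :=
    { lipschitzOnWith := fun _ _ => LipschitzOnWith.of_dist_le_mul fun y hy z hz => by
        refine (hL.dist_le_mul _ (H _ (hball y hy)).2 _ (H _ (hball z hz)).2).trans (le_of_eq ?_)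
        rw [Prod.dist_eq]
        simp
      continuousOn := fun _ _ => continuousOn_const
      norm_le := fun _ _ y hy => by
        refine (H _ (hball y hy)).1.trans ?_
        rw [pow_one]
        change D * ‖t‖ ≤ ρ / 4
        nlinarith [le_abs_self D, norm_nonneg t]
      mul_max_le := by simp }
  exact hPL.exists_eq_forall_mem_Icc_hasDerivWithinAt₀

end

end Radon

namespace Radon

section

variable {N n ν : ℕ} {γ : Rn N → Rn n → Rn n}

theorem iterPartialT_mem_vanishIdeal {m : ℕ} (β : Fin N → ℕ) {φ : anGerm (Rn N × Rn n)}
    (h : φ ∈ vanishIdeal (Rn N) (Rn n) (m + ∑ j, β j)) :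
    iterPartialT β φ ∈ vanishIdeal (Rn N) (Rn n) m := by
  have step : ∀ (j : Fin N) (k m : ℕ) (φ : anGerm (Rn N × Rn n)),
      φ ∈ vanishIdeal (Rn N) (Rn n) (m + k) →
      (partialT N n j)^[k] φ ∈ vanishIdeal (Rn N) (Rn n) m := by
    intro j k
    induction k with
    | zero => exact fun _ _ h => h
    | succ k ih =>
      intro m φ h
      rw [Function.iterate_succ_apply]
      exact ih _ _ (dirDeriv_fst_mem_vanishIdeal _ h)
  have key : ∀ (l : List (Fin N)) (m : ℕ), φ ∈ vanishIdeal (Rn N) (Rn n) (m + (l.map β).sum) →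
      l.foldr (fun j ψ => (partialT N n j)^[β j] ψ) φ ∈ vanishIdeal (Rn N) (Rn n) m := by
    intro l
    induction l with
    | nil => exact fun _ h => h
    | cons j l ih =>
      intro m h
      rw [List.map_cons, List.sum_cons, ← add_assoc] at h
      exact step j _ _ _ (ih _ h)
  refine key _ m ?_
  rwa [← List.ofFn_eq_map, List.sum_ofFn]

/-- The leading term in the Taylor expansion of a germ that is `O(|t|^M)`. -/
theorem sub_leading_mem_vanishIdeal {M : ℕ} {φ : anGerm (Rn N × Rn n)}
    (h : φ ∈ vanishIdeal (Rn N) (Rn n) M) :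
    φ - ∑ α ∈ Finset.piAntidiag (Finset.univ : Finset (Fin N)) M,
      tmon n α * ofX N n (taylorCoeff α φ) ∈ vanishIdeal (Rn N) (Rn n) (M + 1) := by
  have h1 := sub_taylor_mem_vanishIdeal (M + 1) φ
  rw [Finset.sum_range_succ, Finset.sum_eq_zero, zero_add] at h1
  · exact h1
  · intro k hk
    refine Finset.sum_eq_zero fun α hα => ?_
    have hαk : ∑ j, α j = k := (Finset.mem_piAntidiag.1 hα).1
    have h2 : iterPartialT α φ ∈ vanishIdeal (Rn N) (Rn n) 1 := by
      refine iterPartialT_mem_vanishIdeal α (vanishIdeal_anti ?_ h)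
      have := Finset.mem_range.1 hk
      omega
    rw [taylorCoeff, atZero_of_mem_vanishIdeal h2, smul_zero, map_zero, mul_zero]

/-- In the expansion of `(a + z) ^ (k + 1) - a ^ (k + 1)` every term has a factor `z` and `k`
further factors that each raise the order by at least one. -/
theorem RaisesOrder.add_pow_sub {M : ℕ} (hM : 1 ≤ M)
    {a z : Module.End ℝ (anGerm (Rn N × Rn n))} (ha : RaisesOrder 1 a) (hz : RaisesOrder M z)
    (k : ℕ) : RaisesOrder (M + k) ((a + z) ^ (k + 1) - a ^ (k + 1)) := by
  induction k with
  | zero => simpa using hz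
  | succ k ih =>
    have e : (a + z) ^ (k + 1 + 1) - a ^ (k + 1 + 1) =
        (a + z) * ((a + z) ^ (k + 1) - a ^ (k + 1)) + z * a ^ (k + 1) := by
      rw [pow_succ' (a + z) (k + 1), pow_succ' a (k + 1), mul_sub, add_mul a z (a ^ (k + 1))]
      abel
    rw [e]
    refine RaisesOrder.add ?_ (hz.mul (ha.pow _))
    have := (ha.add (hz.anti hM)).mul ih
    rwa [add_comm 1, add_assoc] at this

/-- To first order in a perturbation `z` that raises the order by `M`, the exponential changes by
`z`. -/
theorem expTrunc_add_sub_mem {M : ℕ} (hM : 1 ≤ M)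
    {a z : Module.End ℝ (anGerm (Rn N × Rn n))} (ha : RaisesOrder 1 a) (hz : RaisesOrder M z)
    (φ : anGerm (Rn N × Rn n)) :
    expTrunc (M + 1) (a + z) φ - expTrunc (M + 1) a φ - z φ ∈
      vanishIdeal (Rn N) (Rn n) (M + 1) := by
  obtain ⟨m, rfl⟩ := Nat.exists_eq_add_of_le' hM
  have e : expTrunc (m + 1 + 1) (a + z) φ - expTrunc (m + 1 + 1) a φ - z φ =
      ∑ k ∈ Finset.range m, (((k + 1 + 1).factorial : ℝ)⁻¹) •
        ((a + z) ^ (k + 1 + 1) - a ^ (k + 1 + 1)) φ := by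
    rw [expTrunc_apply, expTrunc_apply, ← Finset.sum_sub_distrib, Finset.sum_range_succ',
      Finset.sum_range_succ']
    simp only [LinearMap.sub_apply, smul_sub, LinearMap.add_apply, zero_add, pow_one, pow_zero,
      Nat.factorial_one, Nat.cast_one, inv_one, one_smul, Nat.factorial_zero, sub_self, add_zero,
      add_sub_cancel_left, add_sub_cancel_right]
  rw [e]
  refine sum_mem fun k _ => smul_mem_vanishIdeal _ ?_
  have := ((ha.add_pow_sub hM hz (k + 1)).anti (m' := m + 1 + 1) (by omega)) 0 φ
    (mem_vanishIdeal_zero φ)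
  rwa [zero_add] at this

/-- The vector fields of the exponential expansion of `γ`, by recursion on the order: those of order
`M` are the coefficients of the leading term of the difference between `γ` and the exponential of
the terms of order less than `M`. -/
noncomputable def expFields (γ : Rn N → Rn n → Rn n) : ℕ → (Fin N → ℕ) → Rn n → Rn n
  | 0 => fun _ _ => 0
  | M + 1 => fun α => if ∑ j, α j = M then
      fun x => WithLp.toLp 2 fun l => rep (taylorCoeff α (germ (fun p => γ p.1 p.2 l) -
        expTrunc (M + 1) (fieldOp (truncGerm (expFields γ M) M)) (xcoord N l))) x
    else expFields γ M α

theorem expFields_succ (γ : Rn N → Rn n → Rn n) (M : ℕ) (α : Fin N → ℕ) :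
    expFields γ (M + 1) α = if ∑ j, α j = M then
      fun x => WithLp.toLp 2 fun l => rep (taylorCoeff α (germ (fun p => γ p.1 p.2 l) -
        expTrunc (M + 1) (fieldOp (truncGerm (expFields γ M) M)) (xcoord N l))) x
    else expFields γ M α := rfl

theorem analyticAt_expFields (γ : Rn N → Rn n → Rn n) (M : ℕ) (α : Fin N → ℕ) :
    AnalyticAt ℝ (expFields γ M α) 0 := by
  induction M with
  | zero => exact analyticAt_const
  | succ M ih =>
    rw [expFields_succ]
    split_ifs
    · exact analyticAt_of_coord fun l => analyticAt_rep _
    · exact ih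

/-- The field of index `α` is not changed after step `|α| + 1` of the recursion. -/
theorem expFields_eq (γ : Rn N → Rn n → Rn n) {M : ℕ} {α : Fin N → ℕ} (h : ∑ j, α j < M) :
    expFields γ M α = expFields γ (∑ j, α j + 1) α := by
  induction M with
  | zero => omega
  | succ M ih =>
    rcases Nat.lt_succ_iff_lt_or_eq.1 h with h1 | h1
    · rw [← ih h1]
      conv_lhs => rw [expFields_succ, if_neg h1.ne]
    · rw [h1]

theorem truncGerm_congr {X Y : (Fin N → ℕ) → Rn n → Rn n} {K : ℕ}
    (h : ∀ α, ∑ j, α j < K → X α = Y α) : truncGerm X K = truncGerm Y K := by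
  rw [truncGerm_eq_sum, truncGerm_eq_sum]
  refine Finset.sum_congr rfl fun k hk => Finset.sum_congr rfl fun α hα => ?_
  rw [h α]
  rw [(Finset.mem_piAntidiag.1 hα).1]
  exact (Finset.mem_Ico.1 hk).2

/-- The terms of order less than `M` reproduce `γ` up to `O(|t|^M)`. Adding the leading term of the
error to the exponent removes it, by `expTrunc_add_sub_mem`. -/
theorem germ_sub_expTrunc_expFields_mem
    (hγ : AnalyticAt ℝ (fun p : Rn N × Rn n => γ p.1 p.2) 0)
    (hγ₀ : ∀ᶠ x in 𝓝 (0 : Rn n), γ 0 x = x) (M : ℕ) (l : Fin n) :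
    germ (fun p => γ p.1 p.2 l) -
      expTrunc M (fieldOp (truncGerm (expFields γ M) M)) (xcoord N l) ∈
      vanishIdeal (Rn N) (Rn n) M := by
  rcases Nat.eq_zero_or_pos M with rfl | hM
  · exact mem_vanishIdeal_zero _
  induction M, hM using Nat.le_induction generalizing l with
  | base =>
    have e : expTrunc 1 (fieldOp (truncGerm (expFields γ 1) 1)) (xcoord N l) = xcoord N l := by
      simp [expTrunc_apply]
    have h1 : germ (fun p => γ p.1 p.2 l) - xcoord N l ∈ vanishIdeal (Rn N) (Rn n) (0 + 1) := by
      refine mem_vanishIdeal_succ ?_ fun j => mem_vanishIdeal_zero _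
      have hγl := analyticAt_coord hγ l
      rw [map_sub, atZero_germ hγl, xcoord_eq, atZero_ofX, sub_eq_zero]
      exact germ_congr (analyticAt_coord analyticAt_id l)
        (hγ₀.mono fun x hx => congrArg (· l) hx)
    rw [← e] at h1
    exact h1
  | succ M hM ih =>
    set A := truncGerm (expFields γ M) M with hA
    have hM1 : 1 ≤ M := hM
    have hao : RaisesOrder 1 (fieldOp A) := raisesOrder_fieldDeriv (truncGerm_mem_vanishIdeal _ M)
    set ψ : Fin n → anGerm (Rn N × Rn n) := fun l => germ (fun p => γ p.1 p.2 l) -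
      expTrunc (M + 1) (fieldOp A) (xcoord N l) with hψ
    have hψM : ∀ l, ψ l ∈ vanishIdeal (Rn N) (Rn n) M := fun l => by
      have h1 : ψ l = (germ (fun p => γ p.1 p.2 l) - expTrunc M (fieldOp A) (xcoord N l)) -
          ((M.factorial : ℝ)⁻¹) • (fieldOp A ^ M) (xcoord N l) := by
        simp only [hψ, expTrunc_apply, Finset.sum_range_succ, sub_sub]
      rw [h1]
      refine sub_mem (ih l) (smul_mem_vanishIdeal _ ?_)
      have := hao.pow M 0 _ (mem_vanishIdeal_zero (xcoord N l))
      rwa [zero_add] at this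
    set z : Fin n → anGerm (Rn N × Rn n) := fun l =>
      ∑ α ∈ Finset.piAntidiag (Finset.univ : Finset (Fin N)) M,
        tmon n α * ofX N n (taylorCoeff α (ψ l)) with hz
    have hzo : RaisesOrder M (fieldOp z) := raisesOrder_fieldDeriv fun l =>
      sum_mem fun α hα => Ideal.mul_mem_right _ _ (by
        have := tmon_mem_vanishIdeal (n := n) α
        rwa [(Finset.mem_piAntidiag.1 hα).1] at this)
    have hsplit : truncGerm (expFields γ (M + 1)) (M + 1) = A + z := by
      funext l
      rw [Pi.add_apply, truncGerm, Finset.sum_Ico_succ_top hM1]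
      congr 1
      · rw [hA, truncGerm]
        refine Finset.sum_congr rfl fun k hk => Finset.sum_congr rfl fun α hα => ?_
        have : ∑ j, α j ≠ M := by
          rw [(Finset.mem_piAntidiag.1 hα).1]
          exact (Finset.mem_Ico.1 hk).2.ne
        rw [expFields_succ, if_neg this]
      · refine Finset.sum_congr rfl fun α hα => ?_
        rw [expFields_succ, if_pos (Finset.mem_piAntidiag.1 hα).1]
        simp only [germ_rep]
        rfl
    have hop : fieldOp (A + z) = fieldOp A + fieldOp z := by
      rw [fieldOp, fieldDeriv_add]
      rfl
    have hzl : fieldOp z (xcoord N l) = z l := fieldDeriv_xcoord z l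
    have m1 := sub_leading_mem_vanishIdeal (hψM l)
    have m2 := expTrunc_add_sub_mem hM1 hao hzo (xcoord N l)
    rw [hsplit, hop]
    have := sub_mem m1 m2
    rw [hzl] at this
    convert this using 1
    simp only [hψ, hz]
    ring

/-- The fields `expFields` form the exponential expansion of `γ`: the truncated exponential, applied
to the coordinates, approximates the flow as well as it approximates `γ`. -/
theorem exists_hasExpExpansion (hγ : AnalyticAt ℝ (fun p : Rn N × Rn n => γ p.1 p.2) 0)
    (hγ₀ : ∀ᶠ x in 𝓝 (0 : Rn n), γ 0 x = x) : ∃ X, HasExpExpansion γ X := by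
  let X : (Fin N → ℕ) → Rn n → Rn n := fun α => expFields γ (∑ j, α j + 1) α
  have hX : ∀ α, α ≠ 0 → AnalyticAt ℝ (X α) 0 := fun α _ => analyticAt_expFields γ _ α
  refine ⟨X, hX, fun M => ?_⟩
  have hA := analyticAt_truncated hX M
  have hAg := vecGerm_truncated hX M
  have hA1 : ∀ i, vecGerm (fun p : Rn N × Rn n => truncated X M p.1 p.2) i ∈
      vanishIdeal (Rn N) (Rn n) 1 := fun i => by
    rw [hAg]; exact truncGerm_mem_vanishIdeal X M i
  obtain ⟨r₁, hr₁, h₁⟩ := exists_isIntegralCurveOn_Icc hA hA1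
  have hx : ∀ l : Fin n, AnalyticAt ℝ (fun p : Rn N × Rn n => p.2 l) 0 := fun l =>
    analyticAt_coord analyticAt_snd l
  choose r₂ hr₂ C₂ h₂ using fun l => exists_expTrunc_bound hA hA1 M (hx l)
  have h₃ : ∀ l, ∃ C, ∀ᶠ p in 𝓝 (0 : Rn N × Rn n), |rep (germ (fun p => γ p.1 p.2 l) -
      expTrunc M (fieldOp (truncGerm X M)) (xcoord N l)) p| ≤ C * ‖p.1‖ ^ M := fun l => by
    have := germ_sub_expTrunc_expFields_mem hγ hγ₀ M l
    rw [truncGerm_congr (Y := X) fun α hα => expFields_eq γ hα] at this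
    exact this
  choose C₃ hC₃ using h₃
  rw [hAg] at h₂
  have hrep : ∀ l, ∀ᶠ p in 𝓝 (0 : Rn N × Rn n), rep (germ (fun p => γ p.1 p.2 l) -
      expTrunc M (fieldOp (truncGerm X M)) (xcoord N l)) p =
      γ p.1 p.2 l - rep (expTrunc M (fieldOp (truncGerm X M)) (xcoord N l)) p := fun l => by
    filter_upwards [rep_sub (germ fun p => γ p.1 p.2 l)
      (expTrunc M (fieldOp (truncGerm X M)) (xcoord N l)), rep_germ (analyticAt_coord hγ l)]
      with p e1 e2
    rw [e1, e2]
  obtain ⟨r₃, hr₃, H⟩ := Metric.eventually_nhds_iff_ball.1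
    ((Filter.eventually_all.2 hC₃).and (Filter.eventually_all.2 hrep))
  obtain ⟨r₄, hr₄, h₄⟩ : ∃ r > 0, ∀ l, r ≤ r₂ l := by
    have : ∀ᶠ r in 𝓝[>] (0 : ℝ), ∀ l, r ≤ r₂ l := Filter.eventually_all.2 fun l =>
      nhdsWithin_le_nhds (Iic_mem_nhds (hr₂ l))
    obtain ⟨r, h, hr⟩ := (this.and self_mem_nhdsWithin).exists
    exact ⟨r, hr, h⟩
  refine ⟨min r₁ (min r₃ r₄), by positivity, ∑ l, (C₃ l + C₂ l), fun t ht x hxr => ?_⟩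
  rw [lt_min_iff, lt_min_iff] at ht hxr
  obtain ⟨σ, hσ0, hσ⟩ := h₁ t ht.1 x hxr.1
  refine ⟨σ, hσ0, hσ, ?_⟩
  have hsum : γ t x - σ 1 = ∑ l, EuclideanSpace.single l ((γ t x - σ 1) l) := by
    ext k
    simp [Finset.sum_apply, Pi.single_apply]
  rw [hsum, Finset.sum_mul]
  refine (norm_sum_le _ _).trans (Finset.sum_le_sum fun l _ => ?_)
  have hmem : (t, x) ∈ Metric.ball (0 : Rn N × Rn n) r₃ := by
    rw [mem_ball_zero_iff, Prod.norm_def]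
    exact max_lt ht.2.1 hxr.2.1
  have b1 := (H _ hmem).1 l
  rw [(H _ hmem).2 l] at b1
  have b2 := h₂ l t (ht.2.2.trans_le (h₄ l)) x (hxr.2.2.trans_le (h₄ l)) σ hσ0 hσ
  rw [abs_sub_comm] at b2
  rw [PiLp.norm_single, add_mul]
  exact (abs_sub_le _ _ _).trans (add_le_add b1 b2)

end

end Radon

/-- For real analytic `γ`, both finite type conditions hold: the one for the Taylor coefficients
of `W`, and the one for the vector fields `X_α` of the exponential expansion of `γ` (which
exists). -/
theorem proposition8p9 {N n ν : ℕ} (e : Fin N → Fin ν → ℕ) (he : ∀ j, e j ≠ 0)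
    (γ : Radon.Rn N → Radon.Rn n → Radon.Rn n)
    (hγ : AnalyticAt ℝ (fun p : Radon.Rn N × Radon.Rn n => γ p.1 p.2) (0, 0))
    (hγ₀ : ∀ᶠ x in nhds (0 : Radon.Rn n), γ 0 x = x) :
    Radon.FiniteType e (Radon.fieldW γ) (Radon.taylorField (Radon.fieldW γ)) ∧
    (∃ X : (Fin N → ℕ) → Radon.Rn n → Radon.Rn n, Radon.HasExpExpansion γ X) ∧
    ∀ X : (Fin N → ℕ) → Radon.Rn n → Radon.Rn n, Radon.HasExpExpansion γ X →
      Radon.FiniteType e (Radon.fieldW γ) X :=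
  ⟨Radon.finiteType_taylorField e (Radon.analyticAt_fieldW hγ hγ₀) (Radon.fieldW_zero γ),
    Radon.exists_hasExpExpansion hγ hγ₀, fun _ hX =>
    Radon.finiteType_of_shear_sub_expTrunc_mem e hγ hγ₀ hX.1
      (Radon.shear_sub_expTrunc_mem hγ hγ₀.self_of_nhds hX)⟩
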